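/- Let $n\ge 2$. For $\mathbf a=(a_1,\dots,a_n)\in L^2_{loc}(\mathbb R^n)^n$ real-valued, put $L_j=\frac1i\frac{\partial}{\partial x_j}-a_j$, $Lu=(L_1u,\dots,L_nu)$ (derivatives in the sense of distributions), $|Lu|=(\sum_j|L_ju|^2)^{1/2}$, and let $B=(b_{jk})$, $b_{jk}=\frac{\partial a_j}{\partial x_k}-\frac{\partial a_k}{\partial x_j}$, be the distributional curl of $\mathbf a$, with $|B|=\sum_{j,k}|b_{jk}|$. Cubes have sides parallel to the axes. There is a number $N$ depending only on $n$ such that the following holds. Let $1\le p<2$. Let $V$ be a weight in the Muckenhoupt class $A_\infty=\bigcup_{r>1}A_r$ on $\mathbb R^n$, and suppose that $B$ is a locally integrable function and that for some constant $C_0$ $$\operatorname*{ess\,sup}_{Q}|B|\le \frac{C_0}{|Q|}\int_Q V\quad\text{for every cube }Q.$$ Then there is a constant $C>0$, depending only on $n$, $p$, $C_0$ and the $A_\infty$ data of $V$ (an exponent $1<r<\infty$ and an upper bound for the $A_r$ constant of $V$), such that for every $f\in C_0^\infty(\mathbb R^n)$ and every $\alpha>0$ there are an (at most countable, possibly empty)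 collection of cubes $(Q_k)$ with sidelengths $R_k>0$ and functions $g$, $b_k$, with $b_k=0$ outside $Q_k$ and with $Lg$, $Lb_k$ locally integrable functions, such that $$f=g+\sum_k b_k,$$ $$\|Lg\|_\infty\le C\alpha,\qquad \|Lg\|_2+\|V^{1/2}g\|_2\le C\alpha^{1-\frac p2}\big(\|Lf\|_p+\|V^{1/2}f\|_p\big)^{p/2},$$ $$\int_{Q_k}|Lb_k|^p+R_k^{-p}|b_k|^p\le C\alpha^p|Q_k|\quad\text{for all }k,$$ $$\sum_k|Q_k|\le C\alpha^{-p}\int_{\mathbb R^n}|Lf|^p+|V^{1/2}f|^p,\qquad \sum_k\mathbf 1_{Q_k}\le N.$$ -/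

import Mathlib

open MeasureTheory
open scoped ENNReal ContDiff

namespace MagneticCZ

noncomputable section

/-- Euclidean space `ℝⁿ`. -/
abbrev E (n : ℕ) : Type := EuclideanSpace ℝ (Fin n)

/-- The closed cube with centre `c`, sidelength `R` and sides parallel to the axes. -/
def cube {n : ℕ} (c : E n) (R : ℝ) : Set (E n) :=
  {x | ∀ i, |x i - c i| ≤ R / 2}

/-- The partial derivative `∂ψ/∂x_j`. -/
def partialDeriv {n : ℕ} {F : Type} [NormedAddCommGroup F] [NormedSpace ℝ F]
    (j : Fin n) (ψ : E n → F) (x : E n) : F :=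
  fderiv ℝ ψ x (EuclideanSpace.single j 1)

/-- `ψ ∈ C₀^∞(ℝⁿ)`. -/
def IsTest {n : ℕ} {F : Type} [NormedAddCommGroup F] [NormedSpace ℝ F] (ψ : E n → F) : Prop :=
  ContDiff ℝ ∞ ψ ∧ HasCompactSupport ψ

/-- `a ∈ L²_loc(ℝⁿ)ⁿ`. -/
def IsL2Loc {n : ℕ} (a : E n → E n) : Prop :=
  ∀ K : Set (E n), IsCompact K → MemLp a 2 (volume.restrict K)

/-- `V` is a Muckenhoupt weight of class `A_r`, `1 < r < ∞`, with `A_r` constant at most `A`.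
The class `A_∞` is the union of these classes over `r > 1` and `A` (recall `A_1 ⊆ A_2`). -/
def IsMuckenhoupt {n : ℕ} (r A : ℝ) (V : E n → ℝ) : Prop :=
  (∀ᵐ x, 0 < V x) ∧ LocallyIntegrable V ∧
    ∀ (c : E n) (R : ℝ), 0 < R →
      (⨍⁻ x in cube c R, ENNReal.ofReal (V x) ∂volume) *
        (⨍⁻ x in cube c R, ENNReal.ofReal (V x) ^ (-(1 / (r - 1))) ∂volume) ^ (r - 1)
          ≤ ENNReal.ofReal A

/-- `B = curl a` in the sense of distributions: `b_{jk} = ∂a_j/∂x_k - ∂a_k/∂x_j`, where the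
entries of `B` are locally integrable functions. -/
def IsCurl {n : ℕ} (a : E n → E n) (B : E n → Matrix (Fin n) (Fin n) ℝ) : Prop :=
  ∀ j k, LocallyIntegrable (fun x => B x j k) ∧
    ∀ ψ : E n → ℝ, IsTest ψ →
      ∫ x, B x j k * ψ x = -∫ x, (a x j * partialDeriv k ψ x - a x k * partialDeriv j ψ x)

/-- `|B(x)| = ∑_{j,k} |b_{jk}(x)|`. -/
def absField {n : ℕ} (B : E n → Matrix (Fin n) (Fin n) ℝ) (x : E n) : ℝ :=
  ∑ j, ∑ k, |B x j k|

/-- `sup_Q |B| ≤ C₀ ⨍_Q V` for every cube `Q`; as `B` is defined almost everywhere, the supremum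
is the essential one. -/
def FieldControlled {n : ℕ} (C₀ : ℝ) (B : E n → Matrix (Fin n) (Fin n) ℝ) (V : E n → ℝ) : Prop :=
  ∀ (c : E n) (R : ℝ), 0 < R →
    ∀ᵐ x ∂(volume.restrict (cube c R)), absField B x ≤ C₀ * ⨍ y in cube c R, V y ∂volume

/-- `Lu = (L_1 u, …, L_n u)` with `L_j u = (1/i) ∂u/∂x_j - a_j u`, for differentiable `u`. -/
def magGrad {n : ℕ} (a : E n → E n) (u : E n → ℂ) (x : E n) : EuclideanSpace ℂ (Fin n) :=
  WithLp.toLp 2 fun j => 1 / Complex.I * partialDeriv j u x - (a x j : ℂ) * u x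

/-- `w = Lu` in the sense of distributions, all terms being locally integrable functions. -/
def IsWeakMagGrad {n : ℕ} (a : E n → E n) (u : E n → ℂ)
    (w : E n → EuclideanSpace ℂ (Fin n)) : Prop :=
  LocallyIntegrable u ∧ (∀ j, LocallyIntegrable fun x => (a x j : ℂ) * u x) ∧
    LocallyIntegrable w ∧
    ∀ j, ∀ ψ : E n → ℂ, IsTest ψ →
      ∫ x, w x j * ψ x =
        ∫ x, (-(1 / Complex.I) * (u x * partialDeriv j ψ x) - (a x j : ℂ) * u x * ψ x)

/-- The function `V^{1/2} u`. -/
def sqrtMul {n : ℕ} (V : E n → ℝ) (u : E n → ℂ) (x : E n) : ℂ :=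
  (Real.sqrt (V x) : ℂ) * u x

end

end MagneticCZ

namespace MagneticCZ

/-! ### Axis-parallel cubes in Euclidean space: geometry and volume. -/

section Cubes

variable {n : ℕ}

/-! This is a Calderón–Zygmund decomposition at the level of gradients. Let w = |Lf|^p +
|V^{1/2}f|^p (`energyDensity`), let Ω be the set where the maximal function of w exceeds α^p, and
cover Ω by Whitney cubes Q_k with a smooth partition of unity χ_k. The doubled cube of Q_k lies in a
ball of comparable volume which is not contained in Ω, so ∫ w over the doubled cube is at most a
constant times α^p |Q_k|. The operator L does not annihilate constants, so the usual subtraction of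
a mean is replaced by the subtraction of a transported constant P_k = z_k e^{iφ_k}, and b_k = (f -
P_k) χ_k.

The phases come from the Poincaré gauge. On a cube Q with centre c and side R one writes a = ∇φ + h,
where h is an integral of B along the rays from c. Hence |h| ≲ R sup |B| ≲ R v, with v the mean of V
over the doubled cube, and L e^{iφ} = -h e^{iφ}. Since a is only locally square integrable, this is
done for mollifications of a; after normalisation the phases converge in L¹(Q)
(`IsCurl.exists_gaugeData`, `GaugeData.integral_phase`).

The size of f is controlled by a Fefferman–Phong inequality, min(v^{1/2}, R⁻¹)^p ∫ |f|^p ≲ ∫ w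
(`IsMuckenhoupt.fefferman_phong`). The A_r condition makes V comparable from below to its mean on
half of the cube, and the diamagnetic inequality gives a Poincaré inequality for |f|. The choice of
z in `exists_local_approximation` then splits into two cases. If R v^{1/2} is small, z is the mean
of e^{-iφ} f: the term |h| |f| in the gauged Poincaré inequality is harmless, and |z| v^{1/2} ≲ α,
which yields both |z| |h| ≲ α and |z|² ∫_Q V ≲ α² |Q|. If R v^{1/2} is large, then z = 0, because
the inequality already bounds ∫_Q |f|^p by (αR)^p |Q| up to a constant.

In Ω one has g = ∑ χ_k P_k and Lg = -∑ χ_k P_k h_k + (1/i) ∑ (P_k - P_l) ∇χ_k for any fixed l. The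
first sum is ≲ α. The second requires a pointwise bound for P_k - P_l, although both are close to f
only in L^p. On the overlap the gradient of φ_k - φ_l is h_l - h_k, so |P_k - P_l| is Lipschitz with
constant min(|z_k|, |z_l|)(sup |h_k| + sup |h_l|) ≲ α, and an L^p bound on a common ball becomes a
pointwise one (`norm_phase_sub_phase_le_of_ball`). Outside Ω, g = f and w ≤ α^p almost everywhere,
so squares are at most α^{2-p} w. Together with the weak type bound |Ω| ≲ α^{-p} ∫ w this gives the
L² estimates. -/

lemma norm_le_card_mul {x : E n} {M : ℝ} (hM : 0 ≤ M) (h : ∀ i, |x i| ≤ M) : ‖x‖ ≤ n * M := by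
  rw [EuclideanSpace.norm_eq]
  apply Real.sqrt_le_iff.2 ⟨by positivity, ?_⟩
  calc ∑ i, ‖x i‖ ^ 2 ≤ ∑ _i : Fin n, M ^ 2 := by
        gcongr with i
        exact h i
    _ = n * M ^ 2 := by simp
    _ ≤ (n * M) ^ 2 := by
        rw [mul_pow]
        gcongr
        exact_mod_cast Nat.le_self_pow (by norm_num) n

lemma isClosed_cube (c : E n) (R : ℝ) : IsClosed (cube c R) := by
  have : cube c R = ⋂ i, {x : E n | |x i - c i| ≤ R / 2} := by ext; simp [cube]
  rw [this]
  exact isClosed_iInter fun i => isClosed_le (by fun_prop) continuous_const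

lemma measurableSet_cube (c : E n) (R : ℝ) : MeasurableSet (cube c R) :=
  (isClosed_cube c R).measurableSet

lemma convex_cube (c : E n) (R : ℝ) : Convex ℝ (cube c R) := by
  intro x hx y hy s t hs ht hst i
  have h1 := hx i
  have h2 := hy i
  have : (s • x + t • y) i - c i = s * (x i - c i) + t * (y i - c i) := by
    simp only [PiLp.add_apply, PiLp.smul_apply, smul_eq_mul]
    linear_combination (c i) * hst
  rw [this]
  calc |s * (x i - c i) + t * (y i - c i)| ≤ s * |x i - c i| + t * |y i - c i| := by
        refine (abs_add_le _ _).trans ?_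
        rw [abs_mul, abs_mul, abs_of_nonneg hs, abs_of_nonneg ht]
    _ ≤ s * (R / 2) + t * (R / 2) := by gcongr
    _ = R / 2 := by rw [← add_mul, hst, one_mul]

lemma cube_subset_closedBall (c : E n) {R : ℝ} (hR : 0 ≤ R) :
    cube c R ⊆ Metric.closedBall c (n * (R / 2)) := by
  intro x hx
  rw [mem_closedBall_iff_norm]
  exact norm_le_card_mul (by positivity) fun i => by simpa using hx i

lemma closedBall_subset_cube (c : E n) (R : ℝ) : Metric.closedBall c (R / 2) ⊆ cube c R := by
  intro x hx i
  rw [mem_closedBall_iff_norm] at hx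
  have := (PiLp.norm_apply_le (x - c) i).trans hx
  simpa using this

lemma isCompact_cube (c : E n) (R : ℝ) : IsCompact (cube c R) := by
  rcases le_or_gt 0 R with hR | hR
  · exact (isCompact_closedBall c (n * (R / 2))).of_isClosed_subset (isClosed_cube c R)
      (cube_subset_closedBall c hR)
  -- In dimension 0 the cube is the whole one-point space even when `R` is negative; otherwise it is
  -- empty.
  · rcases Nat.eq_zero_or_pos n with rfl | hn
    · exact Set.Finite.isCompact (Set.toFinite _)
    · have : cube c R = ∅ := by
        ext x
        simp only [Set.mem_empty_iff_false, iff_false]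
        intro hx
        have := (abs_nonneg _).trans (hx ⟨0, hn⟩)
        linarith
      rw [this]
      exact isCompact_empty

lemma dist_le_of_mem_cube {c x y : E n} {R : ℝ} (hR : 0 ≤ R) (hx : x ∈ cube c R)
    (hy : y ∈ cube c R) : ‖x - y‖ ≤ n * R := by
  refine norm_le_card_mul hR fun i => ?_
  have h1 := hx i
  have h2 := hy i
  rw [abs_le] at *
  simp only [PiLp.sub_apply]
  constructor <;> linarith [h1.1, h1.2, h2.1, h2.2]

lemma mem_cube_self (c : E n) {R : ℝ} (hR : 0 ≤ R) : c ∈ cube c R := fun i => by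
  simpa using by positivity

lemma cube_subset_cube (c : E n) {R S : ℝ} (h : R ≤ S) : cube c R ⊆ cube c S :=
  fun _ hx i => (hx i).trans (by linarith)

lemma volume_cube (c : E n) {R : ℝ} (hR : 0 ≤ R) : volume (cube c R) = ENNReal.ofReal (R ^ n) := by
  have h := (EuclideanSpace.volume_preserving_symm_measurableEquiv_toLp (Fin n)).measure_preimage
    (s := Set.pi Set.univ fun i => Set.Icc (c i - R / 2) (c i + R / 2))
    (MeasurableSet.univ_pi fun i => measurableSet_Icc).nullMeasurableSet
  have h2 : (MeasurableEquiv.toLp 2 (Fin n → ℝ)).symm ⁻¹'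
      (Set.pi Set.univ fun i => Set.Icc (c i - R / 2) (c i + R / 2)) = cube c R := by
    ext x
    simp only [cube, Set.mem_preimage, Set.mem_pi, Set.mem_univ, true_imp_iff, Set.mem_Icc,
      Set.mem_ofPred_eq, abs_le]
    refine forall_congr' fun i => ?_
    change (_ ≤ x i ∧ x i ≤ _) ↔ _
    constructor <;> rintro ⟨h1, h2⟩ <;> constructor <;> linarith
  rw [h2] at h
  rw [h, volume_pi_pi]
  simp [Real.volume_Icc, ENNReal.ofReal_pow hR]

lemma volume_cube_pos (c : E n) {R : ℝ} (hR : 0 < R) : 0 < volume (cube c R) := by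
  rw [volume_cube c hR.le]; simp; positivity

lemma volume_cube_ne_top (c : E n) (R : ℝ) : volume (cube c R) ≠ ⊤ :=
  (isCompact_cube c R).measure_lt_top.ne

lemma volume_cube_mul (c : E n) {R K : ℝ} (hR : 0 ≤ R) (hK : 0 ≤ K) :
    volume (cube c (K * R)) = ENNReal.ofReal (K ^ n) * volume (cube c R) := by
  rw [volume_cube c hR, volume_cube c (by positivity), mul_pow, ENNReal.ofReal_mul (by positivity)]

end Cubes

/-! ### Jensen's inequality for powers, in extended nonnegative form. -/

section Jensen

lemma rpow_lintegral_le_of_isProbabilityMeasure {α : Type*} [MeasurableSpace α] {μ : Measure α}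
    [IsProbabilityMeasure μ] {G : α → ℝ≥0∞} (hG : AEMeasurable G μ) {p : ℝ} (hp : 1 ≤ p) :
    (∫⁻ x, G x ∂μ) ^ p ≤ ∫⁻ x, G x ^ p ∂μ := by
  have h := eLpNorm'_le_eLpNorm'_of_exponent_le zero_lt_one hp μ hG.aestronglyMeasurable
  simp only [eLpNorm', enorm_eq_self, ENNReal.rpow_one, div_one] at h
  have hp0 : 0 < p := by linarith
  calc (∫⁻ x, G x ∂μ) ^ p ≤ ((∫⁻ x, G x ^ p ∂μ) ^ (1 / p)) ^ p := by gcongr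
    _ = _ := by rw [← ENNReal.rpow_mul, one_div_mul_cancel hp0.ne', ENNReal.rpow_one]

lemma rpow_laverage_le {α : Type*} [MeasurableSpace α] {μ : Measure α} [IsFiniteMeasure μ]
    {G : α → ℝ≥0∞} (hG : AEMeasurable G μ) {p : ℝ} (hp : 1 ≤ p) (hμ : μ ≠ 0) :
    (⨍⁻ x, G x ∂μ) ^ p ≤ ⨍⁻ x, G x ^ p ∂μ := by
  have : NeZero μ := ⟨hμ⟩
  unfold laverage
  exact rpow_lintegral_le_of_isProbabilityMeasure
    (hG.mono_ac (Measure.smul_absolutelyContinuous)) hp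

end Jensen

/-! ### Poincaré inequality on cubes. -/

section Poincare

variable {n : ℕ}

lemma lintegral_comp_homothety (G : E n → ℝ≥0∞) (hG : Measurable G) (y : E n) {s : ℝ}
    (hs : 0 < s) :
    ∫⁻ x, G (y + s • x) = ENNReal.ofReal ((s ^ n)⁻¹) * ∫⁻ x, G x := by
  have h1 : ∫⁻ x, G (y + s • x) = ∫⁻ x, G (y + x) ∂(Measure.map (fun x : E n => s • x) volume) := by
    rw [lintegral_map (by fun_prop) (by fun_prop)]
  rw [h1, Measure.map_addHaar_smul _ hs.ne', lintegral_smul_measure, lintegral_add_left_eq_self]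
  simp only [finrank_euclideanSpace, Fintype.card_fin, smul_eq_mul]
  rw [abs_of_pos (by positivity)]

/-- Integrating along the chords of a convex set costs at most a factor `2 ^ n`. -/
lemma lintegral_lintegral_comp_chord_le {Q : Set (E n)} (hQ : Convex ℝ Q) (hQm : MeasurableSet Q)
    (G : E n → ℝ≥0∞) (hG : Measurable G) {t : ℝ} (ht : t ∈ Set.Icc (0 : ℝ) 1) :
    ∫⁻ x in Q, ∫⁻ y in Q, G (x + t • (y - x)) ≤ 2 ^ n * volume Q * ∫⁻ x in Q, G x := by
  -- One of the weights `t` and `1 - t` is at least `1 / 2`. Moving the endpoint which carries it is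
  -- a homothety with Jacobian at least `2⁻ⁿ`, and convexity keeps the image in `Q`.
  have key : ∀ s ∈ Set.Icc (1 / 2 : ℝ) 1, ∀ x ∈ Q,
      ∫⁻ y in Q, G ((1 - s) • x + s • y) ≤ 2 ^ n * ∫⁻ x in Q, G x := by
    intro s hs x hx
    have hs0 : 0 < s := by linarith [hs.1]
    calc ∫⁻ y in Q, G ((1 - s) • x + s • y)
        ≤ ∫⁻ y, Q.indicator G ((1 - s) • x + s • y) := by
          rw [← lintegral_indicator hQm]
          refine lintegral_mono fun y => ?_
          by_cases hy : y ∈ Q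
          · have : (1 - s) • x + s • y ∈ Q := hQ hx hy (by linarith [hs.2]) hs0.le (by ring)
            simp [hy, this]
          · simp [hy]
      _ = ENNReal.ofReal ((s ^ n)⁻¹) * ∫⁻ x in Q, G x := by
          rw [lintegral_comp_homothety _ (hG.indicator hQm) _ hs0, lintegral_indicator hQm]
      _ ≤ 2 ^ n * ∫⁻ x in Q, G x := by
          gcongr
          have : ENNReal.ofReal ((2 : ℝ) ^ n) = 2 ^ n := by
            rw [ENNReal.ofReal_pow (by norm_num)]; simp
          rw [← this]
          apply ENNReal.ofReal_le_ofReal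
          rw [← inv_pow]
          gcongr
          rw [inv_le_comm₀ hs0 (by norm_num)]
          linarith [hs.1]
  rcases le_total (1 / 2) t with h | h
  · calc ∫⁻ x in Q, ∫⁻ y in Q, G (x + t • (y - x))
        ≤ ∫⁻ _x in Q, 2 ^ n * ∫⁻ x in Q, G x := by
          refine setLIntegral_mono measurable_const fun x hx => ?_
          refine le_trans (le_of_eq ?_) (key t ⟨h, ht.2⟩ x hx)
          congr with y
          congr 1
          module
      _ = _ := by rw [lintegral_const, Measure.restrict_apply_univ]; ring
  -- Now `1 - t` is the large weight, so the integration in `x` has to come first.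
  · rw [lintegral_lintegral_swap (by
      apply Measurable.aemeasurable
      exact hG.comp (by fun_prop))]
    calc ∫⁻ y in Q, ∫⁻ x in Q, G (x + t • (y - x))
        ≤ ∫⁻ _x in Q, 2 ^ n * ∫⁻ x in Q, G x := by
          refine setLIntegral_mono measurable_const fun x hx => ?_
          refine le_trans (le_of_eq ?_) (key (1 - t) ⟨by linarith, by linarith [ht.1]⟩ x hx)
          congr with y
          congr 1
          module
      _ = _ := by rw [lintegral_const, Measure.restrict_apply_univ]; ring

/-- The fundamental theorem of calculus along the segment, followed by Jensen in the parameter `t`.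
-/
lemma enorm_sub_rpow_le_lintegral {F : Type*} [NormedAddCommGroup F] [NormedSpace ℝ F]
    [CompleteSpace F] {u : E n → F} (hu : ContDiff ℝ 1 u) {p : ℝ} (hp : 1 ≤ p) (x y : E n) :
    ‖u y - u x‖ₑ ^ p ≤
      ‖y - x‖ₑ ^ p * ∫⁻ t in Set.Icc (0 : ℝ) 1, ‖fderiv ℝ u (x + t • (y - x))‖ₑ ^ p := by
  have hcont : Continuous (fderiv ℝ u) := hu.continuous_fderiv one_ne_zero
  have hder : ∀ t : ℝ, HasDerivAt (fun t : ℝ => u (x + t • (y - x)))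
      (fderiv ℝ u (x + t • (y - x)) (y - x)) t := by
    intro t
    have h1 : HasDerivAt (fun t : ℝ => x + t • (y - x)) (y - x) t := by
      simpa using ((hasDerivAt_id t).smul_const (y - x)).const_add x
    exact ((hu.differentiable one_ne_zero _).hasFDerivAt).comp_hasDerivAt t h1
  have hint := intervalIntegral.integral_eq_sub_of_hasDerivAt (a := 0) (b := 1)
    (fun t _ => hder t) (Continuous.intervalIntegrable (by fun_prop) _ _)
  simp only [one_smul, zero_smul, add_zero, add_sub_cancel] at hint
  have : IsProbabilityMeasure (volume.restrict (Set.Icc (0 : ℝ) 1)) := ⟨by simp⟩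
  rw [← hint, intervalIntegral.integral_of_le zero_le_one, ← integral_Icc_eq_integral_Ioc]
  calc _ ≤ (∫⁻ t in Set.Icc (0 : ℝ) 1, ‖fderiv ℝ u (x + t • (y - x)) (y - x)‖ₑ) ^ p := by
        gcongr
        exact enorm_integral_le_lintegral_enorm _
    _ ≤ ∫⁻ t in Set.Icc (0 : ℝ) 1, ‖fderiv ℝ u (x + t • (y - x)) (y - x)‖ₑ ^ p :=
        rpow_lintegral_le_of_isProbabilityMeasure
          (Continuous.aemeasurable (by fun_prop)) hp
    _ ≤ ∫⁻ t in Set.Icc (0 : ℝ) 1, ‖y - x‖ₑ ^ p * ‖fderiv ℝ u (x + t • (y - x))‖ₑ ^ p := by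
        refine lintegral_mono fun t => ?_
        rw [← ENNReal.mul_rpow_of_nonneg _ _ (by linarith), mul_comm]
        gcongr
        exact ContinuousLinearMap.le_opENorm _ _
    _ = _ := lintegral_const_mul _ (Continuous.measurable (by fun_prop))

/-- **Poincaré inequality** on a cube, in its two-point form. -/
lemma lintegral_lintegral_enorm_sub_rpow_le {F : Type*} [NormedAddCommGroup F] [NormedSpace ℝ F]
    [CompleteSpace F] {u : E n → F} (hu : ContDiff ℝ 1 u) {p : ℝ} (hp : 1 ≤ p) (c : E n) {R : ℝ}
    (hR : 0 ≤ R) :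
    ∫⁻ x in cube c R, ∫⁻ y in cube c R, ‖u y - u x‖ₑ ^ p ≤
      2 ^ n * ENNReal.ofReal ((n * R) ^ p) * volume (cube c R) *
        ∫⁻ x in cube c R, ‖fderiv ℝ u x‖ₑ ^ p := by
  set Q := cube c R
  have hp0 : 0 ≤ p := by linarith
  have hcont : Continuous (fderiv ℝ u) := hu.continuous_fderiv one_ne_zero
  have hmeas : Measurable fun x => ‖fderiv ℝ u x‖ₑ ^ p := Continuous.measurable (by fun_prop)
  calc ∫⁻ x in Q, ∫⁻ y in Q, ‖u y - u x‖ₑ ^ p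
      ≤ ∫⁻ x in Q, ∫⁻ y in Q, ENNReal.ofReal ((n * R) ^ p) *
          ∫⁻ t in Set.Icc (0 : ℝ) 1, ‖fderiv ℝ u (x + t • (y - x))‖ₑ ^ p := by
        refine setLIntegral_mono' (measurableSet_cube c R) fun x hx => ?_
        refine setLIntegral_mono' (measurableSet_cube c R) fun y hy => ?_
        refine (enorm_sub_rpow_le_lintegral hu hp x y).trans ?_
        gcongr
        rw [← ENNReal.ofReal_rpow_of_nonneg (by positivity) hp0]
        gcongr
        rw [← ofReal_norm]
        exact ENNReal.ofReal_le_ofReal (dist_le_of_mem_cube hR hy hx)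
    -- The `t`-integral is moved outside, since the chord estimate bounds the double integral over
    -- the endpoints for each fixed `t`.
    _ = ENNReal.ofReal ((n * R) ^ p) * ∫⁻ t in Set.Icc (0 : ℝ) 1, ∫⁻ x in Q, ∫⁻ y in Q,
          ‖fderiv ℝ u (x + t • (y - x))‖ₑ ^ p := by
        have e1 : ∀ x, ∫⁻ y in Q, ENNReal.ofReal ((n * R) ^ p) *
            ∫⁻ t in Set.Icc (0 : ℝ) 1, ‖fderiv ℝ u (x + t • (y - x))‖ₑ ^ p =
            ENNReal.ofReal ((n * R) ^ p) *
              ∫⁻ t in Set.Icc (0 : ℝ) 1, ∫⁻ y in Q, ‖fderiv ℝ u (x + t • (y - x))‖ₑ ^ p := by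
          intro x
          have hm3 : Measurable fun q : E n × ℝ => ‖fderiv ℝ u (x + q.2 • (q.1 - x))‖ₑ ^ p :=
            Continuous.measurable (by fun_prop)
          have hm6 : Measurable fun y => ∫⁻ t in Set.Icc (0 : ℝ) 1,
            ‖fderiv ℝ u (x + t • (y - x))‖ₑ ^ p := hm3.lintegral_prod_right'
          rw [lintegral_const_mul _ hm6, lintegral_lintegral_swap]
          exact Measurable.aemeasurable (Continuous.measurable (by fun_prop))
        simp_rw [e1]
        have hm4 : Measurable fun q : (E n × ℝ) × E n =>
          ‖fderiv ℝ u (q.1.1 + q.1.2 • (q.2 - q.1.1))‖ₑ ^ p := Continuous.measurable (by fun_prop)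
        have hm5 : Measurable fun q : E n × ℝ => ∫⁻ y in Q,
          ‖fderiv ℝ u (q.1 + q.2 • (y - q.1))‖ₑ ^ p := hm4.lintegral_prod_right'
        rw [lintegral_const_mul _ hm5.lintegral_prod_right', lintegral_lintegral_swap]
        exact hm5.aemeasurable
    _ ≤ ENNReal.ofReal ((n * R) ^ p) * ∫⁻ _t in Set.Icc (0 : ℝ) 1,
          2 ^ n * volume Q * ∫⁻ x in Q, ‖fderiv ℝ u x‖ₑ ^ p := by
        gcongr 1
        refine setLIntegral_mono' measurableSet_Icc fun t ht => ?_
        exact lintegral_lintegral_comp_chord_le (convex_cube c R) (measurableSet_cube c R) _ hmeas ht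
    _ = _ := by
        rw [lintegral_const, Measure.restrict_apply_univ, Real.volume_Icc]
        simp only [sub_zero, ENNReal.ofReal_one, mul_one]
        ring

end Poincare

end MagneticCZ

namespace MagneticCZ

/-! ### Fatou's lemma as a device for passing to the limit. -/

section Fatou

open Filter Topology

/-- Fatou's lemma with a bound that also varies. It carries Poincaré inequalities from smooth
approximations to `|f|` and to `e^{-iφ} f`, which need not be differentiable. -/
lemma lintegral_le_of_tendsto_ae {α : Type*} [MeasurableSpace α] {μ : Measure α}
    {G : ℕ → α → ℝ≥0∞} {G₀ : α → ℝ≥0∞} {K : ℕ → ℝ≥0∞} {K₀ : ℝ≥0∞}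
    (hG : ∀ m, AEMeasurable (G m) μ)
    (hlim : ∀ᵐ x ∂μ, Tendsto (fun m => G m x) atTop (𝓝 (G₀ x)))
    (hle : ∀ᶠ m in atTop, ∫⁻ x, G m x ∂μ ≤ K m) (hK : Tendsto K atTop (𝓝 K₀)) :
    ∫⁻ x, G₀ x ∂μ ≤ K₀ := by
  calc ∫⁻ x, G₀ x ∂μ = ∫⁻ x, liminf (fun m => G m x) atTop ∂μ := by
        refine lintegral_congr_ae ?_
        filter_upwards [hlim] with x hx
        exact hx.liminf_eq.symm
    _ ≤ liminf (fun m => ∫⁻ x, G m x ∂μ) atTop := lintegral_liminf_le' hG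
    _ ≤ liminf K atTop := liminf_le_liminf hle
    _ = K₀ := hK.liminf_eq

end Fatou

variable {n : ℕ}

/-- The density `|Lf|^p + |V^{1/2} f|^p`. -/
noncomputable def energyDensity (a : E n → E n) (V : E n → ℝ) (p : ℝ) (f : E n → ℂ) (x : E n) :
    ℝ≥0∞ :=
  ‖magGrad a f x‖ₑ ^ p + ‖sqrtMul V f x‖ₑ ^ p

/-! ### The diamagnetic inequality. -/

section Diamagnetic

lemma opNorm_le_norm_coords (D : E n →L[ℝ] ℂ) :
    ‖D‖ ≤ ‖(WithLp.toLp 2 fun j => D (EuclideanSpace.single j 1) : EuclideanSpace ℂ (Fin n))‖ := by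
  refine D.opNorm_le_bound (norm_nonneg _) fun v => ?_
  have hv : D v = ∑ j, v j • D (EuclideanSpace.single j 1) := by
    conv_lhs => rw [← (EuclideanSpace.basisFun (Fin n) ℝ).sum_repr v]
    simp [map_sum]
  rw [hv, EuclideanSpace.norm_eq, EuclideanSpace.norm_eq v, mul_comm]
  calc ‖∑ j, v j • D (EuclideanSpace.single j 1)‖
      ≤ ∑ j, ‖v j‖ * ‖D (EuclideanSpace.single j 1)‖ := by
        refine (norm_sum_le _ _).trans (le_of_eq ?_)
        simp only [norm_smul]
    _ ≤ _ := Real.sum_mul_le_sqrt_mul_sqrt _ _ _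

/-- The covariant differential `v ↦ ∂_v f - i ⟨a, v⟩ f` is bounded by `|Lf|`. -/
lemma norm_fderiv_sub_le_magGrad (a : E n → E n) (f : E n → ℂ) (x : E n) :
    ‖fderiv ℝ f x - (innerSL ℝ (a x)).smulRight (Complex.I * f x)‖ ≤ ‖magGrad a f x‖ := by
  refine (opNorm_le_norm_coords _).trans (le_of_eq ?_)
  rw [EuclideanSpace.norm_eq, EuclideanSpace.norm_eq]
  congr 1
  refine Finset.sum_congr rfl fun j _ => ?_
  congr 1
  have : (fderiv ℝ f x - (innerSL ℝ (a x)).smulRight (Complex.I * f x))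
      (EuclideanSpace.single j 1) = Complex.I * magGrad a f x j := by
    simp only [magGrad, partialDeriv, sub_apply,
      ContinuousLinearMap.smulRight_apply, innerSL_apply_apply, EuclideanSpace.inner_single_right,
      Complex.real_smul]
    simp
    linear_combination ((fderiv ℝ f x) (EuclideanSpace.single j 1)) * Complex.I_sq
  simp only [this, norm_mul, Complex.norm_I, one_mul]

/-- The modulus of `f` may fail to be differentiable at the zeros of `f`; the positive `δ` removes
the singularity. -/
lemma contDiff_sqrt_norm_sq {f : E n → ℂ} (hf : ContDiff ℝ 1 f) {δ : ℝ} (hδ : 0 < δ) :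
    ContDiff ℝ 1 fun x => Real.sqrt (‖f x‖ ^ 2 + δ ^ 2) :=
  ((hf.norm_sq ℝ).add contDiff_const).sqrt fun x => by positivity

/-- The derivative of `|f|²` pairs `f` with `∂_v f`. Replacing `∂_v f` by the covariant derivative
changes nothing, because `i⟨a, v⟩f` is real-orthogonal to `f`. So the magnetic field drops out. -/
lemma norm_fderiv_sqrt_norm_sq_le (a : E n → E n) {f : E n → ℂ} (hf : ContDiff ℝ 1 f) {δ : ℝ}
    (hδ : 0 < δ) (x : E n) :
    ‖fderiv ℝ (fun x => Real.sqrt (‖f x‖ ^ 2 + δ ^ 2)) x‖ ≤ ‖magGrad a f x‖ := by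
  have h1 : HasFDerivAt f (fderiv ℝ f x) x := (hf.differentiable one_ne_zero x).hasFDerivAt
  have hpos : 0 < ‖f x‖ ^ 2 + δ ^ 2 := by positivity
  have h2 := ((h1.norm_sq).add_const (δ ^ 2)).sqrt hpos.ne'
  rw [h2.fderiv]
  refine ContinuousLinearMap.opNorm_le_bound _ (norm_nonneg _) fun v => ?_
  set D := fderiv ℝ f x - (innerSL ℝ (a x)).smulRight (Complex.I * f x) with hD
  have h3 : inner ℝ (f x) (fderiv ℝ f x v) = inner ℝ (f x) (D v) := by
    simp only [hD, sub_apply, ContinuousLinearMap.smulRight_apply,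
      inner_sub_right, Complex.inner]
    simp
    ring_nf
  have h4 : |inner ℝ (f x) (D v)| ≤ ‖f x‖ * (‖magGrad a f x‖ * ‖v‖) := by
    refine (abs_real_inner_le_norm _ _).trans ?_
    gcongr
    exact (D.le_opNorm v).trans (by gcongr; exact norm_fderiv_sub_le_magGrad a f x)
  have h5 : ‖f x‖ ≤ Real.sqrt (‖f x‖ ^ 2 + δ ^ 2) :=
    Real.le_sqrt_of_sq_le (by nlinarith [sq_nonneg δ])
  have h6 : 0 < Real.sqrt (‖f x‖ ^ 2 + δ ^ 2) := Real.sqrt_pos.2 hpos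
  simp only [smul_apply, ContinuousLinearMap.comp_apply, innerSL_apply_apply,
    smul_eq_mul, h3, Real.norm_eq_abs]
  rw [abs_mul, abs_of_pos (by positivity)]
  simp only [nsmul_eq_mul, Nat.cast_ofNat, abs_mul, abs_two]
  rw [div_mul_eq_mul_div, div_le_iff₀ (by positivity)]
  nlinarith [mul_le_mul_of_nonneg_right h5 (show 0 ≤ ‖magGrad a f x‖ * ‖v‖ by positivity)]

/-- Poincaré inequality for `|f|` in terms of the magnetic gradient. -/
lemma lintegral_lintegral_norm_sub_norm_rpow_le (a : E n → E n) {f : E n → ℂ}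
    (hf : ContDiff ℝ 1 f) {p : ℝ} (hp : 1 ≤ p) (c : E n) {R : ℝ} (hR : 0 ≤ R) :
    ∫⁻ x in cube c R, ∫⁻ y in cube c R, ‖‖f y‖ - ‖f x‖‖ₑ ^ p ≤
      2 ^ n * ENNReal.ofReal ((n * R) ^ p) * volume (cube c R) *
        ∫⁻ x in cube c R, ‖magGrad a f x‖ₑ ^ p := by
  set μ := volume.restrict (cube c R)
  have hp0 : 0 ≤ p := by linarith
  have hfc : Continuous f := hf.continuous
  -- The regularisation parameter is `1 / (m + 1)`; the bound on the gradient does not depend on it.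
  let u : ℕ → E n → ℝ := fun m x => Real.sqrt (‖f x‖ ^ 2 + (1 / ((m : ℝ) + 1)) ^ 2)
  have hu : ∀ m, ContDiff ℝ 1 (u m) := fun m => contDiff_sqrt_norm_sq hf (by positivity)
  have huc : ∀ m, Continuous (u m) := fun m => (hu m).continuous
  have hlim : ∀ x, Filter.Tendsto (fun m => u m x) Filter.atTop (nhds ‖f x‖) := by
    intro x
    have h1 : Filter.Tendsto (fun m : ℕ => ‖f x‖ ^ 2 + (1 / ((m : ℝ) + 1)) ^ 2) Filter.atTop
        (nhds (‖f x‖ ^ 2 + 0 ^ 2)) := (tendsto_one_div_add_atTop_nhds_zero_nat.pow 2).const_add _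
    have h2 := h1.sqrt
    rw [show √(‖f x‖ ^ 2 + 0 ^ 2) = ‖f x‖ by simp] at h2
    exact h2
  have e : ∫⁻ x, ∫⁻ y, ‖‖f y‖ - ‖f x‖‖ₑ ^ p ∂μ ∂μ =
      ∫⁻ q : E n × E n, ‖‖f q.2‖ - ‖f q.1‖‖ₑ ^ p ∂(μ.prod μ) := by
    rw [lintegral_prod]
    exact Measurable.aemeasurable (Continuous.measurable (by fun_prop))
  rw [e]
  refine lintegral_le_of_tendsto_ae (G := fun m q => ‖u m q.2 - u m q.1‖ₑ ^ p)
    (fun m => Measurable.aemeasurable (Continuous.measurable (by fun_prop)))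
    (Filter.Eventually.of_forall fun q => ?_) (Filter.Eventually.of_forall fun m => ?_)
    (tendsto_const_nhds)
  · exact (((hlim q.2).sub (hlim q.1)).enorm).ennrpow_const p
  · rw [lintegral_prod _ (Measurable.aemeasurable (Continuous.measurable (by fun_prop)))]
    refine (lintegral_lintegral_enorm_sub_rpow_le (hu m) hp c hR).trans ?_
    gcongr with x
    rw [← ofReal_norm, ← ofReal_norm]
    exact ENNReal.ofReal_le_ofReal (norm_fderiv_sqrt_norm_sq_le a hf (by positivity) x)

end Diamagnetic

/-! ### Muckenhoupt weights and the Fefferman–Phong inequality. -/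

section Weights

/-- A Muckenhoupt weight is comparable to its mean on a fixed proportion of each cube. -/
noncomputable def levelRatio (r A : ℝ) : ℝ := (2 ^ (r - 1) * max A 1)⁻¹

lemma levelRatio_pos (r A : ℝ) : 0 < levelRatio r A := by
  unfold levelRatio; positivity

lemma levelRatio_le_one {r : ℝ} (hr : 1 < r) (A : ℝ) : levelRatio r A ≤ 1 := by
  unfold levelRatio
  apply inv_le_one_of_one_le₀
  have h1 : (1 : ℝ) ≤ 2 ^ (r - 1) := Real.one_le_rpow (by norm_num) (by linarith)
  nlinarith [le_max_right A 1]

variable {r A : ℝ} {V : E n → ℝ}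

lemma IsMuckenhoupt.integrableOn_cube (hV : IsMuckenhoupt r A V) (c : E n) (R : ℝ) :
    IntegrableOn V (cube c R) := hV.2.1.integrableOn_isCompact (isCompact_cube c R)

lemma IsMuckenhoupt.lintegral_cube (hV : IsMuckenhoupt r A V) (c : E n) (R : ℝ) :
    ∫⁻ x in cube c R, ENNReal.ofReal (V x) = ENNReal.ofReal (∫ x in cube c R, V x) :=
  (ofReal_integral_eq_lintegral_ofReal (hV.integrableOn_cube c R)
    (ae_restrict_of_ae (hV.1.mono fun _ h => h.le))).symm

lemma IsMuckenhoupt.setAverage_pos (hV : IsMuckenhoupt r A V) (c : E n) {R : ℝ} (hR : 0 < R) :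
    0 < ⨍ x in cube c R, V x := by
  rw [setAverage_eq, smul_eq_mul]
  have hvol : 0 < volume.real (cube c R) :=
    ENNReal.toReal_pos (volume_cube_pos c hR).ne' (volume_cube_ne_top c R)
  refine mul_pos (inv_pos.2 hvol) ?_
  rw [setIntegral_pos_iff_support_of_nonneg_ae
    (ae_restrict_of_ae (hV.1.mono fun _ h => h.le)) (hV.integrableOn_cube c R)]
  have : volume (Function.support V ∩ cube c R) = volume (cube c R) := by
    apply measure_congr
    filter_upwards [hV.1] with x hx
    simp only [eq_iff_iff]
    exact ⟨fun h => h.2, fun h => ⟨hx.ne', h⟩⟩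
  rw [this]
  exact volume_cube_pos c hR

lemma ofReal_setAverage_mul_volume {c : E n} {R : ℝ} (hR : 0 < R) (V : E n → ℝ) :
    ENNReal.ofReal (∫ x in cube c R, V x) =
      ENNReal.ofReal (⨍ x in cube c R, V x) * volume (cube c R) := by
  have hvol : 0 < volume.real (cube c R) :=
    ENNReal.toReal_pos (volume_cube_pos c hR).ne' (volume_cube_ne_top c R)
  rw [← ofReal_measureReal (volume_cube_ne_top c R), ← ENNReal.ofReal_mul' hvol.le, setAverage_eq,
    smul_eq_mul]
  congr 1
  field_simp

/-- Chebyshev's inequality for the dual weight `V^{-1/(r-1)}`: the A_r condition bounds its mean,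
and it is large where `V` is small. -/
lemma IsMuckenhoupt.volume_level_le (hr : 1 < r) (hV : IsMuckenhoupt r A V) (c : E n) {R : ℝ}
    (hR : 0 < R) :
    volume.restrict (cube c R) {x | V x < levelRatio r A * ⨍ y in cube c R, V y} ≤
      volume (cube c R) / 2 := by
  set Q := cube c R with hQ
  set v := ⨍ y in Q, V y with hv
  have hv0 : 0 < v := hV.setAverage_pos c hR
  set s := 1 / (r - 1) with hs
  have hr1 : 0 < r - 1 := by linarith
  have hs0 : 0 < s := by positivity
  set A' := max A 1 with hA'
  have hA'0 : 0 < A' := by positivity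
  have hvolpos : volume Q ≠ 0 := (volume_cube_pos c hR).ne'
  have hvoltop : volume Q ≠ ⊤ := volume_cube_ne_top c R
  have hlav : (⨍⁻ x in Q, ENNReal.ofReal (V x) ∂volume) = ENNReal.ofReal v := by
    rw [setLAverage_eq, hV.lintegral_cube, ofReal_setAverage_mul_volume hR,
      ENNReal.mul_div_cancel_right hvolpos hvoltop]
  set W := ⨍⁻ x in Q, ENNReal.ofReal (V x) ^ (-s) ∂volume with hW
  have hWle : W ≤ ENNReal.ofReal ((A' / v) ^ s) := by
    have h := hV.2.2 c R hR
    rw [← hQ, hlav, ← hs, ← hW] at h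
    have h2 : W ^ (r - 1) ≤ ENNReal.ofReal (A' / v) := by
      rw [ENNReal.ofReal_div_of_pos hv0, ENNReal.le_div_iff_mul_le
        (Or.inl (by simpa using hv0)) (Or.inl ENNReal.ofReal_ne_top), mul_comm]
      exact h.trans (ENNReal.ofReal_le_ofReal (le_max_left _ _))
    rw [← ENNReal.ofReal_rpow_of_nonneg (by positivity) hs0.le]
    calc W = (W ^ (r - 1)) ^ s := by
          rw [← ENNReal.rpow_mul, hs, mul_one_div_cancel hr1.ne', ENNReal.rpow_one]
      _ ≤ _ := by gcongr
  set k : ℝ := levelRatio r A * v with hk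
  have hk0 : 0 < k := mul_pos (levelRatio_pos r A) hv0
  -- The factor `2 ^ (r - 1)` in `levelRatio` is chosen so that the dual weight at level `k` is
  -- exactly twice the bound for its mean; this is where the proportion one half comes from.
  have hkpow : ENNReal.ofReal k ^ (-s) = 2 * ENNReal.ofReal ((A' / v) ^ s) := by
    have e1 : k ^ (-s) = 2 * (A' / v) ^ s := by
      have e2 : k = (2 ^ (r - 1) * (A' / v))⁻¹ := by
        rw [hk, levelRatio, ← hA']; field_simp
      rw [e2, Real.rpow_neg (by positivity), ← Real.inv_rpow (by positivity), inv_inv,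
        Real.mul_rpow (by positivity) (by positivity), ← Real.rpow_mul (by norm_num), hs,
        mul_one_div_cancel hr1.ne', Real.rpow_one]
    rw [ENNReal.ofReal_rpow_of_pos hk0, e1, ENNReal.ofReal_mul (by norm_num)]
    simp
  have hcheb := mul_meas_ge_le_lintegral₀ (μ := volume.restrict Q)
    (f := fun x => ENNReal.ofReal (V x) ^ (-s))
    ((hV.2.1.aestronglyMeasurable.aemeasurable.ennreal_ofReal.pow_const _).restrict)
    (ENNReal.ofReal k ^ (-s))
  have hsub : {x | V x < k} ⊆ {x | ENNReal.ofReal k ^ (-s) ≤ ENNReal.ofReal (V x) ^ (-s)} := by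
    intro x hx
    simp only [Set.mem_ofPred_eq] at hx ⊢
    rw [ENNReal.rpow_neg, ENNReal.rpow_neg, ENNReal.inv_le_inv]
    gcongr
  have hWint : ∫⁻ x in Q, ENNReal.ofReal (V x) ^ (-s) = W * volume Q := by
    rw [hW, setLAverage_eq, ENNReal.div_mul_cancel hvolpos hvoltop]
  rw [hWint, hkpow] at hcheb
  set T := ENNReal.ofReal ((A' / v) ^ s) with hT
  have hT0 : T ≠ 0 := by rw [hT]; simp; positivity
  have hTt : T ≠ ⊤ := ENNReal.ofReal_ne_top
  have h5 : T * (2 * volume.restrict Q {x | V x < k}) ≤ T * volume Q := by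
    calc T * (2 * volume.restrict Q {x | V x < k})
        = 2 * T * volume.restrict Q {x | V x < k} := by ring
      _ ≤ 2 * T * volume.restrict Q {x | 2 * T ≤ ENNReal.ofReal (V x) ^ (-s)} := by
          refine mul_le_mul_right (measure_mono fun x hx => ?_) _
          exact hkpow ▸ hsub hx
      _ ≤ W * volume Q := hcheb
      _ ≤ T * volume Q := by gcongr
  rw [ENNReal.mul_le_mul_iff_right hT0 hTt] at h5
  rw [ENNReal.le_div_iff_mul_le (by simp) (by simp), mul_comm]
  exact h5

/-- **Fefferman–Phong inequality** for `A_∞` weights and magnetic gradients. -/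
lemma IsMuckenhoupt.fefferman_phong (hr : 1 < r) (hV : IsMuckenhoupt r A V) (a : E n → E n)
    {f : E n → ℂ} (hf : ContDiff ℝ 1 f) {p : ℝ} (hp : 1 ≤ p) (c : E n) {R : ℝ} (hR : 0 < R) :
    ENNReal.ofReal (min (Real.sqrt (levelRatio r A * ⨍ y in cube c R, V y)) R⁻¹) ^ p *
        ∫⁻ x in cube c R, ‖f x‖ₑ ^ p ≤
      2 ^ p * (2 ^ n * ENNReal.ofReal ((n : ℝ) ^ p) + 1) *
        ∫⁻ x in cube c R, energyDensity a V p f x := by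
  set Q := cube c R with hQ
  set k : ℝ := levelRatio r A * ⨍ y in Q, V y with hk
  have hp0 : 0 < p := by linarith
  have hfc : Continuous f := hf.continuous
  have hVm : AEMeasurable V := hV.2.1.aestronglyMeasurable.aemeasurable
  have hvolpos : volume Q ≠ 0 := (volume_cube_pos c hR).ne'
  have hvoltop : volume Q ≠ ⊤ := volume_cube_ne_top c R
  -- Both bounds on `κ` are needed: `κ ≤ R⁻¹` turns the Poincaré inequality into a scale-free one,
  -- and `κ ≤ V^{1/2}` produces the potential energy.
  set κ : E n → ℝ≥0∞ := fun y => ENNReal.ofReal (min (Real.sqrt (V y)) R⁻¹) with hκ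
  set κ₀ := ENNReal.ofReal (min (Real.sqrt k) R⁻¹) with hκ₀
  have hκm : AEMeasurable κ := by
    have : AEMeasurable fun y => min (Real.sqrt (V y)) R⁻¹ := by fun_prop
    exact this.ennreal_ofReal
  have hlev : κ₀ ^ p * (volume Q / 2) ≤ ∫⁻ y in Q, κ y ^ p := by
    have h1 := mul_meas_ge_le_lintegral₀ (μ := volume.restrict Q) (f := fun y => κ y ^ p)
      ((hκm.pow_const p).restrict) (κ₀ ^ p)
    refine le_trans ?_ h1
    gcongr
    have h2 : {y | V y < k}ᶜ ⊆ {y | κ₀ ^ p ≤ κ y ^ p} := by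
      intro y hy
      simp only [Set.mem_compl_iff, Set.mem_ofPred_eq, not_lt] at hy ⊢
      gcongr
      exact ENNReal.ofReal_le_ofReal (min_le_min_right _ (Real.sqrt_le_sqrt hy))
    refine le_trans ?_ (measure_mono h2)
    have h3 := hV.volume_level_le hr c hR
    have h4 : volume Q ≤ volume.restrict Q {y | V y < k} + volume.restrict Q {y | V y < k}ᶜ := by
      rw [← Measure.restrict_apply_univ, ← Set.union_compl_self {y | V y < k}]
      exact measure_union_le _ _
    have h5 : volume Q ≤ volume Q / 2 + volume.restrict Q {y | V y < k}ᶜ :=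
      h4.trans (by gcongr)
    have h6 : volume Q / 2 + volume Q / 2 ≤ volume Q / 2 + volume.restrict Q {y | V y < k}ᶜ := by
      rwa [ENNReal.add_halves]
    exact (ENNReal.add_le_add_iff_left (ENNReal.div_ne_top hvoltop (by simp))).1 h6
  -- The value at `x` is compared with the value at `y`, where the potential is evaluated.
  -- Integrating over both points decouples the left side into a product.
  have hpt : ∀ x y, κ y ^ p * ‖f x‖ₑ ^ p ≤ 2 ^ (p - 1) *
      (ENNReal.ofReal R⁻¹ ^ p * ‖‖f y‖ - ‖f x‖‖ₑ ^ p + ‖sqrtMul V f y‖ₑ ^ p) := by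
    intro x y
    rw [← ENNReal.mul_rpow_of_nonneg _ _ hp0.le, ← ENNReal.mul_rpow_of_nonneg _ _ hp0.le]
    refine le_trans ?_ (ENNReal.rpow_add_le_mul_rpow_add_rpow _ _ hp)
    gcongr
    calc κ y * ‖f x‖ₑ ≤ κ y * (‖‖f y‖ - ‖f x‖‖ₑ + ‖f y‖ₑ) := by
          gcongr
          rw [← ofReal_norm, ← ofReal_norm, ← ofReal_norm, ← ENNReal.ofReal_add
            (norm_nonneg _) (norm_nonneg _)]
          apply ENNReal.ofReal_le_ofReal
          rw [Real.norm_eq_abs]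
          linarith [neg_abs_le (‖f y‖ - ‖f x‖)]
      _ = κ y * ‖‖f y‖ - ‖f x‖‖ₑ + κ y * ‖f y‖ₑ := mul_add _ _ _
      _ ≤ _ := by
          gcongr
          · exact ENNReal.ofReal_le_ofReal (min_le_right _ _)
          · rw [sqrtMul, enorm_mul]
            gcongr
            rw [← ofReal_norm, Complex.norm_real, Real.norm_of_nonneg (Real.sqrt_nonneg _)]
            exact ENNReal.ofReal_le_ofReal (min_le_left _ _)
  have hprod : (∫⁻ y in Q, κ y ^ p) * ∫⁻ x in Q, ‖f x‖ₑ ^ p =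
      ∫⁻ x in Q, ∫⁻ y in Q, κ y ^ p * ‖f x‖ₑ ^ p := by
    have : ∀ x, ∫⁻ y in Q, κ y ^ p * ‖f x‖ₑ ^ p = (∫⁻ y in Q, κ y ^ p) * ‖f x‖ₑ ^ p := fun x =>
      lintegral_mul_const' _ _ (by simp [hp0.le])
    simp_rw [this]
    rw [lintegral_const_mul _ (Continuous.measurable (by fun_prop))]
  have hint : (∫⁻ y in Q, κ y ^ p) * ∫⁻ x in Q, ‖f x‖ₑ ^ p ≤
      2 ^ (p - 1) * (ENNReal.ofReal R⁻¹ ^ p * (2 ^ n * ENNReal.ofReal ((n * R) ^ p) * volume Q *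
        ∫⁻ x in Q, ‖magGrad a f x‖ₑ ^ p) + volume Q * ∫⁻ y in Q, ‖sqrtMul V f y‖ₑ ^ p) := by
    rw [hprod]
    calc _ ≤ ∫⁻ x in Q, ∫⁻ y in Q, 2 ^ (p - 1) *
        (ENNReal.ofReal R⁻¹ ^ p * ‖‖f y‖ - ‖f x‖‖ₑ ^ p + ‖sqrtMul V f y‖ₑ ^ p) :=
          lintegral_mono fun x => lintegral_mono fun y => hpt x y
      _ = 2 ^ (p - 1) * (ENNReal.ofReal R⁻¹ ^ p *
          (∫⁻ x in Q, ∫⁻ y in Q, ‖‖f y‖ - ‖f x‖‖ₑ ^ p) +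
            volume Q * ∫⁻ y in Q, ‖sqrtMul V f y‖ₑ ^ p) := by
          have e1 : ∀ x, ∫⁻ y in Q, 2 ^ (p - 1) *
              (ENNReal.ofReal R⁻¹ ^ p * ‖‖f y‖ - ‖f x‖‖ₑ ^ p + ‖sqrtMul V f y‖ₑ ^ p) =
              2 ^ (p - 1) * (ENNReal.ofReal R⁻¹ ^ p * (∫⁻ y in Q, ‖‖f y‖ - ‖f x‖‖ₑ ^ p) +
                ∫⁻ y in Q, ‖sqrtMul V f y‖ₑ ^ p) := by
            intro x
            have hm : Measurable fun y => ENNReal.ofReal R⁻¹ ^ p * ‖‖f y‖ - ‖f x‖‖ₑ ^ p :=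
              (Continuous.measurable (by fun_prop)).const_mul _
            rw [lintegral_const_mul' _ _ (by simp), lintegral_add_left hm,
              lintegral_const_mul' _ _ (by simp [hp0.le])]
          simp_rw [e1]
          rw [lintegral_const_mul' _ _ (by simp), lintegral_add_right _ measurable_const,
            lintegral_const_mul' _ _ (by simp [hp0.le]), lintegral_const,
            Measure.restrict_apply_univ, mul_comm (volume Q)]
      _ ≤ _ := by
          gcongr
          exact lintegral_lintegral_norm_sub_norm_rpow_le a hf hp c hR.le
  have hRR : ENNReal.ofReal R⁻¹ ^ p * ENNReal.ofReal ((n * R) ^ p) = ENNReal.ofReal ((n : ℝ) ^ p) := by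
    rw [ENNReal.ofReal_rpow_of_nonneg (by positivity) hp0.le, ← ENNReal.ofReal_mul (by positivity),
      ← Real.mul_rpow (by positivity) (by positivity)]
    congr 2
    field_simp
  have hw1 : ∫⁻ x in Q, ‖magGrad a f x‖ₑ ^ p ≤ ∫⁻ x in Q, energyDensity a V p f x :=
    lintegral_mono fun x => le_self_add
  have hw2 : ∫⁻ x in Q, ‖sqrtMul V f x‖ₑ ^ p ≤ ∫⁻ x in Q, energyDensity a V p f x :=
    lintegral_mono fun x => le_add_self
  set J := ∫⁻ x in Q, energyDensity a V p f x
  have h2p : (2 : ℝ≥0∞) * 2 ^ (p - 1) = 2 ^ p := by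
    nth_rewrite 1 [← ENNReal.rpow_one 2]
    rw [← ENNReal.rpow_add _ _ (by simp) (by simp)]
    congr 1; ring
  have hfin : volume Q * (κ₀ ^ p * ∫⁻ x in Q, ‖f x‖ₑ ^ p) ≤
      volume Q * (2 ^ p * (2 ^ n * ENNReal.ofReal ((n : ℝ) ^ p) + 1) * J) := by
    calc volume Q * (κ₀ ^ p * ∫⁻ x in Q, ‖f x‖ₑ ^ p)
        = 2 * ((κ₀ ^ p * (volume Q / 2)) * ∫⁻ x in Q, ‖f x‖ₑ ^ p) := by
          have : (2 : ℝ≥0∞) * (volume Q / 2) = volume Q := ENNReal.mul_div_cancel (by simp) (by simp)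
          nth_rewrite 1 [← this]
          ring
      _ ≤ 2 * ((∫⁻ y in Q, κ y ^ p) * ∫⁻ x in Q, ‖f x‖ₑ ^ p) := by gcongr
      _ ≤ 2 * (2 ^ (p - 1) * (ENNReal.ofReal R⁻¹ ^ p * (2 ^ n * ENNReal.ofReal ((n * R) ^ p) *
            volume Q * J) + volume Q * J)) := by
          refine mul_le_mul_right (hint.trans ?_) _
          gcongr
      _ = volume Q * ((2 * 2 ^ (p - 1)) * (2 ^ n * (ENNReal.ofReal R⁻¹ ^ p *
            ENNReal.ofReal ((n * R) ^ p)) + 1) * J) := by ring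
      _ = _ := by rw [hRR, h2p]
  exact (ENNReal.mul_le_mul_iff_right hvolpos hvoltop).1 hfin

end Weights

end MagneticCZ

namespace MagneticCZ

/-! ### Mollification of the vector potential and of its curl. -/

section Mollify

open Filter Topology Convolution ContinuousLinearMap

variable {n : ℕ} {F : Type*} [NormedAddCommGroup F] [NormedSpace ℝ F]

/-- A standard approximation of the identity. -/
noncomputable def mollifier (n m : ℕ) : ContDiffBump (0 : E n) where
  rIn := 1 / ((m : ℝ) + 1)
  rOut := 2 / ((m : ℝ) + 1)
  rIn_pos := by positivity
  rIn_lt_rOut := by gcongr; norm_num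

/-- Convolution with the standard approximation of the identity. -/
noncomputable def mollify (m : ℕ) (g : E n → F) : E n → F :=
  (mollifier n m).normed volume ⋆[lsmul ℝ ℝ, volume] g

lemma tendsto_rOut_mollifier : Tendsto (fun m => (mollifier n m).rOut) atTop (𝓝 0) := by
  have := (tendsto_one_div_add_atTop_nhds_zero_nat (𝕜 := ℝ)).const_mul 2
  simp only [mul_zero] at this
  refine this.congr fun m => ?_
  simp [mollifier, div_eq_mul_inv]

lemma rOut_mollifier_le (m : ℕ) : (mollifier n m).rOut ≤ 2 := by
  simp only [mollifier]
  rw [div_le_iff₀ (by positivity)]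
  have : (0 : ℝ) ≤ m := by positivity
  linarith

lemma mollify_eq (m : ℕ) (g : E n → F) (x : E n) :
    mollify m g x = ∫ t, (mollifier n m).normed volume t • g (x - t) := by
  simp [mollify, convolution_def]

lemma mollify_eq_swap (m : ℕ) (g : E n → F) (x : E n) :
    mollify m g x = ∫ t, (mollifier n m).normed volume (x - t) • g t := by
  simp [mollify, convolution_eq_swap]

lemma contDiff_mollify (m : ℕ) {g : E n → F} (hg : LocallyIntegrable g) :
    ContDiff ℝ 1 (mollify m g) := by
  have := HasCompactSupport.contDiff_convolution_left (lsmul ℝ ℝ) (μ := volume) (n := 1)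
    (f := (mollifier n m).normed volume) (mollifier n m).hasCompactSupport_normed
    ((mollifier n m).contDiff_normed (n := 1)) hg
  exact_mod_cast this

/-- Convergence at Lebesgue points. It applies because the outer radius of the mollifier is always
twice the inner one. -/
lemma ae_tendsto_mollify [CompleteSpace F] {g : E n → F} (hg : LocallyIntegrable g) :
    ∀ᵐ x, Tendsto (fun m => mollify m g x) atTop (𝓝 (g x)) :=
  ContDiffBump.ae_convolution_tendsto_right_of_locallyIntegrable (K := 2) tendsto_rOut_mollifier
    (Eventually.of_forall fun m => le_of_eq (by simp [mollifier, div_eq_mul_inv])) hg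

lemma integrable_mollifier_smul (m : ℕ) {g : E n → F} (hg : LocallyIntegrable g) (x : E n) :
    Integrable fun t => (mollifier n m).normed volume t • g (x - t) := by
  have := HasCompactSupport.convolutionExists_left (lsmul ℝ ℝ) (μ := volume)
    (f := (mollifier n m).normed volume) (mollifier n m).hasCompactSupport_normed
    ((mollifier n m).continuous_normed) hg x
  simpa [ConvolutionExistsAt] using this

lemma integrable_mollifier_smul_swap (m : ℕ) {g : E n → F} (hg : LocallyIntegrable g) (x : E n) :
    Integrable fun t => (mollifier n m).normed volume (x - t) • g t := by
  have := (integrable_mollifier_smul m hg x).comp_sub_left x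
  simpa using this

/-- Translations are continuous in `L²`. -/
lemma tendsto_eLpNorm_translate_sub {F : Type*} [NormedAddCommGroup F] {g : E n → F} (hg : MemLp g 2 volume) :
    Tendsto (fun t => eLpNorm (fun x => g (x - t) - g x) 2 volume) (𝓝 0) (𝓝 0) := by
  have : Fact ((2 : ℝ≥0∞) ≠ ⊤) := ⟨by simp⟩
  have hcont : Continuous fun t : E n => (DomAddAct.mk (-t) : (E n)ᵈᵃᵃ) +ᵥ hg.toLp g := by
    have : Continuous fun t : E n => (DomAddAct.mk (-t) : (E n)ᵈᵃᵃ) :=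
      DomAddAct.continuous_mk.comp continuous_neg
    exact this.vadd continuous_const
  have h0 := hcont.tendsto 0
  rw [tendsto_iff_edist_tendsto_0] at h0
  refine h0.congr fun t => ?_
  rw [DomAddAct.mk_vadd_toLp, DomAddAct.mk_vadd_toLp, Lp.edist_toLp_toLp]
  congr 1
  ext x
  simp [sub_eq_add_neg, add_comm]

/-- Jensen's inequality for the square: the mollifier is a probability density. -/
lemma enorm_mollify_sub_rpow_le [CompleteSpace F] (m : ℕ) {g : E n → F}
    (hg : LocallyIntegrable g) (x : E n) :
    ‖mollify m g x - g x‖ₑ ^ (2 : ℝ) ≤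
      ∫⁻ t, ENNReal.ofReal ((mollifier n m).normed volume t) * ‖g (x - t) - g x‖ₑ ^ (2 : ℝ) := by
  set ρ := (mollifier n m).normed volume with hρ
  have hρc : Continuous ρ := (mollifier n m).continuous_normed
  have hρm : Measurable fun t => ENNReal.ofReal (ρ t) := hρc.measurable.ennreal_ofReal
  have hone : ∫⁻ t, ENNReal.ofReal (ρ t) = 1 := by
    rw [← ofReal_integral_eq_lintegral_ofReal (mollifier n m).integrable_normed
      (Eventually.of_forall (mollifier n m).nonneg_normed), (mollifier n m).integral_normed]
    simp
  have : IsProbabilityMeasure (volume.withDensity fun t => ENNReal.ofReal (ρ t)) :=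
    ⟨by rw [withDensity_apply _ MeasurableSet.univ, Measure.restrict_univ, hone]⟩
  have e : mollify m g x - g x = ∫ t, ρ t • (g (x - t) - g x) := by
    simp_rw [smul_sub]
    rw [integral_sub (integrable_mollifier_smul m hg x)
      ((mollifier n m).integrable_normed.smul_const _), integral_smul_const,
      (mollifier n m).integral_normed, one_smul, mollify_eq]
  have hgm : AEMeasurable (fun t => ‖g (x - t) - g x‖ₑ) := by
    refine AEStronglyMeasurable.enorm ?_
    refine AEStronglyMeasurable.sub ?_ aestronglyMeasurable_const
    exact hg.aestronglyMeasurable.comp_quasiMeasurePreserving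
      (quasiMeasurePreserving_sub_left volume x)
  have hac := withDensity_absolutelyContinuous volume (fun t => ENNReal.ofReal (ρ t))
  calc ‖mollify m g x - g x‖ₑ ^ (2 : ℝ)
      ≤ (∫⁻ t, ENNReal.ofReal (ρ t) * ‖g (x - t) - g x‖ₑ) ^ (2 : ℝ) := by
        rw [e]
        gcongr
        refine (enorm_integral_le_lintegral_enorm _).trans (le_of_eq ?_)
        refine lintegral_congr fun t => ?_
        rw [enorm_smul, ← ofReal_norm (ρ t), Real.norm_of_nonneg ((mollifier n m).nonneg_normed t)]
    _ = (∫⁻ t, ‖g (x - t) - g x‖ₑ ∂(volume.withDensity fun t => ENNReal.ofReal (ρ t))) ^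
          (2 : ℝ) := by
        rw [lintegral_withDensity_eq_lintegral_mul₀ hρm.aemeasurable hgm]; rfl
    _ ≤ ∫⁻ t, ‖g (x - t) - g x‖ₑ ^ (2 : ℝ) ∂(volume.withDensity fun t => ENNReal.ofReal (ρ t)) :=
        rpow_lintegral_le_of_isProbabilityMeasure (hgm.mono_ac hac) (by norm_num)
    _ = _ := by
        rw [lintegral_withDensity_eq_lintegral_mul₀ hρm.aemeasurable (hgm.pow_const _)]; rfl

/-- By Tonelli the error is at most an average of the translation errors over `|t| < rOut`, and
translation is continuous in L². -/
lemma tendsto_lintegral_mollify_sub_of_memLp [CompleteSpace F] {g : E n → F}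
    (hg : MemLp g 2 volume) :
    Tendsto (fun m => ∫⁻ x, ‖mollify m g x - g x‖ₑ ^ (2 : ℝ)) atTop (𝓝 0) := by
  have hloc : LocallyIntegrable g := hg.locallyIntegrable (by norm_num)
  rw [ENNReal.tendsto_nhds_zero]
  intro ε hε
  have h2 : Tendsto (fun t => ∫⁻ x, ‖g (x - t) - g x‖ₑ ^ (2 : ℝ)) (𝓝 0) (𝓝 0) := by
    have := (tendsto_eLpNorm_translate_sub hg).ennrpow_const 2
    rw [ENNReal.zero_rpow_of_pos (by norm_num)] at this
    refine this.congr fun t => ?_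
    rw [eLpNorm_eq_lintegral_rpow_enorm_toReal (by simp) (by simp)]
    simp only [ENNReal.toReal_ofNat]
    rw [← ENNReal.rpow_mul]
    norm_num
  rw [ENNReal.tendsto_nhds_zero] at h2
  obtain ⟨δ, hδ, hball⟩ := Metric.eventually_nhds_iff_ball.1 (h2 ε hε)
  filter_upwards [(tendsto_order.1 (tendsto_rOut_mollifier (n := n))).2 δ hδ] with m hm
  set ρ := (mollifier n m).normed volume with hρ
  have hρc : Continuous ρ := (mollifier n m).continuous_normed
  have hone : ∫⁻ t, ENNReal.ofReal (ρ t) = 1 := by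
    rw [← ofReal_integral_eq_lintegral_ofReal (mollifier n m).integrable_normed
      (Eventually.of_forall (mollifier n m).nonneg_normed), (mollifier n m).integral_normed]
    simp
  calc ∫⁻ x, ‖mollify m g x - g x‖ₑ ^ (2 : ℝ)
      ≤ ∫⁻ x, ∫⁻ t, ENNReal.ofReal (ρ t) * ‖g (x - t) - g x‖ₑ ^ (2 : ℝ) :=
        lintegral_mono fun x => enorm_mollify_sub_rpow_le m hloc x
    _ = ∫⁻ t, ∫⁻ x, ENNReal.ofReal (ρ t) * ‖g (x - t) - g x‖ₑ ^ (2 : ℝ) := by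
        refine lintegral_lintegral_swap ?_
        refine AEMeasurable.mul ?_ ?_
        · exact (hρc.comp continuous_snd).measurable.ennreal_ofReal.aemeasurable
        · refine (AEStronglyMeasurable.enorm ?_).pow_const _
          refine AEStronglyMeasurable.sub ?_ hg.1.comp_fst
          exact hg.1.comp_quasiMeasurePreserving (quasiMeasurePreserving_sub volume volume)
    _ ≤ ∫⁻ t, ENNReal.ofReal (ρ t) * ε := by
        refine lintegral_mono fun t => ?_
        simp only
        rw [lintegral_const_mul' _ _ ENNReal.ofReal_ne_top]
        by_cases ht : t ∈ Metric.ball (0 : E n) δ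
        · gcongr
          exact hball t ht
        · have : ρ t = 0 := by
            have : t ∉ Function.support ρ := by
              rw [hρ, ContDiffBump.support_normed_eq]
              exact fun h => ht (Metric.ball_subset_ball hm.le h)
            simpa using this
          simp [this]
    _ = ε := by rw [lintegral_mul_const _ hρc.measurable.ennreal_ofReal, hone, one_mul]

lemma IsL2Loc.locallyIntegrable {a : E n → E n} (ha : IsL2Loc a) : LocallyIntegrable a := by
  rw [locallyIntegrable_iff]
  intro K hK
  have : IsFiniteMeasure (volume.restrict K) := ⟨by simpa using hK.measure_lt_top⟩
  exact (ha K hK).integrable (by norm_num)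

lemma IsL2Loc.locallyIntegrable_apply {a : E n → E n} (ha : IsL2Loc a) (j : Fin n) :
    LocallyIntegrable fun x => a x j := by
  rw [locallyIntegrable_iff]
  intro K hK
  exact (EuclideanSpace.proj (𝕜 := ℝ) j).integrable_comp
    (ha.locallyIntegrable.integrableOn_isCompact hK)

/-- All mollifiers live in the ball of radius 2, so on `K` the field may be truncated to a larger
ball without changing its mollification; this reduces to the global L² case. -/
lemma IsL2Loc.tendsto_lintegral_mollify_sub {a : E n → E n} (ha : IsL2Loc a) {K : Set (E n)}
    (hK : IsCompact K) :
    Tendsto (fun m => ∫⁻ x in K, ‖mollify m a x - a x‖ₑ ^ (2 : ℝ)) atTop (𝓝 0) := by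
  obtain ⟨ρ, hρ⟩ := hK.isBounded.subset_closedBall 0
  set K' := Metric.closedBall (0 : E n) (ρ + 2)
  have hK'm : MeasurableSet K' := measurableSet_closedBall
  have hg : MemLp (K'.indicator a) 2 volume :=
    (memLp_indicator_iff_restrict hK'm).2 (ha K' (isCompact_closedBall _ _))
  refine tendsto_of_tendsto_of_tendsto_of_le_of_le tendsto_const_nhds
    (tendsto_lintegral_mollify_sub_of_memLp hg) (fun _ => zero_le) fun m => ?_
  refine le_trans ?_ (setLIntegral_le_lintegral K _)
  refine setLIntegral_mono_ae' hK.measurableSet (Eventually.of_forall fun x hx => ?_)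
  have hx' : ‖x‖ ≤ ρ := by simpa using hρ hx
  have h1 : K'.indicator a x = a x := Set.indicator_of_mem (by simp [K']; linarith) _
  have h2 : mollify m (K'.indicator a) x = mollify m a x := by
    rw [mollify_eq, mollify_eq]
    refine integral_congr_ae (Eventually.of_forall fun t => ?_)
    simp only
    by_cases ht : t ∈ Function.support ((mollifier n m).normed volume)
    · rw [ContDiffBump.support_normed_eq] at ht
      have ht' : ‖t‖ < 2 := by
        have := rOut_mollifier_le (n := n) m
        have : ‖t‖ < (mollifier n m).rOut := by simpa using ht
        linarith
      rw [Set.indicator_of_mem]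
      simp only [K', mem_closedBall_iff_norm, sub_zero]
      linarith [norm_sub_le x t]
    · have : (mollifier n m).normed volume t = 0 := by simpa using ht
      simp [this]
  rw [h1, h2]

/-- The components of the mollified curl are the curl of the mollified field. -/
lemma IsCurl.fderiv_mollify_sub {a : E n → E n} {B : E n → Matrix (Fin n) (Fin n) ℝ}
    (hB : IsCurl a B) (ha : IsL2Loc a) (m : ℕ) (x : E n) (j k : Fin n) :
    fderiv ℝ (mollify m a) x (EuclideanSpace.single k 1) j -
      fderiv ℝ (mollify m a) x (EuclideanSpace.single j 1) k = mollify m (fun y => B y j k) x := by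
  set ρ := (mollifier n m).normed volume with hρ
  have hρs : ContDiff ℝ ∞ ρ := (mollifier n m).contDiff_normed
  have hρ1 : ContDiff ℝ 1 ρ := hρs.of_le (by simp)
  have hρc : HasCompactSupport ρ := (mollifier n m).hasCompactSupport_normed
  have hd : ∀ v i, Integrable (fun t => fderiv ℝ ρ (x - t) v * a t i) ∧
      fderiv ℝ (mollify m a) x v i = ∫ t, fderiv ℝ ρ (x - t) v * a t i := by
    intro v i
    have h1 := HasCompactSupport.hasFDerivAt_convolution_left (lsmul ℝ ℝ) (μ := volume)
      hρc hρ1 ha.locallyIntegrable x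
    have hex := (HasCompactSupport.convolutionExists_left ((lsmul ℝ ℝ).precompL (E n))
      (μ := volume) (hρc.fderiv ℝ) (hρ1.continuous_fderiv one_ne_zero) ha.locallyIntegrable
      x).integrable_swap
    have h2 : fderiv ℝ (mollify m a) x =
        ∫ t, ((lsmul ℝ ℝ).precompL (E n)) (fderiv ℝ ρ (x - t)) (a t) := by
      rw [← convolution_eq_swap]; exact h1.fderiv
    have hex2 := (ContinuousLinearMap.apply ℝ (E n) v).integrable_comp hex
    refine ⟨?_, ?_⟩
    · have hex3 := (EuclideanSpace.proj (𝕜 := ℝ) i).integrable_comp hex2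
      simpa using hex3
    · have e1 := (ContinuousLinearMap.apply ℝ (E n) v).integral_comp_comm hex
      have e2 := (EuclideanSpace.proj (𝕜 := ℝ) i).integral_comp_comm hex2
      rw [← h2] at e1
      rw [e1] at e2
      simpa using e2.symm
  -- The curl is tested against the reflected mollifier. Reflection changes the sign of the
  -- derivatives, which cancels the minus sign in the distributional definition.
  let ψ : E n → ℝ := fun t => ρ (x - t)
  have hψ : IsTest ψ := ⟨hρs.comp (contDiff_const.sub contDiff_id), by
    have := hρc.comp_homeomorph (Homeomorph.subLeft x)
    exact this⟩
  have hψd : ∀ i t, partialDeriv i ψ t = -fderiv ℝ ρ (x - t) (EuclideanSpace.single i 1) := by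
    intro i t
    have h1 : HasFDerivAt (fun t => x - t) (-ContinuousLinearMap.id ℝ (E n)) t :=
      (hasFDerivAt_id t).const_sub x
    have h2 := ((hρ1.differentiable one_ne_zero (x - t)).hasFDerivAt).comp t h1
    rw [partialDeriv, show ψ = ρ ∘ fun t => x - t from rfl, h2.fderiv]
    simp
  have h := (hB j k).2 ψ hψ
  rw [mollify_eq_swap, (hd _ j).2, (hd _ k).2, ← integral_sub (hd _ j).1 (hd _ k).1]
  have h3 : ∫ t, ρ (x - t) • B t j k = ∫ t, B t j k * ψ t := by
    simp_rw [smul_eq_mul, mul_comm]; rfl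
  rw [h3, h, ← integral_neg]
  refine integral_congr_ae (Eventually.of_forall fun t => ?_)
  simp only [hψd]
  ring

/-- Mollification averages, so an almost everywhere bound on `|B|` near `x` becomes a bound at the
point `x` itself. Such bounds at every point are what integration along rays needs. -/
lemma sum_abs_mollify_le {B : E n → Matrix (Fin n) (Fin n) ℝ}
    (hB : ∀ j k, LocallyIntegrable fun x => B x j k) (m : ℕ) {x : E n} {M : ℝ}
    (hM : ∀ᵐ y, y ∈ Metric.ball x (mollifier n m).rOut → absField B y ≤ M) :
    ∑ j, ∑ k, |mollify m (fun y => B y j k) x| ≤ M := by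
  set ρ := (mollifier n m).normed volume with hρ
  have hint : ∀ j k, Integrable fun t => ρ (x - t) * |B t j k| := fun j k => by
    have := (integrable_mollifier_smul_swap m (hB j k) x).abs
    refine this.congr (Eventually.of_forall fun t => ?_)
    simp only [smul_eq_mul, abs_mul]
    rw [abs_of_nonneg ((mollifier n m).nonneg_normed _)]
  calc ∑ j, ∑ k, |mollify m (fun y => B y j k) x|
      ≤ ∑ j, ∑ k, ∫ t, ρ (x - t) * |B t j k| := by
        gcongr with j _ k _
        rw [mollify_eq_swap]
        refine abs_integral_le_integral_abs.trans (le_of_eq ?_)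
        refine integral_congr_ae (Eventually.of_forall fun t => ?_)
        simp only [smul_eq_mul, abs_mul]
        rw [abs_of_nonneg ((mollifier n m).nonneg_normed _)]
    _ = ∫ t, ρ (x - t) * absField B t := by
        simp only [absField, Finset.mul_sum]
        rw [integral_finsetSum _ fun j _ => integrable_finsetSum _ fun k _ => hint j k]
        refine Finset.sum_congr rfl fun j _ => ?_
        rw [integral_finsetSum _ fun k _ => hint j k]
    _ ≤ ∫ t, ρ (x - t) * M := by
        refine integral_mono_ae ?_ ?_ ?_
        · simp only [absField, Finset.mul_sum]
          exact integrable_finsetSum _ fun j _ => integrable_finsetSum _ fun k _ => hint j k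
        · exact ((mollifier n m).integrable_normed.comp_sub_left x).mul_const M
        · filter_upwards [hM] with t ht
          by_cases hs : x - t ∈ Function.support ρ
          · rw [hρ, ContDiffBump.support_normed_eq] at hs
            have : t ∈ Metric.ball x (mollifier n m).rOut := by
              rw [mem_ball_iff_norm'] ; simpa using hs
            exact mul_le_mul_of_nonneg_left (ht this) ((mollifier n m).nonneg_normed _)
          · have : ρ (x - t) = 0 := by simpa using hs
            simp [this]
    _ = M := by
        rw [integral_mul_const, integral_sub_left_eq_self ρ volume x,
          (mollifier n m).integral_normed, one_mul]

end Mollify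

end MagneticCZ

namespace MagneticCZ

/-! ### From two-point differences to the oscillation about the mean. -/

section Averages

variable {n : ℕ} {F : Type*} [NormedAddCommGroup F] [NormedSpace ℝ F] [CompleteSpace F]

/-- The deviation from the mean is the mean of the differences; Jensen moves the power inside. -/
lemma lintegral_sub_average_rpow_le {c : E n} {R : ℝ} (hR : 0 < R) {u : E n → F}
    (hu : IntegrableOn u (cube c R)) {p : ℝ} (hp : 1 ≤ p) :
    ∫⁻ x in cube c R, ‖u x - ⨍ y in cube c R, u y‖ₑ ^ p ≤
      (volume (cube c R))⁻¹ * ∫⁻ x in cube c R, ∫⁻ y in cube c R, ‖u y - u x‖ₑ ^ p := by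
  set Q := cube c R with hQ
  have hvolpos : volume Q ≠ 0 := (volume_cube_pos c hR).ne'
  have hvoltop : volume Q ≠ ⊤ := volume_cube_ne_top c R
  have : IsFiniteMeasure (volume.restrict Q) := ⟨by simpa using hvoltop.lt_top⟩
  have hne : volume.restrict Q ≠ 0 := by simpa using hvolpos
  have : NeZero (volume.restrict Q) := ⟨hne⟩
  rw [← lintegral_const_mul' _ _ (ENNReal.inv_ne_top.2 hvolpos)]
  refine lintegral_mono fun x => ?_
  simp only
  have e : u x - ⨍ y in Q, u y = - ⨍ y in Q, (u y - u x) := by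
    rw [setAverage_eq, setAverage_eq, integral_sub hu (integrable_const _), smul_sub]
    have h1 : (volume.real Q)⁻¹ • ∫ _y in Q, u x = u x := by
      rw [← setAverage_eq, average_const]
    rw [h1]
    abel
  rw [e, enorm_neg]
  calc ‖⨍ y in Q, (u y - u x)‖ₑ ^ p ≤ (⨍⁻ y in Q, ‖u y - u x‖ₑ ∂volume) ^ p := by
        gcongr
        exact enorm_integral_le_lintegral_enorm _
    _ ≤ ⨍⁻ y in Q, ‖u y - u x‖ₑ ^ p ∂volume :=
        rpow_laverage_le (hu.aestronglyMeasurable.sub aestronglyMeasurable_const).enorm hp hne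
    _ = _ := by rw [setLAverage_eq, ENNReal.div_eq_inv_mul]

end Averages

/-! ### The Poincaré gauge for continuously differentiable fields. -/

section SmoothGauge

open Filter Topology

variable {n : ℕ}

/-- The antisymmetric part of the derivative of a vector field. -/
noncomputable def curlMatrix (A : E n → E n) (x : E n) : Matrix (Fin n) (Fin n) ℝ :=
  Matrix.of fun j k => fderiv ℝ A x (EuclideanSpace.single k 1) j -
    fderiv ℝ A x (EuclideanSpace.single j 1) k

/-- The vector potential of `B` in the Poincaré gauge at `c`. -/
noncomputable def gaugeField (B : E n → Matrix (Fin n) (Fin n) ℝ) (c x : E n) : E n :=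
  WithLp.toLp 2 fun j => ∫ t in (0 : ℝ)..1, t * ∑ k, B (c + t • (x - c)) j k * (x k - c k)

/-- The phase which takes the field `A` to the Poincaré gauge at `c`. -/
noncomputable def gaugePhase (A : E n → E n) (c x : E n) : ℝ :=
  ∫ t in (0 : ℝ)..1, inner ℝ (A (c + t • (x - c))) (x - c)

lemma clm_ext_single {G : Type*} [NormedAddCommGroup G] [NormedSpace ℝ G] {f g : E n →L[ℝ] G}
    (h : ∀ j, f (EuclideanSpace.single j 1) = g (EuclideanSpace.single j 1)) : f = g := by
  apply ContinuousLinearMap.coe_injective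
  refine (EuclideanSpace.basisFun (Fin n) ℝ).toBasis.ext fun j => ?_
  simpa using h j

lemma clm_apply_eq_sum {G : Type*} [NormedAddCommGroup G] [NormedSpace ℝ G] (D : E n →L[ℝ] G)
    (v : E n) : D v = ∑ k, v k • D (EuclideanSpace.single k 1) := by
  conv_lhs => rw [← (EuclideanSpace.basisFun (Fin n) ℝ).sum_repr v]
  simp [map_sum]

/-- The integrand of the differential of `gaugePhase`. -/
noncomputable def gaugePhaseDeriv (A : E n → E n) (c x : E n) (t : ℝ) : E n →L[ℝ] ℝ :=
  innerSL ℝ (A (c + t • (x - c))) + t • (innerSL ℝ (x - c)).comp (fderiv ℝ A (c + t • (x - c)))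

lemma continuous_gaugePhaseDeriv {A : E n → E n} (hA : ContDiff ℝ 1 A) (c : E n) :
    Continuous (Function.uncurry (gaugePhaseDeriv A c)) := by
  have hAc : Continuous A := hA.continuous
  have hDc : Continuous (fderiv ℝ A) := hA.continuous_fderiv one_ne_zero
  unfold gaugePhaseDeriv Function.uncurry
  fun_prop

lemma continuous_gaugePhaseDeriv_right {A : E n → E n} (hA : ContDiff ℝ 1 A) (c x : E n) :
    Continuous (gaugePhaseDeriv A c x) := by
  have hAc : Continuous A := hA.continuous
  have hDc : Continuous (fderiv ℝ A) := hA.continuous_fderiv one_ne_zero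
  unfold gaugePhaseDeriv
  fun_prop

lemma hasFDerivAt_inner_chord {A : E n → E n} (hA : ContDiff ℝ 1 A) (c y : E n) (t : ℝ) :
    HasFDerivAt (fun y => inner ℝ (A (c + t • (y - c))) (y - c)) (gaugePhaseDeriv A c y t) y := by
  have h1 : HasFDerivAt (fun y => c + t • (y - c)) (t • ContinuousLinearMap.id ℝ (E n)) y :=
    (((hasFDerivAt_id y).sub_const c).const_smul t).const_add c
  have h2 := ((hA.differentiable one_ne_zero (c + t • (y - c))).hasFDerivAt).comp y h1
  have h3 := h2.inner ℝ ((hasFDerivAt_id y).sub_const c)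
  refine h3.congr_fderiv ?_
  ext v
  simp [gaugePhaseDeriv, real_inner_comm, inner_smul_left, inner_sub_left]

lemma hasFDerivAt_gaugePhase_integral {A : E n → E n} (hA : ContDiff ℝ 1 A) (c x : E n) :
    HasFDerivAt (gaugePhase A c) (∫ t in (0 : ℝ)..1, gaugePhaseDeriv A c x t) x := by
  have hAc : Continuous A := hA.continuous
  have hF'c := continuous_gaugePhaseDeriv hA c
  obtain ⟨C, hC⟩ := ((isCompact_closedBall x 1).prod
    (isCompact_Icc (a := (0 : ℝ)) (b := 1))).exists_bound_of_continuousOn hF'c.continuousOn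
  have hC' : ∀ t ∈ Set.uIoc (0 : ℝ) 1, ∀ y ∈ Metric.closedBall x 1,
      ‖gaugePhaseDeriv A c y t‖ ≤ C := by
    intro t ht y hy
    rw [Set.uIoc_of_le zero_le_one] at ht
    exact hC (y, t) (Set.mk_mem_prod hy ⟨ht.1.le, ht.2⟩)
  have hcont : ∀ y : E n, Continuous fun t : ℝ => inner ℝ (A (c + t • (y - c))) (y - c) :=
    fun y => by fun_prop
  have hF'x := continuous_gaugePhaseDeriv_right hA c x
  have := intervalIntegral.hasFDerivAt_integral_of_dominated_of_fderiv_le (μ := volume)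
    (Metric.closedBall_mem_nhds x one_pos)
    (Eventually.of_forall fun y => (hcont y).aestronglyMeasurable)
    ((hcont x).intervalIntegrable 0 1) hF'x.aestronglyMeasurable
    (Eventually.of_forall hC') intervalIntegrable_const
    (Eventually.of_forall fun t _ y _ => hasFDerivAt_inner_chord hA c y t)
  exact this

/-- The integrand is the derivative of `t * A (c + t • (x - c)) j`. -/
lemma intervalIntegral_add_deriv_eq {A : E n → E n} (hA : ContDiff ℝ 1 A) (c x : E n)
    (j : Fin n) :
    ∫ t in (0 : ℝ)..1, (A (c + t • (x - c)) j + t * fderiv ℝ A (c + t • (x - c)) (x - c) j) =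
      A x j := by
  have hAc : Continuous A := hA.continuous
  have hDc : Continuous (fderiv ℝ A) := hA.continuous_fderiv one_ne_zero
  have hz : ∀ t : ℝ, HasDerivAt (fun t : ℝ => c + t • (x - c)) (x - c) t := fun t => by
    simpa using ((hasDerivAt_id t).smul_const (x - c)).const_add c
  have hAj : ∀ t : ℝ, HasDerivAt (fun t : ℝ => t * A (c + t • (x - c)) j)
      (A (c + t • (x - c)) j + t * fderiv ℝ A (c + t • (x - c)) (x - c) j) t := by
    intro t
    have h1 := ((hA.differentiable one_ne_zero (c + t • (x - c))).hasFDerivAt).comp_hasDerivAt t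
      (hz t)
    have h2 := (EuclideanSpace.proj (𝕜 := ℝ) j).hasFDerivAt.comp_hasDerivAt t h1
    have h3 := (hasDerivAt_id t).mul h2
    simp only [one_mul, id] at h3
    exact h3
  rw [intervalIntegral.integral_eq_sub_of_hasDerivAt (fun t _ => hAj t)
    (Continuous.intervalIntegrable (by fun_prop) _ _)]
  simp

/-- Differentiating the line integral produces `∂_j A_k`; exchanging it for `∂_k A_j` costs exactly
the curl. What remains is a total derivative in `t`. -/
lemma gaugePhaseDeriv_single (A : E n → E n) (c x : E n) (t : ℝ) (j : Fin n) :
    gaugePhaseDeriv A c x t (EuclideanSpace.single j 1) =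
      (A (c + t • (x - c)) j + t * fderiv ℝ A (c + t • (x - c)) (x - c) j) -
        t * ∑ k, curlMatrix A (c + t • (x - c)) j k * (x k - c k) := by
  have e1 : fderiv ℝ A (c + t • (x - c)) (x - c) j =
      ∑ k, fderiv ℝ A (c + t • (x - c)) (EuclideanSpace.single k 1) j * (x k - c k) := by
    conv_lhs => rw [clm_apply_eq_sum (fderiv ℝ A (c + t • (x - c))) (x - c)]
    simp only [WithLp.ofLp_sum, Finset.sum_apply, PiLp.smul_apply, PiLp.sub_apply, smul_eq_mul]
    exact Finset.sum_congr rfl fun k _ => mul_comm _ _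
  have e2 : inner ℝ (x - c) ((fderiv ℝ A (c + t • (x - c))) (EuclideanSpace.single j 1)) =
      ∑ k, fderiv ℝ A (c + t • (x - c)) (EuclideanSpace.single j 1) k * (x k - c k) := by
    rw [PiLp.inner_apply]
    exact Finset.sum_congr rfl fun k _ => by simp
  have e3 : inner ℝ (A (c + t • (x - c))) (EuclideanSpace.single j (1 : ℝ)) =
      A (c + t • (x - c)) j := by
    simp [EuclideanSpace.inner_single_right]
  simp only [gaugePhaseDeriv, add_apply, smul_apply, ContinuousLinearMap.comp_apply,
    innerSL_apply_apply, smul_eq_mul, curlMatrix, Matrix.of_apply]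
  rw [e1, e2, e3]
  simp only [sub_mul, Finset.sum_sub_distrib]
  ring

/-- The Poincaré lemma with remainder: the field is the gradient of the phase plus a term built from
its curl alone. -/
lemma hasFDerivAt_gaugePhase {A : E n → E n} (hA : ContDiff ℝ 1 A) (c x : E n) :
    HasFDerivAt (gaugePhase A c) (innerSL ℝ (A x - gaugeField (curlMatrix A) c x)) x := by
  have hAc : Continuous A := hA.continuous
  have hDc : Continuous (fderiv ℝ A) := hA.continuous_fderiv one_ne_zero
  refine (hasFDerivAt_gaugePhase_integral hA c x).congr_fderiv (clm_ext_single fun j => ?_)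
  have hF'x := continuous_gaugePhaseDeriv_right hA c x
  rw [ContinuousLinearMap.intervalIntegral_apply (hF'x.intervalIntegrable _ _)]
  have hsingle : innerSL ℝ (A x - gaugeField (curlMatrix A) c x) (EuclideanSpace.single j 1) =
      A x j - gaugeField (curlMatrix A) c x j := by
    simp [EuclideanSpace.inner_single_right]
  rw [hsingle, ← intervalIntegral_add_deriv_eq hA c x j]
  simp only [gaugeField]
  rw [← intervalIntegral.integral_sub (Continuous.intervalIntegrable (by fun_prop) _ _) (by
    apply Continuous.intervalIntegrable
    simp only [curlMatrix, Matrix.of_apply]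
    fun_prop)]
  exact intervalIntegral.integral_congr fun t _ => gaugePhaseDeriv_single A c x t j

lemma continuous_gaugeField {B : E n → Matrix (Fin n) (Fin n) ℝ} (hB : Continuous B) (c : E n) :
    Continuous (gaugeField B c) := by
  unfold gaugeField
  refine (PiLp.continuous_toLp 2 _).comp (continuous_pi fun j => ?_)
  refine intervalIntegral.continuous_parametric_intervalIntegral_of_continuous' ?_ 0 1
  unfold Function.uncurry
  fun_prop

lemma continuous_curlMatrix {A : E n → E n} (hA : ContDiff ℝ 1 A) : Continuous (curlMatrix A) := by
  have hDc : Continuous (fderiv ℝ A) := hA.continuous_fderiv one_ne_zero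
  refine continuous_matrix fun j k => ?_
  simp only [curlMatrix, Matrix.of_apply]
  fun_prop

/-- No second derivative of `A` is needed: the gradient involves only `A` and its curl, which are
continuous. -/
lemma contDiff_gaugePhase {A : E n → E n} (hA : ContDiff ℝ 1 A) (c : E n) :
    ContDiff ℝ 1 (gaugePhase A c) := by
  refine contDiff_one_iff_hasFDerivAt.2 ⟨_, ?_, fun x => hasFDerivAt_gaugePhase hA c x⟩
  have := continuous_gaugeField (continuous_curlMatrix hA) c
  have hAc : Continuous A := hA.continuous
  fun_prop

lemma segment_mem_cube {c x : E n} {R : ℝ} (hx : x ∈ cube c R) {t : ℝ} (ht : t ∈ Set.Icc (0 : ℝ) 1)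
    (hR : 0 ≤ R) : c + t • (x - c) ∈ cube c R := by
  have := convex_cube c R (mem_cube_self c hR) hx (by linarith [ht.2] : 0 ≤ 1 - t) ht.1 (by ring)
  convert this using 1
  module

lemma abs_sum_mul_le {B : E n → Matrix (Fin n) (Fin n) ℝ} {c x : E n} {R M : ℝ} (hR : 0 ≤ R)
    (hx : x ∈ cube c R) {z : E n} (hM : absField B z ≤ M) (j : Fin n) :
    |∑ k, B z j k * (x k - c k)| ≤ R / 2 * M := by
  calc |∑ k, B z j k * (x k - c k)| ≤ ∑ k, |B z j k| * (R / 2) := by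
        refine (Finset.abs_sum_le_sum_abs _ _).trans (Finset.sum_le_sum fun k _ => ?_)
        rw [abs_mul]
        gcongr
        exact hx k
    _ = R / 2 * ∑ k, |B z j k| := by rw [← Finset.sum_mul, mul_comm]
    _ ≤ R / 2 * M := by
        gcongr
        refine le_trans ?_ hM
        exact Finset.single_le_sum (f := fun j => ∑ k, |B z j k|)
          (fun i _ => Finset.sum_nonneg fun k _ => abs_nonneg _) (Finset.mem_univ j)

/-- The ray from `c` to `x` stays in the cube, and the coordinates of `x - c` are at most `R / 2`.
-/
lemma norm_gaugeField_le {B : E n → Matrix (Fin n) (Fin n) ℝ} {c x : E n} {R M : ℝ} (hR : 0 ≤ R)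
    (hx : x ∈ cube c R) (hM : ∀ z ∈ cube c R, absField B z ≤ M) (hM0 : 0 ≤ M) :
    ‖gaugeField B c x‖ ≤ n * (R / 2 * M) := by
  refine norm_le_card_mul (by positivity) fun j => ?_
  simp only [gaugeField]
  rw [← Real.norm_eq_abs]
  have := intervalIntegral.norm_integral_le_of_norm_le_const (a := 0) (b := 1) (C := R / 2 * M)
    (f := fun t => t * ∑ k, B (c + t • (x - c)) j k * (x k - c k)) (fun t ht => by
      rw [Set.uIoc_of_le zero_le_one] at ht
      rw [norm_mul, Real.norm_of_nonneg ht.1.le, Real.norm_eq_abs]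
      have h1 := abs_sum_mul_le hR hx (hM _ (segment_mem_cube hx ⟨ht.1.le, ht.2⟩ hR)) j
      calc t * _ ≤ 1 * (R / 2 * M) := by
            gcongr
            exact ht.2
        _ = _ := one_mul _)
  simpa using this

/-- Almost every ray from `c` meets a conull set in almost every parameter. -/
lemma ae_ae_of_ae_homothety {P : E n → Prop} (hP : ∀ᵐ z, P z) (c : E n) :
    ∀ᵐ x : E n, ∀ᵐ t ∂(volume.restrict (Set.Ioc (0 : ℝ) 1)), P (c + t • (x - c)) := by
  -- The exceptional set is enlarged to a measurable null set so that the two almost-everywhere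
  -- quantifiers can be exchanged. For fixed positive `t`, a homothety pulls null sets back to null
  -- sets.
  obtain ⟨S, hPS, hS, hS0⟩ := exists_measurable_superset_of_null (ae_iff.1 hP)
  have hmain : ∀ᵐ x : E n, ∀ᵐ t ∂(volume.restrict (Set.Ioc (0 : ℝ) 1)), c + t • (x - c) ∉ S := by
    rw [Measure.ae_ae_comm (p := fun (x : E n) (t : ℝ) => c + t • (x - c) ∉ S)]
    · filter_upwards [ae_restrict_mem measurableSet_Ioc] with t ht
      rw [ae_iff]
      simp only [not_not]
      have h1 := lintegral_comp_homothety (S.indicator fun _ => 1) (measurable_const.indicator hS)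
        (c - t • c) ht.1
      rw [lintegral_indicator hS] at h1
      simp only [lintegral_const, Measure.restrict_apply_univ, hS0, mul_zero] at h1
      have h2 : ∀ x : E n, S.indicator (fun _ => (1 : ℝ≥0∞)) (c - t • c + t • x) =
          {x | c + t • (x - c) ∈ S}.indicator (fun _ => 1) x := by
        intro x
        have : c - t • c + t • x = c + t • (x - c) := by module
        rw [this]
        rfl
      simp_rw [h2] at h1
      rw [lintegral_indicator_const, one_mul] at h1
      · exact h1
      · exact hS.preimage (by fun_prop)
    · exact (hS.preimage (f := fun q : E n × ℝ => c + q.2 • (q.1 - c))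
        (Continuous.measurable (by fun_prop))).compl
  filter_upwards [hmain] with x hx
  filter_upwards [hx] with t ht
  by_contra hcon
  exact ht (hPS hcon)

/-- A ray is a null set, so almost everywhere convergence in space says nothing about a given ray;
it does about almost every one. The uniform bound then allows dominated convergence along it. -/
lemma ae_tendsto_gaugeField {B : E n → Matrix (Fin n) (Fin n) ℝ}
    {Bm : ℕ → E n → Matrix (Fin n) (Fin n) ℝ} (hBm : ∀ m, Continuous (Bm m)) {c : E n} {R M : ℝ}
    (hR : 0 ≤ R) (hM : ∀ᶠ m in atTop, ∀ z ∈ cube c R, absField (Bm m) z ≤ M)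
    (hlim : ∀ᵐ z, ∀ j k, Tendsto (fun m => Bm m z j k) atTop (𝓝 (B z j k))) :
    ∀ᵐ x ∂(volume.restrict (cube c R)),
      Tendsto (fun m => gaugeField (Bm m) c x) atTop (𝓝 (gaugeField B c x)) := by
  filter_upwards [ae_restrict_of_ae (ae_ae_of_ae_homothety hlim c),
    ae_restrict_mem (measurableSet_cube c R)] with x hx hxQ
  refine ((PiLp.continuous_toLp 2 _).tendsto _).comp (tendsto_pi_nhds.2 fun j => ?_)
  refine intervalIntegral.tendsto_integral_filter_of_dominated_convergence
    (fun _ => R / 2 * M) (Eventually.of_forall fun m => ?_) ?_ intervalIntegrable_const ?_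
  · have := hBm m
    exact Continuous.aestronglyMeasurable (by fun_prop)
  · filter_upwards [hM] with m hm
    refine Eventually.of_forall fun t ht => ?_
    rw [Set.uIoc_of_le zero_le_one] at ht
    rw [norm_mul, Real.norm_of_nonneg ht.1.le, Real.norm_eq_abs]
    have h1 := abs_sum_mul_le hR hxQ (hm _ (segment_mem_cube hxQ ⟨ht.1.le, ht.2⟩ hR)) j
    calc t * _ ≤ 1 * (R / 2 * M) := by
          gcongr
          exact ht.2
      _ = _ := one_mul _
  · rw [Set.uIoc_of_le zero_le_one]
    rw [ae_restrict_iff' measurableSet_Ioc] at hx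
    filter_upwards [hx] with t ht htm
    refine Tendsto.const_mul _ (tendsto_finsetSum _ fun k _ => ?_)
    exact (ht htm j k).mul_const _

end SmoothGauge

end MagneticCZ

namespace MagneticCZ

/-! ### The gauge for a locally square integrable field with bounded curl. -/

section Gauge

open Filter Topology

variable {n : ℕ}

/-- Hölder's inequality on a finite measure space. -/
lemma tendsto_lintegral_rpow_of_tendsto_sq {α : Type*} [MeasurableSpace α] {μ : Measure α}
    [IsFiniteMeasure μ] {g : ℕ → α → ℝ≥0∞} (hg : ∀ m, AEMeasurable (g m) μ)
    (hlim : Tendsto (fun m => ∫⁻ x, g m x ^ (2 : ℝ) ∂μ) atTop (𝓝 0)) {p : ℝ} (hp : 1 ≤ p)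
    (hp2 : p ≤ 2) : Tendsto (fun m => ∫⁻ x, g m x ^ p ∂μ) atTop (𝓝 0) := by
  have hp0 : 0 < p := by linarith
  have h1 : Tendsto (fun m => (∫⁻ x, g m x ^ (2 : ℝ) ∂μ) ^ (1 / 2 : ℝ) *
      μ Set.univ ^ (1 / p - 1 / 2)) atTop (𝓝 0) := by
    have := ENNReal.Tendsto.mul_const (hlim.ennrpow_const (1 / 2 : ℝ))
      (b := μ Set.univ ^ (1 / p - 1 / 2)) (Or.inr ?_)
    · rwa [ENNReal.zero_rpow_of_pos (by norm_num), zero_mul] at this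
    · refine ENNReal.rpow_ne_top_of_nonneg ?_ (measure_ne_top _ _)
      have := one_div_le_one_div_of_le hp0 hp2
      linarith
  have h2 : Tendsto (fun m => (∫⁻ x, g m x ^ p ∂μ) ^ (1 / p)) atTop (𝓝 0) := by
    refine tendsto_of_tendsto_of_tendsto_of_le_of_le tendsto_const_nhds h1 (fun _ => zero_le)
      fun m => ?_
    have := eLpNorm'_le_eLpNorm'_mul_rpow_measure_univ hp0 hp2 (hg m).aestronglyMeasurable
    simpa [eLpNorm'] using this
  have h3 := h2.ennrpow_const p
  rw [ENNReal.zero_rpow_of_pos hp0] at h3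
  refine h3.congr fun m => ?_
  rw [← ENNReal.rpow_mul, one_div_mul_cancel hp0.ne', ENNReal.rpow_one]

lemma enorm_innerSL (v : E n) : ‖innerSL ℝ v‖ₑ = ‖v‖ₑ := by
  rw [← ofReal_norm, ← ofReal_norm, innerSL_apply_norm]

/-- Phases with convergent gradients converge after normalization by additive constants. -/
lemma exists_phase_limit {c : E n} {R : ℝ} (hR : 0 < R) {Φ : ℕ → E n → ℝ}
    (hΦ : ∀ m, ContDiff ℝ 1 (Φ m)) {G : ℕ → E n → E n} (hGc : ∀ m, Continuous (G m))
    (hG : ∀ m x, fderiv ℝ (Φ m) x = innerSL ℝ (G m x)) {g : E n → E n}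
    (hg : AEStronglyMeasurable g (volume.restrict (cube c R)))
    (hlim : Tendsto (fun m => ∫⁻ x in cube c R, ‖G m x - g x‖ₑ) atTop (𝓝 0)) :
    ∃ (κ : ℕ → ℝ) (φ : E n → ℝ), AEStronglyMeasurable φ volume ∧
      Tendsto (fun m => ∫⁻ x in cube c R, ‖Φ m x - κ m - φ x‖ₑ) atTop (𝓝 0) := by
  set Q := cube c R with hQ
  set μ := volume.restrict Q with hμ
  have hvolpos : volume Q ≠ 0 := (volume_cube_pos c hR).ne'
  have hvoltop : volume Q ≠ ⊤ := volume_cube_ne_top c R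
  have : IsFiniteMeasure μ := ⟨by simpa [hμ] using hvoltop.lt_top⟩
  have hint : ∀ m, IntegrableOn (Φ m) Q := fun m =>
    (hΦ m).continuous.continuousOn.integrableOn_compact (isCompact_cube c R)
  set κ : ℕ → ℝ := fun m => ⨍ y in Q, Φ m y with hκ
  set Ψ : ℕ → E n → ℝ := fun m x => Φ m x - κ m with hΨ
  have hΨmem : ∀ m, MemLp (Ψ m) 1 μ := fun m =>
    memLp_one_iff_integrable.2 ((hint m).sub (integrable_const _))
  set e : ℕ → ℝ≥0∞ := fun m => ∫⁻ x in Q, ‖G m x - g x‖ₑ with he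
  set D : ℝ≥0∞ := 2 ^ n * ENNReal.ofReal (n * R) with hD
  have hDtop : D ≠ ⊤ := by simp [hD, ENNReal.mul_eq_top]
  -- The Poincaré inequality with exponent 1 for `Φ m - Φ l`: with means subtracted, the phases are
  -- as close in L¹ as their gradients.
  have hkey : ∀ m l, eLpNorm (Ψ m - Ψ l) 1 μ ≤ D * e m + D * e l := by
    intro m l
    rw [eLpNorm_one_eq_lintegral_enorm]
    set u : E n → ℝ := fun x => Φ m x - Φ l x with hu
    have huc : ContDiff ℝ 1 u := (hΦ m).sub (hΦ l)
    have huint : IntegrableOn u Q := (hint m).sub (hint l)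
    have h1 := lintegral_sub_average_rpow_le hR huint le_rfl
    have h2 := lintegral_lintegral_enorm_sub_rpow_le huc le_rfl c hR.le
    simp only [ENNReal.rpow_one, Real.rpow_one] at h1 h2
    have hav : ⨍ y in Q, u y = κ m - κ l := by
      simp only [hκ, hu, setAverage_eq]
      rw [integral_sub (hint m) (hint l), smul_sub]
    have e1 : ∀ x, (Ψ m - Ψ l) x = u x - ⨍ y in Q, u y := by
      intro x
      rw [hav]
      simp only [hΨ, hu, Pi.sub_apply]
      ring
    simp_rw [e1]
    have hfd : ∀ x, ‖fderiv ℝ u x‖ₑ ≤ ‖G m x - g x‖ₑ + ‖G l x - g x‖ₑ := by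
      intro x
      have : fderiv ℝ u x = innerSL ℝ (G m x - G l x) := by
        have := fderiv_fun_sub ((hΦ m).differentiable one_ne_zero x)
          ((hΦ l).differentiable one_ne_zero x)
        rw [hu, this, hG, hG, map_sub]
      rw [this, enorm_innerSL, show G m x - G l x = (G m x - g x) - (G l x - g x) by abel]
      exact enorm_sub_le
    have hmeas : ∀ m, AEMeasurable (fun x => ‖G m x - g x‖ₑ) μ := fun m =>
      ((hGc m).aestronglyMeasurable.sub hg).enorm
    calc ∫⁻ x in Q, ‖u x - ⨍ y in Q, u y‖ₑ
        ≤ (volume Q)⁻¹ * (D * volume Q * ∫⁻ x in Q, ‖fderiv ℝ u x‖ₑ) :=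
          h1.trans (by gcongr)
      _ = D * (∫⁻ x in Q, ‖fderiv ℝ u x‖ₑ) * ((volume Q)⁻¹ * volume Q) := by ring
      _ = D * ∫⁻ x in Q, ‖fderiv ℝ u x‖ₑ := by
          rw [ENNReal.inv_mul_cancel hvolpos hvoltop, mul_one]
      _ ≤ D * ∫⁻ x in Q, (‖G m x - g x‖ₑ + ‖G l x - g x‖ₑ) := by
          gcongr with x; exact hfd x
      _ = D * e m + D * e l := by rw [lintegral_add_left' (hmeas m), mul_add]
  have hDe : Tendsto (fun m => D * e m) atTop (𝓝 0) := by
    have := ENNReal.Tendsto.const_mul hlim (Or.inr hDtop)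
    rwa [mul_zero] at this
  have hcauchy : CauchySeq fun m => (hΨmem m).toLp (Ψ m) := by
    rw [EMetric.cauchySeq_iff]
    intro ε hε
    obtain ⟨N, hN⟩ := eventually_atTop.1 ((tendsto_order.1 hDe).2 (ε / 2) (ENNReal.half_pos hε.ne'))
    refine ⟨N, fun m hm l hl => ?_⟩
    rw [Lp.edist_toLp_toLp]
    calc _ ≤ D * e m + D * e l := hkey m l
      _ < ε / 2 + ε / 2 := ENNReal.add_lt_add (hN m hm) (hN l hl)
      _ = ε := ENNReal.add_halves ε
  obtain ⟨L, hL⟩ := cauchySeq_tendsto_of_complete hcauchy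
  refine ⟨κ, Q.indicator L, ?_, ?_⟩
  · exact (aestronglyMeasurable_indicator_iff (measurableSet_cube c R)).2 (Lp.aestronglyMeasurable L)
  · rw [tendsto_iff_edist_tendsto_0] at hL
    refine hL.congr fun m => ?_
    rw [Lp.edist_def, eLpNorm_one_eq_lintegral_enorm]
    refine lintegral_congr_ae ?_
    filter_upwards [(hΨmem m).coeFn_toLp, ae_restrict_mem (measurableSet_cube c R)] with x hx hxQ
    simp only [Pi.sub_apply]
    rw [hx, Set.indicator_of_mem hxQ]

/-- A real phase `φ` on `Q` which takes the limit of the fields `A m` to the field `h`, bounded by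
`M`, together with smooth approximations of the phase and of the field. -/
structure GaugeData (A : ℕ → E n → E n) (Q : Set (E n)) (M : ℝ) where
  φ : E n → ℝ
  h : E n → E n
  Φ : ℕ → E n → ℝ
  H : ℕ → E n → E n
  aestronglyMeasurable_φ : AEStronglyMeasurable φ volume
  aestronglyMeasurable_h : AEStronglyMeasurable h volume
  contDiff_Φ : ∀ m, ContDiff ℝ 1 (Φ m)
  continuous_H : ∀ m, Continuous (H m)
  fderiv_Φ : ∀ m x, fderiv ℝ (Φ m) x = innerSL ℝ (A m x - H m x)
  norm_H_le : ∀ᶠ m in atTop, ∀ x ∈ Q, ‖H m x‖ ≤ M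
  norm_h_le : ∀ᵐ x, ‖h x‖ ≤ M
  tendsto_Φ : Tendsto (fun m => ∫⁻ x in Q, ‖Φ m x - φ x‖ₑ) atTop (𝓝 0)
  tendsto_H : ∀ᵐ x ∂(volume.restrict Q), Tendsto (fun m => H m x) atTop (𝓝 (h x))

lemma IsL2Loc.tendsto_lintegral_mollify_sub_rpow {a : E n → E n} (ha : IsL2Loc a) (c : E n)
    (R : ℝ) {p : ℝ} (hp : 1 ≤ p) (hp2 : p ≤ 2) :
    Tendsto (fun m => ∫⁻ x in cube c R, ‖mollify m a x - a x‖ₑ ^ p) atTop (𝓝 0) := by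
  have : IsFiniteMeasure (volume.restrict (cube c R)) :=
    ⟨by simpa using (volume_cube_ne_top c R).lt_top⟩
  refine tendsto_lintegral_rpow_of_tendsto_sq (fun m => ?_)
    (ha.tendsto_lintegral_mollify_sub (isCompact_cube c R)) hp hp2
  exact ((contDiff_mollify m ha.locallyIntegrable).continuous.aestronglyMeasurable.sub
    ha.locallyIntegrable.aestronglyMeasurable.restrict).enorm

/-- Once the mollifier radius is below `R / 2`, mollification on the cube sees only the doubled
cube, where the curl is bounded. -/
lemma IsCurl.absField_curlMatrix_mollify_le {a : E n → E n}
    {B : E n → Matrix (Fin n) (Fin n) ℝ} (hB : IsCurl a B) (ha : IsL2Loc a) {c : E n} {R M : ℝ}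
    (hR : 0 < R) (hM : ∀ᵐ x ∂(volume.restrict (cube c (2 * R))), absField B x ≤ M) :
    ∀ᶠ m in atTop, ∀ z ∈ cube c R, absField (curlMatrix (mollify m a)) z ≤ M := by
  filter_upwards [(tendsto_order.1 (tendsto_rOut_mollifier (n := n))).2 (R / 2) (by positivity)]
    with m hm z hz
  simp only [absField, curlMatrix, Matrix.of_apply, hB.fderiv_mollify_sub ha]
  refine sum_abs_mollify_le (fun j k => (hB j k).1) m ?_
  rw [ae_restrict_iff' (measurableSet_cube _ _)] at hM
  filter_upwards [hM] with y hy hyb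
  refine hy fun i => ?_
  have h1 := hz i
  have h2 : |(y - z) i| ≤ R / 2 := by
    rw [mem_ball_iff_norm] at hyb
    exact (PiLp.norm_apply_le (y - z) i).trans (hyb.le.trans hm.le)
  simp only [PiLp.sub_apply] at h2
  calc |y i - c i| ≤ |y i - z i| + |z i - c i| := abs_sub_le _ _ _
    _ ≤ _ := by linarith

/-- Every field with bounded curl has a bounded representative, up to a gauge transformation. -/
lemma IsCurl.exists_gaugeData {a : E n → E n} {B : E n → Matrix (Fin n) (Fin n) ℝ}
    (hB : IsCurl a B) (ha : IsL2Loc a) {c : E n} {R M : ℝ} (hR : 0 < R) (hM0 : 0 ≤ M)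
    (hM : ∀ᵐ x ∂(volume.restrict (cube c (2 * R))), absField B x ≤ M) :
    Nonempty (GaugeData (fun m => mollify m a) (cube c R) (n * (R / 2 * M))) := by
  set Q := cube c R with hQ
  have hvoltop : volume Q ≠ ⊤ := volume_cube_ne_top c R
  have : IsFiniteMeasure (volume.restrict Q) := ⟨by simpa using hvoltop.lt_top⟩
  set A : ℕ → E n → E n := fun m => mollify m a with hA
  have hAs : ∀ m, ContDiff ℝ 1 (A m) := fun m => contDiff_mollify m ha.locallyIntegrable
  set H : ℕ → E n → E n := fun m => gaugeField (curlMatrix (A m)) c with hH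
  have hHc : ∀ m, Continuous (H m) := fun m =>
    continuous_gaugeField (continuous_curlMatrix (hAs m)) c
  have hcurl := hB.absField_curlMatrix_mollify_le ha hR hM
  have hlimB : ∀ᵐ z, ∀ j k,
      Tendsto (fun m => curlMatrix (A m) z j k) atTop (𝓝 (B z j k)) := by
    rw [ae_all_iff]
    intro j
    rw [ae_all_iff]
    intro k
    filter_upwards [ae_tendsto_mollify (hB j k).1] with z hz
    refine hz.congr fun m => ?_
    rw [← hB.fderiv_mollify_sub ha]
    rfl
  have hHlim := ae_tendsto_gaugeField (fun m => continuous_curlMatrix (hAs m)) hR.le hcurl hlimB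
  have hHle : ∀ᶠ m in atTop, ∀ x ∈ Q, ‖H m x‖ ≤ n * (R / 2 * M) := by
    filter_upwards [hcurl] with m hm x hx
    exact norm_gaugeField_le hR.le hx hm hM0
  have hhm : AEStronglyMeasurable (gaugeField B c) (volume.restrict Q) :=
    aestronglyMeasurable_of_tendsto_ae atTop (fun m => (hHc m).aestronglyMeasurable) hHlim
  -- Cutting off outside `Q` makes the bound and the measurability hold on the whole space.
  set h : E n → E n := Q.indicator (gaugeField B c) with hh
  have hhQ : ∀ x ∈ Q, h x = gaugeField B c x := fun x hx => Set.indicator_of_mem hx _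
  have hhm' : AEStronglyMeasurable h volume :=
    (aestronglyMeasurable_indicator_iff (measurableSet_cube c R)).2 hhm
  have hHlim' : ∀ᵐ x ∂(volume.restrict Q), Tendsto (fun m => H m x) atTop (𝓝 (h x)) := by
    filter_upwards [hHlim, ae_restrict_mem (measurableSet_cube c R)] with x hx hxQ
    rw [hhQ x hxQ]
    exact hx
  have hhle : ∀ᵐ x, ‖h x‖ ≤ n * (R / 2 * M) := by
    have h1 := hHlim'
    rw [ae_restrict_iff' (measurableSet_cube c R)] at h1
    filter_upwards [h1] with x hx
    by_cases hxQ : x ∈ Q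
    · exact le_of_tendsto (hx hxQ).norm (hHle.mono fun m hm => hm x hxQ)
    · rw [hh, Set.indicator_of_notMem hxQ, norm_zero]
      positivity
  have hHint : Tendsto (fun m => ∫⁻ x in Q, ‖H m x - h x‖ₑ) atTop (𝓝 0) := by
    -- The uniform bound holds only for large indices, so the sequence is shifted before dominated
    -- convergence.
    obtain ⟨N, hN⟩ := eventually_atTop.1 hHle
    rw [← tendsto_add_atTop_iff_nat N]
    have := tendsto_lintegral_of_dominated_convergence' (μ := volume.restrict Q)
      (F := fun m x => ‖H (m + N) x - h x‖ₑ) (f := fun _ => 0)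
      (fun _ => ENNReal.ofReal (2 * (n * (R / 2 * M))))
      (fun m => ((hHc (m + N)).aestronglyMeasurable.sub hhm'.restrict).enorm) ?_ ?_ ?_
    · simpa using this
    · intro m
      filter_upwards [ae_restrict_mem (measurableSet_cube c R), ae_restrict_of_ae hhle]
        with x hx hx2
      rw [← ofReal_norm]
      apply ENNReal.ofReal_le_ofReal
      linarith [norm_sub_le (H (m + N) x) (h x), hN (m + N) (by omega) x hx]
    · simp only [lintegral_const, Measure.restrict_apply_univ]
      exact ENNReal.mul_ne_top ENNReal.ofReal_ne_top hvoltop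
    · filter_upwards [hHlim'] with x hx
      have := (((tendsto_add_atTop_iff_nat N).2 hx).sub_const (h x)).enorm
      simpa using this
  have hAint : Tendsto (fun m => ∫⁻ x in Q, ‖A m x - a x‖ₑ) atTop (𝓝 0) := by
    simpa using ha.tendsto_lintegral_mollify_sub_rpow c R le_rfl one_le_two
  have ham : AEStronglyMeasurable a (volume.restrict Q) :=
    ha.locallyIntegrable.aestronglyMeasurable.restrict
  -- The gradients `A m - H m` converge in L¹ to `a - h`, as both terms do separately; the constants
  -- `κ` are then absorbed into the smooth phases.
  obtain ⟨κ, φ, hφm, hφlim⟩ := exists_phase_limit hR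
    (Φ := fun m => gaugePhase (A m) c) (fun m => contDiff_gaugePhase (hAs m) c)
    (G := fun m x => A m x - H m x) (fun m => (hAs m).continuous.sub (hHc m))
    (fun m x => (hasFDerivAt_gaugePhase (hAs m) c x).fderiv)
    (g := fun x => a x - h x) (ham.sub hhm'.restrict) (by
      have hsum := hAint.add hHint
      rw [add_zero] at hsum
      refine tendsto_of_tendsto_of_tendsto_of_le_of_le tendsto_const_nhds hsum (fun _ => zero_le)
        fun m => ?_
      simp only
      have hmeas : AEMeasurable (fun x => ‖A m x - a x‖ₑ) (volume.restrict Q) :=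
        ((hAs m).continuous.aestronglyMeasurable.sub ham).enorm
      rw [← lintegral_add_left' hmeas]
      refine lintegral_mono fun x => ?_
      simp only
      rw [show A m x - H m x - (a x - h x) = (A m x - a x) - (H m x - h x) by abel]
      exact enorm_sub_le)
  exact ⟨{
    φ := φ
    h := h
    Φ := fun m x => gaugePhase (A m) c x - κ m
    H := H
    aestronglyMeasurable_φ := hφm
    aestronglyMeasurable_h := hhm'
    contDiff_Φ := fun m => (contDiff_gaugePhase (hAs m) c).sub contDiff_const
    continuous_H := hHc
    fderiv_Φ := fun m x => by
      have := ((hasFDerivAt_gaugePhase (hAs m) c x).sub_const (κ m)).fderiv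
      exact this
    norm_H_le := hHle
    norm_h_le := hhle
    tendsto_Φ := hφlim
    tendsto_H := hHlim' }⟩

end Gauge

end MagneticCZ

namespace MagneticCZ

/-! ### What a gauge provides: comparison of phases, gauged Poincaré inequality, weak equation for
the phase. -/

section GaugeProperties

open Filter Topology

variable {n : ℕ}

/-- The unimodular function `e^{iφ}`. -/
noncomputable def phase (φ : E n → ℝ) (x : E n) : ℂ := Complex.exp (Complex.I * (φ x : ℂ))

@[simp] lemma norm_phase (φ : E n → ℝ) (x : E n) : ‖phase φ x‖ = 1 :=
  Complex.norm_exp_I_mul_ofReal _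

lemma phase_mul_phase_neg (φ : E n → ℝ) (x : E n) : phase φ x * phase (-φ) x = 1 := by
  simp [phase, ← Complex.exp_add]

lemma aestronglyMeasurable_phase {φ : E n → ℝ} {μ : Measure (E n)}
    (hφ : AEStronglyMeasurable φ μ) : AEStronglyMeasurable (phase φ) μ := by
  have : Continuous fun t : ℝ => Complex.exp (Complex.I * (t : ℂ)) := by fun_prop
  exact this.comp_aestronglyMeasurable hφ

lemma tendsto_phase {Φ : ℕ → E n → ℝ} {φ : E n → ℝ} {x : E n}
    (h : Tendsto (fun m => Φ m x) atTop (𝓝 (φ x))) :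
    Tendsto (fun m => phase (Φ m) x) atTop (𝓝 (phase φ x)) := by
  have : Continuous fun t : ℝ => Complex.exp (Complex.I * (t : ℂ)) := by fun_prop
  exact (this.tendsto _).comp h

lemma contDiff_phase {φ : E n → ℝ} (hφ : ContDiff ℝ 1 φ) : ContDiff ℝ 1 (phase φ) := by
  have h1 : ContDiff ℝ 1 fun x => (φ x : ℂ) := Complex.ofRealCLM.contDiff.comp hφ
  exact (contDiff_const.mul h1).cexp

lemma hasFDerivAt_phase {φ : E n → ℝ} {φ' : E n →L[ℝ] ℝ} {x : E n} (hφ : HasFDerivAt φ φ' x) :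
    HasFDerivAt (phase φ) (φ'.smulRight (Complex.I * phase φ x)) x := by
  have h1 : HasFDerivAt (fun x => (φ x : ℂ)) (Complex.ofRealCLM.comp φ') x :=
    Complex.ofRealCLM.hasFDerivAt.comp x hφ
  refine ((h1.const_mul Complex.I).cexp).congr_fderiv ?_
  ext v
  simp [phase]
  ring

lemma exists_seq_tendsto_ae_of_lintegral {α : Type*} [MeasurableSpace α] {μ : Measure α}
    {F : ℕ → α → ℝ} {f : α → ℝ} (hF : ∀ m, AEStronglyMeasurable (F m) μ)
    (hf : AEStronglyMeasurable f μ)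
    (h : Tendsto (fun m => ∫⁻ x, ‖F m x - f x‖ₑ ∂μ) atTop (𝓝 0)) :
    ∃ ns : ℕ → ℕ, StrictMono ns ∧ ∀ᵐ x ∂μ, Tendsto (fun i => F (ns i) x) atTop (𝓝 (f x)) := by
  refine (tendstoInMeasure_of_tendsto_eLpNorm one_ne_zero hF hf ?_).exists_seq_tendsto_ae
  refine h.congr fun m => ?_
  rw [eLpNorm_one_eq_lintegral_enorm]
  rfl

variable {A : ℕ → E n → E n} {M : ℝ}

lemma GaugeData.exists_seq {Q : Set (E n)} (g : GaugeData A Q M) :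
    ∃ ns : ℕ → ℕ, StrictMono ns ∧
      ∀ᵐ x ∂(volume.restrict Q), Tendsto (fun i => g.Φ (ns i) x) atTop (𝓝 (g.φ x)) :=
  exists_seq_tendsto_ae_of_lintegral (fun m => (g.contDiff_Φ m).continuous.aestronglyMeasurable)
    g.aestronglyMeasurable_φ.restrict g.tendsto_Φ

lemma norm_phase_sub_phase_le (s t : ℝ) :
    ‖Complex.exp (Complex.I * (s : ℂ)) - Complex.exp (Complex.I * (t : ℂ))‖ ≤ |s - t| := by
  have h1 : Complex.exp (Complex.I * (s : ℂ)) - Complex.exp (Complex.I * (t : ℂ)) =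
      Complex.exp (Complex.I * (t : ℂ)) * (Complex.exp (Complex.I * ((s - t : ℝ) : ℂ)) - 1) := by
    rw [mul_sub, ← Complex.exp_add]
    push_cast
    ring_nf
  rw [h1, norm_mul, Complex.norm_exp_I_mul_ofReal, one_mul]
  exact Real.norm_exp_I_mul_ofReal_sub_one_le

/-- Constants transported in two gauges differ by a function of Lipschitz modulus. -/
lemma GaugeData.abs_norm_sub_sub_le {Q₁ Q₂ : Set (E n)} {M₁ M₂ : ℝ} (hQ : Convex ℝ (Q₁ ∩ Q₂))
    (hm : MeasurableSet (Q₁ ∩ Q₂)) (g₁ : GaugeData A Q₁ M₁) (g₂ : GaugeData A Q₂ M₂)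
    (z₁ z₂ : ℂ) :
    ∃ S : Set (E n), (∀ᵐ x ∂(volume.restrict (Q₁ ∩ Q₂)), x ∈ S) ∧ ∀ x ∈ S, ∀ y ∈ S,
      |‖z₁ * phase g₁.φ x - z₂ * phase g₂.φ x‖ - ‖z₁ * phase g₁.φ y - z₂ * phase g₂.φ y‖| ≤
        min ‖z₁‖ ‖z₂‖ * ((M₁ + M₂) * ‖x - y‖) := by
  -- A subsequence of a subsequence, so that both phases converge almost everywhere along the same
  -- indices.
  obtain ⟨ns, hns, h1⟩ := g₁.exists_seq
  obtain ⟨ms, hms, h2⟩ := exists_seq_tendsto_ae_of_lintegral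
    (μ := volume.restrict Q₂) (F := fun i => g₂.Φ (ns i)) (f := g₂.φ)
    (fun m => (g₂.contDiff_Φ _).continuous.aestronglyMeasurable)
    g₂.aestronglyMeasurable_φ.restrict (g₂.tendsto_Φ.comp hns.tendsto_atTop)
  refine ⟨{x | x ∈ Q₁ ∩ Q₂ ∧ Tendsto (fun i => g₁.Φ (ns (ms i)) x) atTop (𝓝 (g₁.φ x)) ∧
    Tendsto (fun i => g₂.Φ (ns (ms i)) x) atTop (𝓝 (g₂.φ x))}, ?_, ?_⟩
  · filter_upwards [ae_restrict_mem hm, ae_restrict_of_ae_restrict_of_subset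
      Set.inter_subset_left h1, ae_restrict_of_ae_restrict_of_subset Set.inter_subset_right h2]
      with x hx hx1 hx2
    exact ⟨hx, hx1.comp hms.tendsto_atTop, hx2⟩
  · rintro x ⟨hxQ, hx1, hx2⟩ y ⟨hyQ, hy1, hy2⟩
    set θ : E n → ℝ := fun x => g₁.φ x - g₂.φ x with hθ
    -- Both approximate phases come from the same field `A m`, which cancels: the gradient of their
    -- difference is `H₂ - H₁`. The Lipschitz bound on the convex intersection survives the limit.
    have hθle : |θ x - θ y| ≤ (M₁ + M₂) * ‖x - y‖ := by
      have hlim : Tendsto (fun i => |(g₁.Φ (ns (ms i)) x - g₂.Φ (ns (ms i)) x) -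
          (g₁.Φ (ns (ms i)) y - g₂.Φ (ns (ms i)) y)|) atTop (𝓝 |θ x - θ y|) :=
        ((hx1.sub hx2).sub (hy1.sub hy2)).abs
      refine le_of_tendsto hlim ?_
      have hsub : Tendsto (fun i => ns (ms i)) atTop atTop :=
        hns.tendsto_atTop.comp hms.tendsto_atTop
      filter_upwards [hsub.eventually g₁.norm_H_le, hsub.eventually g₂.norm_H_le] with i hi1 hi2
      set m := ns (ms i)
      have hd1 := fun z => (g₁.contDiff_Φ m).differentiable one_ne_zero z
      have hd2 := fun z => (g₂.contDiff_Φ m).differentiable one_ne_zero z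
      refine hQ.norm_image_sub_le_of_norm_fderiv_le (𝕜 := ℝ)
        (f := fun z => g₁.Φ m z - g₂.Φ m z) (fun z _ => (hd1 z).sub (hd2 z)) (fun z hz => ?_)
        hyQ hxQ
      rw [fderiv_fun_sub (hd1 z) (hd2 z), g₁.fderiv_Φ, g₂.fderiv_Φ, ← map_sub, innerSL_apply_norm,
        show A m z - g₁.H m z - (A m z - g₂.H m z) = g₂.H m z - g₁.H m z by abel]
      linarith [norm_sub_le (g₂.H m z) (g₁.H m z), hi1 z hz.1, hi2 z hz.2]
    -- A common unimodular factor does not change the modulus, so the relative phase can be attached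
    -- to either constant. Attaching it to the smaller one gives the minimum.
    have e1 : ∀ w, ‖z₁ * phase g₁.φ w - z₂ * phase g₂.φ w‖ =
        ‖z₁ * Complex.exp (Complex.I * (θ w : ℂ)) - z₂‖ := by
      intro w
      have : z₁ * phase g₁.φ w - z₂ * phase g₂.φ w =
          phase g₂.φ w * (z₁ * Complex.exp (Complex.I * (θ w : ℂ)) - z₂) := by
        have h3 : phase g₁.φ w = phase g₂.φ w * Complex.exp (Complex.I * (θ w : ℂ)) := by
          rw [phase, phase, ← Complex.exp_add, hθ]
          push_cast
          ring_nf
        rw [h3]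
        ring
      rw [this, norm_mul, norm_phase, one_mul]
    have e2 : ∀ w, ‖z₁ * phase g₁.φ w - z₂ * phase g₂.φ w‖ =
        ‖z₁ - z₂ * Complex.exp (Complex.I * ((-θ w : ℝ) : ℂ))‖ := by
      intro w
      have : z₁ * phase g₁.φ w - z₂ * phase g₂.φ w =
          phase g₁.φ w * (z₁ - z₂ * Complex.exp (Complex.I * ((-θ w : ℝ) : ℂ))) := by
        have h3 : phase g₂.φ w = phase g₁.φ w * Complex.exp (Complex.I * ((-θ w : ℝ) : ℂ)) := by
          rw [phase, phase, ← Complex.exp_add, hθ]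
          push_cast
          ring_nf
        rw [h3]
        ring
      rw [this, norm_mul, norm_phase, one_mul]
    have hn0 : 0 ≤ (M₁ + M₂) * ‖x - y‖ := (abs_nonneg _).trans hθle
    rcases le_total ‖z₁‖ ‖z₂‖ with h | h
    · rw [min_eq_left h, e1, e1]
      refine (abs_norm_sub_norm_le _ _).trans ?_
      rw [sub_sub_sub_cancel_right, ← mul_sub, norm_mul]
      gcongr
      exact (norm_phase_sub_phase_le _ _).trans hθle
    · rw [min_eq_right h, e2, e2]
      refine (abs_norm_sub_norm_le _ _).trans ?_
      rw [sub_sub_sub_cancel_left, ← mul_sub, norm_mul]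
      gcongr
      refine (norm_phase_sub_phase_le _ _).trans ?_
      rwa [neg_sub_neg]

variable {a : E n → E n} {c : E n} {R : ℝ}

/-- Gauge covariance: `e^{-iΦ} f` has the covariant derivative of `f` for the field `∇Φ`, and
passing from `∇Φ` to `a` costs `|a - ∇Φ| |f|`. -/
lemma norm_fderiv_phase_neg_mul_le {Φ : E n → ℝ} (hΦ : ContDiff ℝ 1 Φ) {f : E n → ℂ}
    (hf : ContDiff ℝ 1 f) {w : E n} {x : E n} (hw : fderiv ℝ Φ x = innerSL ℝ w) :
    ‖fderiv ℝ (fun y => phase (-Φ) y * f y) x‖ ≤ ‖magGrad a f x‖ + ‖a x - w‖ * ‖f x‖ := by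
  have h1 : HasFDerivAt (-Φ) (-innerSL ℝ w) x := by
    rw [← hw]; exact ((hΦ.differentiable one_ne_zero x).hasFDerivAt).neg
  have h2 := (hasFDerivAt_phase h1).mul ((hf.differentiable one_ne_zero x).hasFDerivAt)
  rw [show (fun y => phase (-Φ) y * f y) = (phase (-Φ) * f) from rfl, h2.fderiv]
  have e : phase (-Φ) x • fderiv ℝ f x +
      f x • (-innerSL ℝ w).smulRight (Complex.I * phase (-Φ) x) =
      phase (-Φ) x • ((fderiv ℝ f x - (innerSL ℝ (a x)).smulRight (Complex.I * f x)) +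
        (innerSL ℝ (a x - w)).smulRight (Complex.I * f x)) := by
    ext v
    simp
    ring
  rw [e, norm_smul, norm_phase, one_mul]
  refine (norm_add_le _ _).trans ?_
  gcongr
  · exact norm_fderiv_sub_le_magGrad a f x
  · rw [ContinuousLinearMap.norm_smulRight_apply, innerSL_apply_norm, norm_mul, Complex.norm_I,
      one_mul]

/-- Poincaré inequality in a gauge: `f` is close to a transported constant. -/
lemma GaugeData.lintegral_sub_phase_rpow_le (ha : IsL2Loc a) (hR : 0 < R)
    (g : GaugeData (fun m => mollify m a) (cube c R) M) (hM : 0 ≤ M) {f : E n → ℂ}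
    (hf : ContDiff ℝ 1 f) (hfc : HasCompactSupport f) {p : ℝ} (hp : 1 ≤ p) (hp2 : p ≤ 2) :
    ∫⁻ x in cube c R, ‖f x - (⨍ y in cube c R, phase (-g.φ) y * f y) * phase g.φ x‖ₑ ^ p ≤
      2 ^ n * ENNReal.ofReal ((n * R) ^ p) * (2 ^ (p - 1) *
        ∫⁻ x in cube c R, (‖magGrad a f x‖ₑ + ENNReal.ofReal M * ‖f x‖ₑ) ^ p) := by
  have hp0 : 0 < p := by linarith
  have hvolpos : volume (cube c R) ≠ 0 := (volume_cube_pos c hR).ne'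
  have hvoltop : volume (cube c R) ≠ ⊤ := volume_cube_ne_top c R
  have : IsFiniteMeasure (volume.restrict (cube c R)) := ⟨by simpa using hvoltop.lt_top⟩
  obtain ⟨S, hS⟩ := hf.continuous.bounded_above_of_compact_support hfc
  have hfcont : Continuous f := hf.continuous
  obtain ⟨ns, hns, hlim⟩ := g.exists_seq
  set u : E n → ℂ := fun y => phase (-g.φ) y * f y with hu
  have hum : AEStronglyMeasurable u volume :=
    (aestronglyMeasurable_phase g.aestronglyMeasurable_φ.neg).mul hfcont.aestronglyMeasurable
  have huint : IntegrableOn u (cube c R) := by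
    refine Measure.integrableOn_of_bounded (M := S) hvoltop hum
      (Eventually.of_forall fun x => ?_)
    simpa [hu] using hS x
  set U : ℕ → E n → ℂ := fun i y => phase (-g.Φ (ns i)) y * f y with hU
  have hUs : ∀ i, ContDiff ℝ 1 (U i) := fun i =>
    (contDiff_phase (g.contDiff_Φ (ns i)).neg).mul hf
  have hUc : ∀ i, Continuous (U i) := fun i => (hUs i).continuous
  have hUlim : ∀ᵐ x ∂(volume.restrict (cube c R)), Tendsto (fun i => U i x) atTop (𝓝 (u x)) := by
    filter_upwards [hlim] with x hx
    exact (tendsto_phase (Φ := fun i => -g.Φ (ns i)) (φ := -g.φ) hx.neg).mul_const _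
  set J := ∫⁻ x in cube c R, (‖magGrad a f x‖ₑ + ENNReal.ofReal M * ‖f x‖ₑ) ^ p with hJ
  set e : ℕ → ℝ≥0∞ := fun i => ∫⁻ x in cube c R, ‖mollify (ns i) a x - a x‖ₑ ^ p with he
  have helim : Tendsto e atTop (𝓝 0) :=
    (ha.tendsto_lintegral_mollify_sub_rpow c R hp hp2).comp hns.tendsto_atTop
  set K : ℝ≥0∞ := 2 ^ n * ENNReal.ofReal ((n * R) ^ p) with hK
  have hKtop : K ≠ ⊤ := by simp [hK, ENNReal.mul_eq_top]
  have ham : AEStronglyMeasurable a (volume.restrict (cube c R)) := ha.locallyIntegrable.aestronglyMeasurable.restrict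
  -- Here `a - ∇Φ = H - (A - a)`. The first term is at most `M`; the second tends to 0 in L^p and is
  -- multiplied by `f`, which is bounded by `S`, so `S` disappears in the limit.
  have hder : ∀ᶠ i in atTop, ∫⁻ x in cube c R, ‖fderiv ℝ (U i) x‖ₑ ^ p ≤
      2 ^ (p - 1) * (J + ENNReal.ofReal S ^ p * e i) := by
    filter_upwards [hns.tendsto_atTop.eventually g.norm_H_le] with i hi
    have hmeas : AEMeasurable (fun x => (ENNReal.ofReal S * ‖mollify (ns i) a x - a x‖ₑ) ^ p)
        (volume.restrict (cube c R)) := by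
      refine AEMeasurable.pow_const (AEMeasurable.const_mul ?_ _) _
      exact ((contDiff_mollify (ns i) ha.locallyIntegrable).continuous.aestronglyMeasurable.sub
        ham).enorm
    have h1 : ∀ x ∈ cube c R, ‖fderiv ℝ (U i) x‖ₑ ^ p ≤ 2 ^ (p - 1) *
        ((‖magGrad a f x‖ₑ + ENNReal.ofReal M * ‖f x‖ₑ) ^ p +
          (ENNReal.ofReal S * ‖mollify (ns i) a x - a x‖ₑ) ^ p) := by
      intro x hx
      refine le_trans ?_ (ENNReal.rpow_add_le_mul_rpow_add_rpow _ _ hp)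
      gcongr
      have h2 := norm_fderiv_phase_neg_mul_le (a := a) (g.contDiff_Φ (ns i)) hf
        (g.fderiv_Φ (ns i) x)
      have h3 : ‖a x - (mollify (ns i) a x - g.H (ns i) x)‖ ≤
          ‖mollify (ns i) a x - a x‖ + M := by
        rw [show a x - (mollify (ns i) a x - g.H (ns i) x) =
          g.H (ns i) x - (mollify (ns i) a x - a x) by abel]
        linarith [norm_sub_le (g.H (ns i) x) (mollify (ns i) a x - a x), hi x hx]
      simp only [← ofReal_norm]
      rw [← ENNReal.ofReal_mul hM, ← ENNReal.ofReal_mul ((norm_nonneg _).trans (hS x)),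
        ← ENNReal.ofReal_add (by positivity) (by positivity), ← ENNReal.ofReal_add (by positivity)
        (mul_nonneg ((norm_nonneg _).trans (hS x)) (norm_nonneg _))]
      apply ENNReal.ofReal_le_ofReal
      refine h2.trans ?_
      have h4 : ‖mollify (ns i) a x - a x‖ * ‖f x‖ ≤ S * ‖mollify (ns i) a x - a x‖ := by
        rw [mul_comm]; gcongr; exact hS x
      nlinarith [mul_le_mul_of_nonneg_right h3 (norm_nonneg (f x))]
    calc ∫⁻ x in cube c R, ‖fderiv ℝ (U i) x‖ₑ ^ p
        ≤ ∫⁻ x in cube c R, 2 ^ (p - 1) * ((‖magGrad a f x‖ₑ + ENNReal.ofReal M * ‖f x‖ₑ) ^ p +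
          (ENNReal.ofReal S * ‖mollify (ns i) a x - a x‖ₑ) ^ p) :=
          setLIntegral_mono' (measurableSet_cube c R) h1
      _ = 2 ^ (p - 1) * (J + ENNReal.ofReal S ^ p * e i) := by
          rw [lintegral_const_mul' _ _ (by simp), lintegral_add_right' _ hmeas]
          simp_rw [ENNReal.mul_rpow_of_nonneg _ _ hp0.le]
          rw [lintegral_const_mul' _ _ (by simp [hp0.le])]
  have hpair : ∫⁻ x in cube c R, ∫⁻ y in cube c R, ‖u y - u x‖ₑ ^ p ≤
      K * volume (cube c R) * (2 ^ (p - 1) * J) := by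
    have hum' : AEStronglyMeasurable u (volume.restrict (cube c R)) := hum.restrict
    have hmeas : AEMeasurable (fun q : E n × E n => ‖u q.2 - u q.1‖ₑ ^ p) 
        ((volume.restrict (cube c R)).prod (volume.restrict (cube c R))) :=
      ((hum'.comp_snd.sub hum'.comp_fst).enorm).pow_const _
    have hrw := (lintegral_prod _ hmeas).symm
    simp only at hrw
    rw [hrw]
    refine lintegral_le_of_tendsto_ae (G := fun i q => ‖U i q.2 - U i q.1‖ₑ ^ p)
      (K := fun i => K * volume (cube c R) * (2 ^ (p - 1) * (J + ENNReal.ofReal S ^ p * e i)))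
      (fun i => Measurable.aemeasurable (Continuous.measurable (by fun_prop))) ?_ ?_ ?_
    · filter_upwards [Measure.quasiMeasurePreserving_fst.ae hUlim,
        Measure.quasiMeasurePreserving_snd.ae hUlim] with q h1 h2
      exact ((h2.sub h1).enorm).ennrpow_const p
    · filter_upwards [hder] with i hi
      rw [lintegral_prod _ (Measurable.aemeasurable (Continuous.measurable (by fun_prop)))]
      refine (lintegral_lintegral_enorm_sub_rpow_le (hUs i) hp c hR.le).trans ?_
      gcongr
    · have h1 : Tendsto (fun i => J + ENNReal.ofReal S ^ p * e i) atTop (𝓝 J) := by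
        have := (ENNReal.Tendsto.const_mul helim (a := ENNReal.ofReal S ^ p)
          (Or.inr (by simp [hp0.le]))).const_add J
        simpa using this
      exact ENNReal.Tendsto.const_mul (ENNReal.Tendsto.const_mul h1 (Or.inr (by simp)))
        (Or.inr (ENNReal.mul_ne_top hKtop hvoltop))
  -- Multiplication by the phase is an isometry, so the estimate for `e^{-iφ} f` about its mean is
  -- the one for `f` about the transported mean.
  have hcong : ∀ x, ‖f x - (⨍ y in cube c R, u y) * phase g.φ x‖ₑ = ‖u x - ⨍ y in cube c R, u y‖ₑ := by
    intro x
    have : f x - (⨍ y in cube c R, u y) * phase g.φ x = phase g.φ x * (u x - ⨍ y in cube c R, u y) := by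
      simp only [hu]
      rw [mul_sub, ← mul_assoc, phase_mul_phase_neg, one_mul]
      ring
    rw [this, enorm_mul, ← ofReal_norm (phase g.φ x), norm_phase, ENNReal.ofReal_one, one_mul]
  calc _ = ∫⁻ x in cube c R, ‖u x - ⨍ y in cube c R, u y‖ₑ ^ p := lintegral_congr fun x => by rw [← hcong x]
    _ ≤ (volume (cube c R))⁻¹ * ∫⁻ x in cube c R, ∫⁻ y in cube c R, ‖u y - u x‖ₑ ^ p :=
        lintegral_sub_average_rpow_le hR huint hp
    _ ≤ (volume (cube c R))⁻¹ * (K * volume (cube c R) * (2 ^ (p - 1) * J)) := by gcongr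
    _ = K * (2 ^ (p - 1) * J) * ((volume (cube c R))⁻¹ * volume (cube c R)) := by ring
    _ = _ := by rw [ENNReal.inv_mul_cancel hvolpos hvoltop, mul_one]

lemma continuous_partialDeriv {ψ : E n → ℂ} (hψ : IsTest ψ) (j : Fin n) :
    Continuous (partialDeriv j ψ) := by
  have : Continuous (fderiv ℝ ψ) := hψ.1.continuous_fderiv (by simp)
  unfold partialDeriv
  fun_prop

lemma hasCompactSupport_partialDeriv {ψ : E n → ℂ} (hψ : IsTest ψ) (j : Fin n) :
    HasCompactSupport (partialDeriv j ψ) :=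
  (hψ.2.fderiv ℝ).comp_left (g := fun D : E n →L[ℝ] ℂ => D (EuclideanSpace.single j 1)) rfl

lemma partialDeriv_eq_zero_of_notMem {Q : Set (E n)} (hQ : IsClosed Q) {ψ : E n → ℂ}
    (hψ : Function.support ψ ⊆ Q) (j : Fin n) {x : E n} (hx : x ∉ Q) : partialDeriv j ψ x = 0 := by
  have h1 : x ∉ tsupport ψ := fun h => hx (closure_minimal hψ hQ h)
  rw [partialDeriv, fderiv_of_notMem_tsupport ℝ h1]
  rfl

lemma integral_phase_mul_partialDeriv {Φ : E n → ℝ} (hΦ : ContDiff ℝ 1 Φ) {G : E n → E n}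
    (hG : ∀ x, fderiv ℝ Φ x = innerSL ℝ (G x)) {ψ : E n → ℂ} (hψ : IsTest ψ) (j : Fin n) :
    ∫ x, phase Φ x * partialDeriv j ψ x = -∫ x, Complex.I * ((G x j : ℂ) * (phase Φ x * ψ x)) := by
  have hpc : ContDiff ℝ 1 (phase Φ) := contDiff_phase hΦ
  have hpcc : Continuous (phase Φ) := hpc.continuous
  have hder : ∀ x, fderiv ℝ (phase Φ) x (EuclideanSpace.single j 1) * ψ x =
      Complex.I * ((G x j : ℂ) * (phase Φ x * ψ x)) := by
    intro x
    rw [(hasFDerivAt_phase (hΦ.differentiable one_ne_zero x).hasFDerivAt).fderiv, hG]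
    simp [EuclideanSpace.inner_single_right]
    ring
  have hψd : Differentiable ℝ ψ := hψ.1.differentiable (by simp)
  have hdc : Continuous (fderiv ℝ (phase Φ)) := hpc.continuous_fderiv one_ne_zero
  have := integral_mul_fderiv_eq_neg_fderiv_mul_of_integrable (μ := volume) (f := phase Φ) (g := ψ)
    (v := EuclideanSpace.single j 1)
    (Continuous.integrable_of_hasCompactSupport
      (by have := hψ.1.continuous; fun_prop) (hψ.2.mul_left))
    (Continuous.integrable_of_hasCompactSupport
      (hpcc.mul (continuous_partialDeriv hψ j)) (hasCompactSupport_partialDeriv hψ j).mul_left)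
    (Continuous.integrable_of_hasCompactSupport
      (hpcc.mul hψ.1.continuous) hψ.2.mul_left)
    (fun x _ => hpc.differentiable one_ne_zero x) (fun x _ => hψd x)
  simp_rw [hder] at this
  exact this

lemma IsL2Loc.integrable_mul_test (ha : IsL2Loc a) {ψ : E n → ℂ} (hψ : Continuous ψ)
    (hψc : HasCompactSupport ψ) (j : Fin n) : Integrable fun x => (a x j : ℂ) * ψ x := by
  have h1 := (ha.locallyIntegrable_apply j).integrable_smul_left_of_hasCompactSupport
    hψ.norm hψc.norm
  refine h1.norm.mono' ?_ (Eventually.of_forall fun x => ?_)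
  · exact (Complex.continuous_ofReal.comp_aestronglyMeasurable
      (ha.locallyIntegrable_apply j).aestronglyMeasurable).mul hψ.aestronglyMeasurable
  · simp [mul_comm]

/-- In the sense of distributions, `L e^{iφ} = -h e^{iφ}` in the interior of the cube. -/
lemma GaugeData.integral_phase (ha : IsL2Loc a)
    (g : GaugeData (fun m => mollify m a) (cube c R) M) (j : Fin n) {ψ : E n → ℂ} (hψ : IsTest ψ)
    (hsupp : Function.support ψ ⊆ cube c R) :
    ∫ x, -(g.h x j : ℂ) * phase g.φ x * ψ x =
      ∫ x, (-(1 / Complex.I) * (phase g.φ x * partialDeriv j ψ x) -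
        (a x j : ℂ) * phase g.φ x * ψ x) := by
  obtain ⟨ns, hns, hlim⟩ := g.exists_seq
  rw [ae_restrict_iff' (measurableSet_cube c R)] at hlim
  have hHlim := g.tendsto_H
  rw [ae_restrict_iff' (measurableSet_cube c R)] at hHlim
  obtain ⟨S, hS⟩ := hψ.1.continuous.bounded_above_of_compact_support hψ.2
  have hψ0 : ∀ x, x ∉ cube c R → ψ x = 0 := fun x hx => by
    by_contra h; exact hx (hsupp h)
  have hdψ0 : ∀ x, x ∉ cube c R → partialDeriv j ψ x = 0 := fun x hx =>
    partialDeriv_eq_zero_of_notMem (isClosed_cube c R) hsupp j hx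
  have hAc : ∀ m, Continuous (mollify m a) := fun m => (contDiff_mollify m ha.locallyIntegrable).continuous
  set e : ℕ → E n → ℂ := fun i => phase (g.Φ (ns i)) with he
  have hec : ∀ i, Continuous (e i) := fun i => (contDiff_phase (g.contDiff_Φ (ns i))).continuous
  have helim : ∀ᵐ x, x ∈ cube c R → Tendsto (fun i => e i x) atTop (𝓝 (phase g.φ x)) := by
    filter_upwards [hlim] with x hx hxQ
    exact tendsto_phase (Φ := fun i => g.Φ (ns i)) (hx hxQ)
  have hem : AEStronglyMeasurable (phase g.φ) volume :=
    aestronglyMeasurable_phase g.aestronglyMeasurable_φ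
  have hψc : Continuous ψ := hψ.1.continuous
  have hdψc := continuous_partialDeriv hψ j
  have hdψi : Integrable (partialDeriv j ψ) :=
    hdψc.integrable_of_hasCompactSupport (hasCompactSupport_partialDeriv hψ j)
  have haψi : Integrable fun x => (a x j : ℂ) * ψ x := ha.integrable_mul_test hψc hψ.2 j
  -- the three limits
  have hT : Tendsto (fun i => ∫ x, e i x * partialDeriv j ψ x) atTop
      (𝓝 (∫ x, phase g.φ x * partialDeriv j ψ x)) := by
    refine tendsto_integral_of_dominated_convergence (fun x => ‖partialDeriv j ψ x‖)
      (fun i => ((hec i).mul hdψc).aestronglyMeasurable) hdψi.norm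
      (fun i => Eventually.of_forall fun x => by simp [he]) ?_
    filter_upwards [helim] with x hx
    by_cases hxQ : x ∈ cube c R
    · exact (hx hxQ).mul_const _
    · simp [hdψ0 x hxQ]
  have hX2 : Tendsto (fun i => ∫ x, (a x j : ℂ) * (e i x * ψ x)) atTop
      (𝓝 (∫ x, (a x j : ℂ) * (phase g.φ x * ψ x))) := by
    refine tendsto_integral_of_dominated_convergence (fun x => ‖(a x j : ℂ) * ψ x‖)
      (fun i => ?_) haψi.norm (fun i => Eventually.of_forall fun x => by simp [he]) ?_
    · exact (Complex.continuous_ofReal.comp_aestronglyMeasurable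
        (ha.locallyIntegrable_apply j).aestronglyMeasurable).mul
          ((hec i).mul hψc).aestronglyMeasurable
    · filter_upwards [helim] with x hx
      by_cases hxQ : x ∈ cube c R
      · exact ((hx hxQ).mul_const _).const_mul _
      · simp [hψ0 x hxQ]
  have hX1 : Tendsto (fun i => ∫ x, ((mollify (ns i) a x j - a x j : ℝ) : ℂ) * (e i x * ψ x)) atTop
      (𝓝 0) := by
    have hAint : Tendsto (fun i => ∫⁻ x in cube c R, ‖mollify (ns i) a x - a x‖ₑ) atTop (𝓝 0) := by
      have := (ha.tendsto_lintegral_mollify_sub_rpow c R le_rfl one_le_two).comp hns.tendsto_atTop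
      simpa [Function.comp_def] using this
    have hAint2 := ENNReal.Tendsto.const_mul hAint (a := ENNReal.ofReal S)
      (Or.inr ENNReal.ofReal_ne_top)
    rw [mul_zero] at hAint2
    rw [tendsto_zero_iff_norm_tendsto_zero, ← tendsto_zero_iff_norm_tendsto_zero,
      tendsto_iff_edist_tendsto_0]
    refine tendsto_of_tendsto_of_tendsto_of_le_of_le tendsto_const_nhds hAint2 (fun _ => zero_le)
      fun i => ?_
    simp only [edist_zero_right]
    refine (enorm_integral_le_lintegral_enorm _).trans ?_
    rw [← lintegral_const_mul' _ _ ENNReal.ofReal_ne_top, ← lintegral_indicator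
      (measurableSet_cube c R)]
    refine lintegral_mono fun x => ?_
    by_cases hxQ : x ∈ cube c R
    · rw [Set.indicator_of_mem hxQ, ← ofReal_norm, ← ofReal_norm,
        ← ENNReal.ofReal_mul ((norm_nonneg _).trans (hS x))]
      apply ENNReal.ofReal_le_ofReal
      rw [norm_mul, norm_mul, he, norm_phase, one_mul, Complex.norm_real, mul_comm]
      gcongr
      · exact (norm_nonneg _).trans (hS x)
      · exact hS x
      · exact PiLp.norm_apply_le (mollify (ns i) a x - a x) j
    · simp [hψ0 x hxQ]
  have hX : Tendsto (fun i => ∫ x, (mollify (ns i) a x j : ℂ) * (e i x * ψ x)) atTop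
      (𝓝 (∫ x, (a x j : ℂ) * (phase g.φ x * ψ x))) := by
    have := hX1.add hX2
    rw [zero_add] at this
    refine this.congr fun i => ?_
    have hAi : Integrable fun x => (mollify (ns i) a x j : ℂ) * (e i x * ψ x) := by
      refine Continuous.integrable_of_hasCompactSupport ?_ hψ.2.mul_left.mul_left
      have := hAc (ns i)
      have := hec i
      fun_prop
    have hai : Integrable fun x => (a x j : ℂ) * (e i x * ψ x) :=
      ha.integrable_mul_test ((hec i).mul hψc) hψ.2.mul_left j
    rw [← integral_add _ hai]
    · refine integral_congr_ae (Eventually.of_forall fun x => ?_)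
      simp only
      push_cast
      ring
    · refine (hAi.sub hai).congr (Eventually.of_forall fun x => ?_)
      simp only [Pi.sub_apply]
      push_cast
      ring
  have hY : Tendsto (fun i => ∫ x, (g.H (ns i) x j : ℂ) * (e i x * ψ x)) atTop
      (𝓝 (∫ x, (g.h x j : ℂ) * (phase g.φ x * ψ x))) := by
    obtain ⟨N, hN⟩ := eventually_atTop.1 (hns.tendsto_atTop.eventually g.norm_H_le)
    rw [← tendsto_add_atTop_iff_nat N]
    refine tendsto_integral_of_dominated_convergence (fun x => M * ‖ψ x‖) (fun i => ?_)
      ((hψc.integrable_of_hasCompactSupport hψ.2).norm.const_mul M) (fun i => ?_) ?_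
    · have := g.continuous_H (ns (i + N))
      have := hec (i + N)
      exact Continuous.aestronglyMeasurable (by fun_prop)
    · refine Eventually.of_forall fun x => ?_
      by_cases hxQ : x ∈ cube c R
      · rw [norm_mul, norm_mul, he, norm_phase, one_mul, Complex.norm_real]
        gcongr
        exact (PiLp.norm_apply_le _ j).trans (hN (i + N) (by omega) x hxQ)
      · simp [hψ0 x hxQ]
    · filter_upwards [helim, hHlim] with x hx hx2
      by_cases hxQ : x ∈ cube c R
      · have h1 : Tendsto (fun i => (g.H (ns i) x j : ℂ)) atTop (𝓝 (g.h x j : ℂ)) := by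
          have : Continuous fun v : E n => ((v j : ℝ) : ℂ) := by fun_prop
          exact (this.tendsto _).comp ((hx2 hxQ).comp hns.tendsto_atTop)
        exact (tendsto_add_atTop_iff_nat N).2 (h1.mul ((hx hxQ).mul_const _))
      · simp [hψ0 x hxQ]
  -- Integration by parts happens only for smooth phases, with gradient `A - H`. The limit phase is
  -- never differentiated classically.
  have hibp : ∀ i, ∫ x, e i x * partialDeriv j ψ x =
      -(Complex.I * (∫ x, (mollify (ns i) a x j : ℂ) * (e i x * ψ x))) +
        Complex.I * ∫ x, (g.H (ns i) x j : ℂ) * (e i x * ψ x) := by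
    intro i
    have h1 := integral_phase_mul_partialDeriv (g.contDiff_Φ (ns i)) (g.fderiv_Φ (ns i)) hψ j
    have hc1 := hAc (ns i)
    have hc2 := hec i
    have hc3 := g.continuous_H (ns i)
    have hi1 : Integrable fun x => (mollify (ns i) a x j : ℂ) * (e i x * ψ x) :=
      Continuous.integrable_of_hasCompactSupport (by fun_prop) hψ.2.mul_left.mul_left
    have hi2 : Integrable fun x => (g.H (ns i) x j : ℂ) * (e i x * ψ x) :=
      Continuous.integrable_of_hasCompactSupport (by fun_prop) hψ.2.mul_left.mul_left
    calc ∫ x, e i x * partialDeriv j ψ x = _ := h1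
      _ = -(Complex.I * ∫ x, ((mollify (ns i) a x j : ℂ) * (e i x * ψ x) -
            (g.H (ns i) x j : ℂ) * (e i x * ψ x))) := by
          rw [integral_const_mul]
          congr 2
          refine integral_congr_ae (Eventually.of_forall fun x => ?_)
          simp only [PiLp.sub_apply, he]
          push_cast
          ring
      _ = _ := by
          rw [integral_sub hi1 hi2]
          ring
  have hlimeq := tendsto_nhds_unique (hT.congr hibp)
    ((hX.const_mul Complex.I).neg.add (hY.const_mul Complex.I))
  have hI1 : Integrable fun x => phase g.φ x * partialDeriv j ψ x :=
    hdψi.bdd_mul hem (Eventually.of_forall fun x => (norm_phase _ x).le)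
  have hI2 : Integrable fun x => (a x j : ℂ) * phase g.φ x * ψ x := by
    refine (haψi.bdd_mul hem (Eventually.of_forall fun x => (norm_phase _ x).le)).congr
      (Eventually.of_forall fun x => ?_)
    simp only
    ring
  rw [integral_sub (hI1.const_mul _) hI2, integral_const_mul, hlimeq]
  have e1 : ∫ x, -(g.h x j : ℂ) * phase g.φ x * ψ x =
      -∫ x, (g.h x j : ℂ) * (phase g.φ x * ψ x) := by
    rw [← integral_neg]
    exact integral_congr_ae (Eventually.of_forall fun x => by simp only; ring)
  have e2 : ∫ x, (a x j : ℂ) * phase g.φ x * ψ x =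
      ∫ x, (a x j : ℂ) * (phase g.φ x * ψ x) :=
    integral_congr_ae (Eventually.of_forall fun x => by simp only; ring)
  rw [e1, e2]
  field_simp
  ring

end GaugeProperties

end MagneticCZ

namespace MagneticCZ

/-! ### Approximation of `f` on a single cube. -/

section Local

open Filter Topology

variable {n : ℕ}

lemma le_ofReal_div_rpow_mul {T m : ℝ≥0∞} {s k α p : ℝ} (hs : 0 < s)
    (hα : 0 ≤ α) (hp : 0 < p) (h : ENNReal.ofReal s ^ p * T ≤ ENNReal.ofReal (k * α ^ p) * m) :
    T ≤ ENNReal.ofReal (k * (α / s) ^ p) * m := by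
  have hs0 : ENNReal.ofReal s ^ p ≠ 0 := by
    rw [ENNReal.ofReal_rpow_of_pos hs]
    simp only [ne_eq, ENNReal.ofReal_eq_zero, not_le]
    positivity
  have hst : ENNReal.ofReal s ^ p ≠ ⊤ := by simp [hp.le]
  rw [← ENNReal.mul_le_mul_iff_right hs0 hst]
  refine h.trans (le_of_eq ?_)
  rw [← mul_assoc]
  congr 1
  rw [ENNReal.ofReal_rpow_of_pos hs, ← ENNReal.ofReal_mul (by positivity)]
  congr 1
  rw [Real.div_rpow hα hs.le]
  field_simp

lemma le_of_enorm_rpow_le {z : ℂ} {k t p : ℝ} (hk : 0 ≤ k) (ht : 0 ≤ t) (hp : 0 < p)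
    (h : ‖z‖ₑ ^ p ≤ ENNReal.ofReal (k * t ^ p)) : ‖z‖ ≤ k ^ (1 / p) * t := by
  rw [← ofReal_norm, ENNReal.ofReal_rpow_of_nonneg (norm_nonneg _) hp.le,
    ENNReal.ofReal_le_ofReal_iff (by positivity)] at h
  have h2 := Real.rpow_le_rpow (by positivity) h (by positivity : 0 ≤ 1 / p)
  rw [← Real.rpow_mul (norm_nonneg _), mul_one_div_cancel hp.ne', Real.rpow_one,
    Real.mul_rpow hk (by positivity), ← Real.rpow_mul ht, mul_one_div_cancel hp.ne',
    Real.rpow_one] at h2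
  exact h2

lemma norm_setAverage_le {c : E n} {R : ℝ} (hR : 0 < R) {u : E n → ℂ} {S : ℝ}
    (hS : ∀ x, ‖u x‖ ≤ S) : ‖⨍ y in cube c R, u y‖ ≤ S := by
  have hvol : 0 < volume.real (cube c R) :=
    ENNReal.toReal_pos (volume_cube_pos c hR).ne' (volume_cube_ne_top c R)
  rw [setAverage_eq, norm_smul, norm_inv, Real.norm_of_nonneg hvol.le, inv_mul_le_iff₀ hvol]
  have := norm_setIntegral_le_of_norm_le_const (f := u) (volume_cube_ne_top c R).lt_top
    (fun x _ => hS x)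
  linarith

lemma enorm_setAverage_rpow_le {c : E n} {R : ℝ} (hR : 0 < R) {u : E n → ℂ}
    (hu : AEStronglyMeasurable u (volume.restrict (cube c R))) {p : ℝ} (hp : 1 ≤ p) {k : ℝ≥0∞}
    (h : ∫⁻ x in cube c R, ‖u x‖ₑ ^ p ≤ k * volume (cube c R)) :
    ‖⨍ y in cube c R, u y‖ₑ ^ p ≤ k := by
  have hvolpos : volume (cube c R) ≠ 0 := (volume_cube_pos c hR).ne'
  have hvoltop : volume (cube c R) ≠ ⊤ := volume_cube_ne_top c R
  have : IsFiniteMeasure (volume.restrict (cube c R)) := ⟨by simpa using hvoltop.lt_top⟩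
  have hne : volume.restrict (cube c R) ≠ 0 := by simpa using hvolpos
  calc ‖⨍ y in cube c R, u y‖ₑ ^ p ≤ (⨍⁻ y in cube c R, ‖u y‖ₑ ∂volume) ^ p := by
        gcongr
        exact enorm_integral_le_lintegral_enorm _
    _ ≤ ⨍⁻ y in cube c R, ‖u y‖ₑ ^ p ∂volume := rpow_laverage_le hu.enorm hp hne
    _ ≤ k := by
        rw [setLAverage_eq]
        exact ENNReal.div_le_of_le_mul h

/-- The constant of the Fefferman–Phong inequality. -/
noncomputable def phongConst (n : ℕ) (p : ℝ) : ℝ := 2 ^ p * (2 ^ n * (n : ℝ) ^ p + 1)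

lemma phongConst_nonneg (n : ℕ) (p : ℝ) : 0 ≤ phongConst n p := by
  unfold phongConst; positivity

lemma ofReal_phongConst (n : ℕ) (p : ℝ) :
    (2 : ℝ≥0∞) ^ p * (2 ^ n * ENNReal.ofReal ((n : ℝ) ^ p) + 1) =
      ENNReal.ofReal (phongConst n p) := by
  rw [phongConst, ENNReal.ofReal_mul (by positivity), ENNReal.ofReal_add (by positivity)
    zero_le_one, ENNReal.ofReal_mul (by positivity), ENNReal.ofReal_pow (by norm_num),
    ← ENNReal.ofReal_rpow_of_pos (by norm_num : (0 : ℝ) < 2)]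
  simp

set_option maxHeartbeats 1000000 in
/-- On each cube, `f` is approximated by a constant transported in a gauge with bounded field. -/
theorem exists_local_approximation (n : ℕ) {p r A C₀ κ : ℝ} (hp : 1 ≤ p) (hp2 : p < 2)
    (hr : 1 < r) (hκ : 0 ≤ κ) :
    ∃ K : ℝ, 0 < K ∧
      ∀ (a : E n → E n) (B : E n → Matrix (Fin n) (Fin n) ℝ) (V : E n → ℝ),
        IsL2Loc a → IsCurl a B → IsMuckenhoupt r A V → FieldControlled C₀ B V →
        ∀ f : E n → ℂ, IsTest f → ∀ α : ℝ, 0 < α → ∀ (c : E n) (R : ℝ), 0 < R →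
          ∫⁻ x in cube c (2 * R), energyDensity a V p f x ≤
            ENNReal.ofReal (κ * α ^ p) * volume (cube c R) →
          ∃ (M : ℝ) (g : GaugeData (fun m => mollify m a) (cube c R) M) (z : ℂ),
            0 ≤ M ∧ ‖z‖ * M ≤ K * α ∧ (∀ S : ℝ, (∀ x, ‖f x‖ ≤ S) → ‖z‖ ≤ S) ∧
            ∫⁻ x in cube c R, ‖f x - z * phase g.φ x‖ₑ ^ p ≤
              ENNReal.ofReal (K * (α * R) ^ p) * volume (cube c R) ∧
            ENNReal.ofReal (‖z‖ ^ 2) * ∫⁻ x in cube c R, ENNReal.ofReal (V x) ≤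
              ENNReal.ofReal (K * α ^ 2) * volume (cube c R) := by
  have hp0 : 0 < p := by linarith
  set ε := levelRatio r A with hε
  have hε0 : 0 < ε := levelRatio_pos r A
  have hε1 : ε ≤ 1 := levelRatio_le_one hr A
  set σ := Real.sqrt ε with hσ
  have hσ0 : 0 < σ := Real.sqrt_pos.2 hε0
  have hσ1 : σ ≤ 1 := Real.sqrt_le_one.2 hε1
  -- `k₁` comes from the Fefferman–Phong inequality, `k₂` bounds `‖z‖ * s / α`, and `k₃` bounds the
  -- term `M ^ p * ∫ |f| ^ p`. `K₁` serves `‖z‖ * M`, `K₂` and `K₃` the L^p distance for dominant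
  -- and for small potential, `K₄` the potential energy of the constant.
  set k₁ := phongConst n p * κ with hk₁
  have hk₁0 : 0 ≤ k₁ := mul_nonneg (phongConst_nonneg n p) hκ
  set k₂ := k₁ ^ (1 / p) / σ with hk₂
  have hk₂0 : 0 ≤ k₂ := by positivity
  set k₃ := k₁ * (n * |C₀| / (4 * σ)) ^ p with hk₃
  have hk₃0 : 0 ≤ k₃ := by positivity
  set K₁ := n * |C₀| / 4 * k₂ with hK₁
  set K₂ := k₁ * (2 / σ) ^ p with hK₂
  set K₃ := 2 ^ n * (n : ℝ) ^ p * (2 ^ (p - 1) * (2 ^ (p - 1) * (κ + k₃))) with hK₃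
  set K₄ := k₂ ^ 2 * 2 ^ n with hK₄
  have hK₁0 : 0 ≤ K₁ := by positivity
  have hK₂0 : 0 ≤ K₂ := by positivity
  have hK₃0 : 0 ≤ K₃ := by positivity
  have hK₄0 : 0 ≤ K₄ := by positivity
  refine ⟨1 + K₁ + K₂ + K₃ + K₄, by positivity, ?_⟩
  intro a B V ha hB hV hF f hf α hα c R hR hw
  set K := 1 + K₁ + K₂ + K₃ + K₄ with hK
  have hf1 : ContDiff ℝ 1 f := hf.1.of_le (by simp)
  have hfc : Continuous f := hf1.continuous
  set v := ⨍ y in cube c (2 * R), V y with hv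
  have hv0 : 0 < v := hV.setAverage_pos c (by positivity)
  set s := Real.sqrt v with hs
  have hs0 : 0 < s := Real.sqrt_pos.2 hv0
  have hss : s * s = v := Real.mul_self_sqrt hv0.le
  have hM0 : 0 ≤ |C₀| * v := by positivity
  have hBv : ∀ᵐ x ∂(volume.restrict (cube c (2 * R))), absField B x ≤ |C₀| * v := by
    filter_upwards [hF c (2 * R) (by positivity)] with x hx
    exact hx.trans (by gcongr; exact le_abs_self _)
  obtain ⟨g⟩ := hB.exists_gaugeData ha hR hM0 hBv
  set M := (n : ℝ) * (R / 2 * (|C₀| * v)) with hM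
  have hM0' : 0 ≤ M := by positivity
  have hsub : cube c R ⊆ cube c (2 * R) := cube_subset_cube c (by linarith)
  have hwQ : ∫⁻ x in cube c R, energyDensity a V p f x ≤
      ENNReal.ofReal (κ * α ^ p) * volume (cube c R) := (lintegral_mono_set hsub).trans hw
  -- The inequality is used on the doubled cube because `v` is the mean there, and `v` controls the
  -- curl on the set that the mollified gauge sees.
  have hFP : ENNReal.ofReal (min (σ * s) (2 * R)⁻¹) ^ p * ∫⁻ x in cube c R, ‖f x‖ₑ ^ p ≤
      ENNReal.ofReal (k₁ * α ^ p) * volume (cube c R) := by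
    have h1 := hV.fefferman_phong hr a hf1 hp c (R := 2 * R) (by positivity)
    rw [ofReal_phongConst, ← hε, Real.sqrt_mul hε0.le] at h1
    calc _ ≤ ENNReal.ofReal (min (σ * s) (2 * R)⁻¹) ^ p * ∫⁻ x in cube c (2 * R), ‖f x‖ₑ ^ p := by
          gcongr
      _ ≤ ENNReal.ofReal (phongConst n p) * ∫⁻ x in cube c (2 * R), energyDensity a V p f x := h1
      _ ≤ ENNReal.ofReal (phongConst n p) * (ENNReal.ofReal (κ * α ^ p) * volume (cube c R)) := by
          gcongr
      _ = _ := by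
          rw [← mul_assoc, ← ENNReal.ofReal_mul (phongConst_nonneg n p), ← mul_assoc]
  have hαR : 0 ≤ (α * R) ^ p := by positivity
  rcases le_or_gt (s * (2 * R)) 1 with htype | htype
  · -- the potential is small compared with the scale of the cube
    have hmin : min (σ * s) (2 * R)⁻¹ = σ * s := by
      apply min_eq_left
      rw [← one_div, le_div_iff₀ (by positivity)]
      nlinarith [mul_le_mul_of_nonneg_right hσ1 (show 0 ≤ s * (2 * R) by positivity)]
    rw [hmin] at hFP
    have hT := le_ofReal_div_rpow_mul (by positivity) hα.le hp0 hFP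
    -- The mean is taken after the gauge transformation; it is at most an L^p mean of `|f|`, hence
    -- controlled by the Fefferman–Phong bound.
    set z := ⨍ y in cube c R, phase (-g.φ) y * f y with hz
    have hum : AEStronglyMeasurable (fun y => phase (-g.φ) y * f y)
        (volume.restrict (cube c R)) :=
      ((aestronglyMeasurable_phase g.aestronglyMeasurable_φ.neg).mul
        hfc.aestronglyMeasurable).restrict
    have hnu : ∀ y, ‖phase (-g.φ) y * f y‖ = ‖f y‖ := fun y => by simp
    have hneu : ∀ y, ‖phase (-g.φ) y * f y‖ₑ = ‖f y‖ₑ := fun y => by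
      rw [← ofReal_norm, hnu, ofReal_norm]
    have hz1 : ‖z‖ ≤ k₁ ^ (1 / p) * (α / (σ * s)) := by
      refine le_of_enorm_rpow_le hk₁0 (by positivity) hp0 ?_
      refine enorm_setAverage_rpow_le hR hum hp ?_
      simp_rw [hneu]
      exact hT
    have hzs : ‖z‖ * s ≤ k₂ * α := by
      calc ‖z‖ * s ≤ k₁ ^ (1 / p) * (α / (σ * s)) * s := by gcongr
        _ = k₂ * α := by rw [hk₂]; field_simp
    refine ⟨M, g, z, hM0', ?_, ?_, ?_, ?_⟩
    -- The field bound is of order `R * v = R * s * s`. One factor `s` is absorbed by `z`, the other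
    -- by the smallness of `s * (2 * R)`.
    · calc ‖z‖ * M = n * |C₀| / 4 * (‖z‖ * s) * (s * (2 * R)) := by
            rw [hM, ← hss]; ring
        _ ≤ n * |C₀| / 4 * (k₂ * α) * 1 := by gcongr
        _ = K₁ * α := by rw [hK₁]; ring
        _ ≤ K * α := by gcongr; rw [hK]; linarith
    · intro S hS
      exact norm_setAverage_le hR fun x => by rw [hnu]; exact hS x
    · have hG := g.lintegral_sub_phase_rpow_le ha hR hM0' hf1 hf.2 hp hp2.le
      -- The same distribution of the two factors `s` controls the error term of the gauged Poincaré
      -- inequality.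
      have hMT : ENNReal.ofReal M ^ p * ∫⁻ x in cube c R, ‖f x‖ₑ ^ p ≤
          ENNReal.ofReal (k₃ * α ^ p) * volume (cube c R) := by
        calc _ ≤ ENNReal.ofReal M ^ p *
              (ENNReal.ofReal (k₁ * (α / (σ * s)) ^ p) * volume (cube c R)) := by gcongr
          _ = ENNReal.ofReal (M ^ p * (k₁ * (α / (σ * s)) ^ p)) * volume (cube c R) := by
              rw [← mul_assoc, ENNReal.ofReal_rpow_of_nonneg hM0' hp0.le,
                ← ENNReal.ofReal_mul (by positivity)]
          _ ≤ _ := by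
              gcongr ENNReal.ofReal ?_ * _
              have e1 : M * (α / (σ * s)) = n * |C₀| / (4 * σ) * α * (s * (2 * R)) := by
                rw [hM, ← hss]; field_simp; ring
              calc M ^ p * (k₁ * (α / (σ * s)) ^ p) = k₁ * (M * (α / (σ * s))) ^ p := by
                    rw [Real.mul_rpow hM0' (by positivity)]; ring
                _ ≤ k₁ * (n * |C₀| / (4 * σ) * α) ^ p := by
                    rw [e1]
                    gcongr k₁ * ?_ ^ p
                    exact mul_le_of_le_one_right (by positivity) htype
                _ = k₃ * α ^ p := by
                    rw [Real.mul_rpow (by positivity) hα.le, hk₃]; ring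
      have hint : ∫⁻ x in cube c R, (‖magGrad a f x‖ₑ + ENNReal.ofReal M * ‖f x‖ₑ) ^ p ≤
          2 ^ (p - 1) * (ENNReal.ofReal (κ * α ^ p) * volume (cube c R) +
            ENNReal.ofReal (k₃ * α ^ p) * volume (cube c R)) := by
        calc _ ≤ ∫⁻ x in cube c R, 2 ^ (p - 1) *
              (energyDensity a V p f x + (ENNReal.ofReal M * ‖f x‖ₑ) ^ p) := by
              refine lintegral_mono fun x => ?_
              refine (ENNReal.rpow_add_le_mul_rpow_add_rpow _ _ hp).trans ?_
              gcongr
              exact le_self_add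
          _ = 2 ^ (p - 1) * ((∫⁻ x in cube c R, energyDensity a V p f x) +
                ENNReal.ofReal M ^ p * ∫⁻ x in cube c R, ‖f x‖ₑ ^ p) := by
              have hm : Measurable fun x => (ENNReal.ofReal M * ‖f x‖ₑ) ^ p :=
                ((hfc.enorm.measurable).const_mul _).pow_const _
              rw [lintegral_const_mul' _ _ (by simp), lintegral_add_right _ hm]
              simp_rw [ENNReal.mul_rpow_of_nonneg _ _ hp0.le]
              rw [lintegral_const_mul' _ _ (by simp [hp0.le])]
          _ ≤ _ := by gcongr
      have h2n : (2 : ℝ≥0∞) ^ n = ENNReal.ofReal (2 ^ n) := by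
        rw [ENNReal.ofReal_pow (by norm_num)]; simp
      have h2p : (2 : ℝ≥0∞) ^ (p - 1) = ENNReal.ofReal (2 ^ (p - 1)) := by
        rw [← ENNReal.ofReal_rpow_of_pos (by norm_num)]; simp
      refine hG.trans ?_
      calc _ ≤ 2 ^ n * ENNReal.ofReal ((n * R) ^ p) * (2 ^ (p - 1) *
            (2 ^ (p - 1) * (ENNReal.ofReal (κ * α ^ p) * volume (cube c R) +
              ENNReal.ofReal (k₃ * α ^ p) * volume (cube c R)))) := by gcongr
        _ = ENNReal.ofReal (K₃ * (α * R) ^ p) * volume (cube c R) := by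
            rw [← add_mul, h2n, h2p, ← ENNReal.ofReal_add (by positivity) (by positivity)]
            simp only [← mul_assoc]
            rw [← ENNReal.ofReal_mul (by positivity), ← ENNReal.ofReal_mul (by positivity),
              ← ENNReal.ofReal_mul (by positivity), ← ENNReal.ofReal_mul (by positivity)]
            congr 2
            rw [hK₃, Real.mul_rpow (by positivity) hR.le, Real.mul_rpow hα.le hR.le]
            ring
        _ ≤ _ := by
            gcongr
            rw [hK]; linarith
    · have hVQ : ∫⁻ x in cube c R, ENNReal.ofReal (V x) ≤
          ENNReal.ofReal (v * 2 ^ n) * volume (cube c R) := by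
        calc _ ≤ ∫⁻ x in cube c (2 * R), ENNReal.ofReal (V x) := lintegral_mono_set hsub
          _ = ENNReal.ofReal v * volume (cube c (2 * R)) := by
              rw [hV.lintegral_cube, ofReal_setAverage_mul_volume (by positivity)]
          _ = _ := by
              rw [volume_cube_mul c hR.le (by norm_num), ← mul_assoc,
                ← ENNReal.ofReal_mul hv0.le]
      calc _ ≤ ENNReal.ofReal (‖z‖ ^ 2) *
            (ENNReal.ofReal (v * 2 ^ n) * volume (cube c R)) := by gcongr
        _ = ENNReal.ofReal (‖z‖ ^ 2 * (v * 2 ^ n)) * volume (cube c R) := by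
            rw [← mul_assoc, ← ENNReal.ofReal_mul (by positivity)]
        _ ≤ _ := by
            gcongr ENNReal.ofReal ?_ * _
            calc ‖z‖ ^ 2 * (v * 2 ^ n) = (‖z‖ * s) ^ 2 * 2 ^ n := by rw [← hss]; ring
              _ ≤ (k₂ * α) ^ 2 * 2 ^ n := by gcongr
              _ = K₄ * α ^ 2 := by rw [hK₄]; ring
              _ ≤ K * α ^ 2 := by gcongr; rw [hK]; linarith
  · -- the potential dominates
    refine ⟨M, g, 0, hM0', ?_, ?_, ?_, ?_⟩
    · rw [norm_zero, zero_mul]; positivity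
    · intro S hS
      rw [norm_zero]
      exact (norm_nonneg _).trans (hS 0)
    -- When `s * (2 * R) > 1` the Fefferman–Phong weight is of order `R⁻¹`, so `f` itself is small
    -- enough and nothing need be subtracted.
    · have hmin : σ / (2 * R) ≤ min (σ * s) (2 * R)⁻¹ := by
        apply le_min
        · rw [div_le_iff₀ (by positivity), mul_assoc]
          nlinarith
        · rw [div_eq_mul_inv]
          exact mul_le_of_le_one_left (by positivity) hσ1
      have h1 : ENNReal.ofReal (σ / (2 * R)) ^ p * ∫⁻ x in cube c R, ‖f x‖ₑ ^ p ≤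
          ENNReal.ofReal (k₁ * α ^ p) * volume (cube c R) := by
        refine le_trans ?_ hFP
        gcongr
      have h2 := le_ofReal_div_rpow_mul (by positivity) hα.le hp0 h1
      simp only [zero_mul, sub_zero]
      refine h2.trans ?_
      gcongr ENNReal.ofReal ?_ * _
      calc k₁ * (α / (σ / (2 * R))) ^ p = K₂ * (α * R) ^ p := by
            rw [hK₂, mul_assoc k₁, ← Real.mul_rpow (by positivity) (by positivity)]
            congr 2
            field_simp
        _ ≤ K * (α * R) ^ p := by gcongr; rw [hK]; linarith
    · simp

/-- Two transported constants which are both close to `f` are close to each other. -/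
lemma norm_phase_sub_phase_le_of_ball {A : ℕ → E n → E n} {c₁ c₂ x₀ : E n}
    {R₁ R₂ ρ Λ K α p M₁ M₂ : ℝ} (hn : 0 < n) (hp : 1 ≤ p) (hρ : 0 < ρ) (hR₁ : 0 < R₁)
    (hR₂ : 0 < R₂) (hΛ₁ : R₁ ≤ Λ * ρ) (hΛ₂ : R₂ ≤ Λ * ρ) (hK : 0 < K) (hα : 0 < α)
    (hM₁ : 0 ≤ M₁) (hM₂ : 0 ≤ M₂)
    (hball : Metric.closedBall x₀ ρ ⊆ cube c₁ R₁ ∩ cube c₂ R₂)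
    (g₁ : GaugeData A (cube c₁ R₁) M₁) (g₂ : GaugeData A (cube c₂ R₂) M₂) {z₁ z₂ : ℂ}
    (hz₁ : ‖z₁‖ * M₁ ≤ K * α) (hz₂ : ‖z₂‖ * M₂ ≤ K * α) {f : E n → ℂ} (hf : Continuous f)
    (h₁ : ∫⁻ x in cube c₁ R₁, ‖f x - z₁ * phase g₁.φ x‖ₑ ^ p ≤
      ENNReal.ofReal (K * (α * R₁) ^ p) * volume (cube c₁ R₁))
    (h₂ : ∫⁻ x in cube c₂ R₂, ‖f x - z₂ * phase g₂.φ x‖ₑ ^ p ≤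
      ENNReal.ofReal (K * (α * R₂) ^ p) * volume (cube c₂ R₂)) :
    ∀ᵐ x ∂(volume.restrict (cube c₁ R₁ ∩ cube c₂ R₂)),
      ‖z₁ * phase g₁.φ x - z₂ * phase g₂.φ x‖ ≤
        (2 * K * n * Λ + (2 ^ p * K * Λ ^ p * (n * Λ / 2) ^ n) ^ (1 / p)) * (α * ρ) := by
  have hp0 : 0 < p := by linarith
  have hn' : (0 : ℝ) < n := by exact_mod_cast hn
  have hΛ : 0 < Λ := pos_of_mul_pos_left (hR₁.trans_le hΛ₁) hρ.le
  obtain ⟨S, hS, hLip⟩ := g₁.abs_norm_sub_sub_le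
    ((convex_cube c₁ R₁).inter (convex_cube c₂ R₂))
    ((measurableSet_cube c₁ R₁).inter (measurableSet_cube c₂ R₂)) g₂ z₁ z₂
  set u : E n → ℂ := fun x => z₁ * phase g₁.φ x - z₂ * phase g₂.φ x with hu
  -- Only the products `‖z₁‖ * M₁` and `‖z₂‖ * M₂` are known to be small. The minimum avoids the
  -- mixed products.
  have hmin : min ‖z₁‖ ‖z₂‖ * (M₁ + M₂) ≤ 2 * K * α := by
    have e1 : min ‖z₁‖ ‖z₂‖ * M₁ ≤ ‖z₁‖ * M₁ := by gcongr; exact min_le_left _ _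
    have e2 : min ‖z₁‖ ‖z₂‖ * M₂ ≤ ‖z₂‖ * M₂ := by gcongr; exact min_le_right _ _
    linarith [mul_add (min ‖z₁‖ ‖z₂‖) M₁ M₂]
  set b := Metric.closedBall x₀ ρ with hb
  have hbm : MeasurableSet b := measurableSet_closedBall
  have hSb : ∀ᵐ y ∂(volume.restrict b), y ∈ S := ae_restrict_of_ae_restrict_of_subset hball hS
  -- A cube of side `2 * ρ / n` fits into the ball.
  have hvolb : ENNReal.ofReal ((2 * ρ / n) ^ n) ≤ volume b := by
    rw [← volume_cube x₀ (by positivity)]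
    apply measure_mono
    refine (cube_subset_closedBall x₀ (by positivity)).trans (Metric.closedBall_subset_closedBall ?_)
    apply le_of_eq
    field_simp
  have hI : ∀ (c : E n) (R M : ℝ) (g : GaugeData A (cube c R) M) (z : ℂ), 0 < R → R ≤ Λ * ρ →
      b ⊆ cube c R → ∫⁻ x in cube c R, ‖f x - z * phase g.φ x‖ₑ ^ p ≤
        ENNReal.ofReal (K * (α * R) ^ p) * volume (cube c R) →
      ∫⁻ x in b, ‖f x - z * phase g.φ x‖ₑ ^ p ≤
        ENNReal.ofReal (K * (α * (Λ * ρ)) ^ p * (Λ * ρ) ^ n) := by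
    intro c R M g z hR hRΛ hbs h
    refine (lintegral_mono_set hbs).trans (h.trans ?_)
    rw [volume_cube c hR.le, ← ENNReal.ofReal_mul (by positivity)]
    gcongr
  filter_upwards [hS, ae_restrict_mem
    ((measurableSet_cube c₁ R₁).inter (measurableSet_cube c₂ R₂))] with x hxS hxQ
  -- `D` is what remains of `‖u x‖` after subtracting the greatest possible oscillation, so `D ≤ ‖u
  -- y‖` for almost every `y` in the ball. Integrating over the ball turns the L^p bounds into a
  -- bound for `D`.
  set D : ℝ := ‖u x‖ - 2 * K * n * Λ * (α * ρ) with hD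
  have hDy : ∀ᵐ y ∂(volume.restrict b), ENNReal.ofReal D ^ p ≤ 2 ^ (p - 1) *
      (‖f y - z₁ * phase g₁.φ y‖ₑ ^ p + ‖f y - z₂ * phase g₂.φ y‖ₑ ^ p) := by
    filter_upwards [hSb, ae_restrict_mem hbm] with y hyS hyb
    refine le_trans ?_ (ENNReal.rpow_add_le_mul_rpow_add_rpow _ _ hp)
    gcongr
    rw [← ofReal_norm, ← ofReal_norm, ← ENNReal.ofReal_add (norm_nonneg _) (norm_nonneg _)]
    apply ENNReal.ofReal_le_ofReal
    have hl := hLip x hxS y hyS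
    have hxy : ‖x - y‖ ≤ n * (Λ * ρ) :=
      (dist_le_of_mem_cube hR₁.le hxQ.1 (hball hyb).1).trans (by gcongr)
    have h3 : min ‖z₁‖ ‖z₂‖ * ((M₁ + M₂) * ‖x - y‖) ≤ 2 * K * n * Λ * (α * ρ) := by
      calc _ = (min ‖z₁‖ ‖z₂‖ * (M₁ + M₂)) * ‖x - y‖ := by ring
        _ ≤ (2 * K * α) * (n * (Λ * ρ)) := by gcongr
        _ = _ := by ring
    have h4 : ‖u y‖ ≤ ‖f y - z₁ * phase g₁.φ y‖ + ‖f y - z₂ * phase g₂.φ y‖ := by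
      have : u y = (f y - z₂ * phase g₂.φ y) - (f y - z₁ * phase g₁.φ y) := by
        simp only [hu]; ring
      rw [this, add_comm]
      exact norm_sub_le _ _
    have h5 := (abs_le.1 hl).2
    simp only [hD]
    simp only [hu] at h4 h5 ⊢
    linarith
  have hint : ENNReal.ofReal D ^ p * volume b ≤
      ENNReal.ofReal (2 ^ p * K * (α * (Λ * ρ)) ^ p * (Λ * ρ) ^ n) := by
    have hm1 : AEMeasurable (fun y => ‖f y - z₁ * phase g₁.φ y‖ₑ ^ p) (volume.restrict b) :=
      ((hf.aestronglyMeasurable.sub ((aestronglyMeasurable_phase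
        g₁.aestronglyMeasurable_φ.restrict).const_mul z₁)).enorm).pow_const _
    calc ENNReal.ofReal D ^ p * volume b = ∫⁻ _y in b, ENNReal.ofReal D ^ p := by simp
      _ ≤ ∫⁻ y in b, 2 ^ (p - 1) *
          (‖f y - z₁ * phase g₁.φ y‖ₑ ^ p + ‖f y - z₂ * phase g₂.φ y‖ₑ ^ p) :=
          lintegral_mono_ae hDy
      _ = 2 ^ (p - 1) * ((∫⁻ y in b, ‖f y - z₁ * phase g₁.φ y‖ₑ ^ p) +
            ∫⁻ y in b, ‖f y - z₂ * phase g₂.φ y‖ₑ ^ p) := by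
          rw [lintegral_const_mul' _ _ (by simp), lintegral_add_left' hm1]
      _ ≤ 2 ^ (p - 1) * (ENNReal.ofReal (K * (α * (Λ * ρ)) ^ p * (Λ * ρ) ^ n) +
            ENNReal.ofReal (K * (α * (Λ * ρ)) ^ p * (Λ * ρ) ^ n)) := by
          gcongr
          · exact hI c₁ R₁ M₁ g₁ z₁ hR₁ hΛ₁ (hball.trans Set.inter_subset_left) h₁
          · exact hI c₂ R₂ M₂ g₂ z₂ hR₂ hΛ₂ (hball.trans Set.inter_subset_right) h₂
      _ = _ := by
          have h2p : (2 : ℝ≥0∞) ^ (p - 1) = ENNReal.ofReal (2 ^ (p - 1)) := by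
            rw [← ENNReal.ofReal_rpow_of_pos (by norm_num)]; simp
          rw [h2p, ← ENNReal.ofReal_add (by positivity) (by positivity),
            ← ENNReal.ofReal_mul (by positivity)]
          congr 1
          have : (2 : ℝ) ^ p = 2 ^ (p - 1) * 2 := by
            rw [← Real.rpow_add_one (by norm_num)]; congr 1; ring
          rw [this]
          ring
  rcases le_or_gt D 0 with hD0 | hD0
  · have : 0 ≤ (2 ^ p * K * Λ ^ p * (n * Λ / 2) ^ n) ^ (1 / p) * (α * ρ) := by positivity
    simp only [hD] at hD0
    rw [add_mul]
    linarith
  · have h6 : D ^ p * (2 * ρ / n) ^ n ≤ 2 ^ p * K * (α * (Λ * ρ)) ^ p * (Λ * ρ) ^ n := by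
      have h7 : ENNReal.ofReal D ^ p * ENNReal.ofReal ((2 * ρ / n) ^ n) ≤
          ENNReal.ofReal (2 ^ p * K * (α * (Λ * ρ)) ^ p * (Λ * ρ) ^ n) :=
        le_trans (by gcongr) hint
      rw [ENNReal.ofReal_rpow_of_pos hD0, ← ENNReal.ofReal_mul (by positivity),
        ENNReal.ofReal_le_ofReal_iff (by positivity)] at h7
      exact h7
    have h8 : D ^ p ≤ (2 ^ p * K * Λ ^ p * (n * Λ / 2) ^ n) * (α * ρ) ^ p := by
      rw [← le_div_iff₀ (by positivity)] at h6
      refine h6.trans (le_of_eq ?_)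
      rw [show α * (Λ * ρ) = Λ * (α * ρ) by ring, Real.mul_rpow hΛ.le (by positivity)]
      rw [div_pow, div_pow, mul_pow, mul_pow, mul_pow]
      field_simp
    have h9 : D ≤ (2 ^ p * K * Λ ^ p * (n * Λ / 2) ^ n) ^ (1 / p) * (α * ρ) := by
      have := Real.rpow_le_rpow (by positivity) h8 (by positivity : 0 ≤ 1 / p)
      rwa [← Real.rpow_mul hD0.le, mul_one_div_cancel hp0.ne', Real.rpow_one,
        Real.mul_rpow (by positivity) (by positivity), ← Real.rpow_mul (by positivity),
        mul_one_div_cancel hp0.ne', Real.rpow_one] at this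
    simp only [hD] at h9
    rw [add_mul]
    linarith

end Local

end MagneticCZ

namespace MagneticCZ

open Metric Filter Topology Set

/-! ### The maximal function of the energy density. -/

section Covering

variable {n : ℕ}

lemma volume_closedBall_eq (x : E n) {t : ℝ} (ht : 0 ≤ t) :
    volume (closedBall x t) = ENNReal.ofReal (t ^ n) * volume (ball (0 : E n) 1) := by
  rw [Measure.addHaar_closedBall _ _ ht]; simp

lemma volume_ball_eq [Nonempty (Fin n)] (x : E n) (t : ℝ) :
    volume (ball x t) = volume (closedBall x t) :=
  (Measure.addHaar_closedBall_eq_addHaar_ball _ _ _).symm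

lemma countable_of_pairwiseDisjoint_closedBall {ι : Type*} {u : Set ι} {x : ι → E n} {r : ι → ℝ}
    (hu : u.PairwiseDisjoint fun a => closedBall (x a) (r a)) (hr : ∀ a ∈ u, 0 < r a) :
    u.Countable := by
  refine hu.countable_of_nonempty_interior fun a ha => ?_
  exact ⟨x a, ball_subset_interior_closedBall (mem_ball_self (hr a ha))⟩

/-- A radius whose ball has bounded volume is bounded. -/
lemma exists_radius_bound (hn : 0 < n) {m : ℝ≥0∞} (hm : m ≠ ⊤) :
    ∃ T : ℝ, ∀ (x : E n) (t : ℝ), 0 ≤ t → volume (closedBall x t) ≤ m → t ≤ T := by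
  have hv0 : volume (ball (0 : E n) 1) ≠ 0 := (measure_ball_pos _ _ one_pos).ne'
  have hvt : volume (ball (0 : E n) 1) ≠ ⊤ := measure_ball_lt_top.ne
  refine ⟨1 + (m / volume (ball (0 : E n) 1)).toReal, fun x t ht h => ?_⟩
  rw [volume_closedBall_eq x ht, ← ENNReal.le_div_iff_mul_le (Or.inl hv0) (Or.inl hvt)] at h
  have h2 : t ^ n ≤ (m / volume (ball (0 : E n) 1)).toReal := by
    rw [← ENNReal.ofReal_le_iff_le_toReal (ENNReal.div_ne_top hm hv0)]
    exact h
  rcases le_or_gt t 1 with h1 | h1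
  · have : 0 ≤ (m / volume (ball (0 : E n) 1)).toReal := ENNReal.toReal_nonneg
    linarith
  · have := le_self_pow₀ h1.le hn.ne'
    linarith

/-- The set where the maximal function of `w` exceeds `t`. -/
def maximalSet (w : E n → ℝ≥0∞) (t : ℝ) : Set (E n) :=
  ⋃ q ∈ {q : E n × ℝ | 0 < q.2 ∧
    ENNReal.ofReal t * volume (ball q.1 q.2) < ∫⁻ x in ball q.1 q.2, w x}, ball q.1 q.2

lemma isOpen_maximalSet (w : E n → ℝ≥0∞) (t : ℝ) : IsOpen (maximalSet w t) :=
  isOpen_biUnion fun _ _ => isOpen_ball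

/-- The maximal function is uncentred, so one point of the ball outside the set suffices. This fits
Whitney balls, whose centres lie inside. -/
lemma lintegral_ball_le_of_not_subset {w : E n → ℝ≥0∞} {t ρ : ℝ} {y : E n} (hρ : 0 < ρ)
    (h : ¬ ball y ρ ⊆ maximalSet w t) :
    ∫⁻ x in ball y ρ, w x ≤ ENNReal.ofReal t * volume (ball y ρ) := by
  by_contra hlt
  exact h fun x hx => mem_iUnion₂.2 ⟨(y, ρ), ⟨hρ, not_le.1 hlt⟩, hx⟩

/-- Lebesgue differentiation: outside the set all centred means are at most `t`. -/
lemma ae_le_of_notMem_maximalSet (hn : 0 < n) {w : E n → ℝ≥0∞} (hw : AEMeasurable w)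
    (hfin : ∫⁻ x, w x ≠ ⊤) (t : ℝ) :
    ∀ᵐ x, x ∉ maximalSet w t → w x ≤ ENNReal.ofReal t := by
  have : Nonempty (Fin n) := ⟨⟨0, hn⟩⟩
  filter_upwards [(Besicovitch.vitaliFamily (volume : Measure (E n))).ae_tendsto_lintegral_div
    hw hfin] with x hx hxF
  refine le_of_tendsto (hx.comp (Besicovitch.tendsto_filterAt volume x)) ?_
  filter_upwards [self_mem_nhdsWithin] with ρ hρ
  have hρ : 0 < ρ := hρ
  simp only [Function.comp]
  apply ENNReal.div_le_of_le_mul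
  have h := lintegral_ball_le_of_not_subset (w := w) (t := t) hρ
    fun hsub => hxF (hsub (mem_ball_self hρ))
  rw [← volume_ball_eq]
  refine le_trans (le_of_eq ?_) h
  refine setLIntegral_congr ?_
  exact (ae_eq_of_subset_of_measure_ge ball_subset_closedBall (volume_ball_eq x ρ).ge
    measurableSet_ball.nullMeasurableSet measure_closedBall_lt_top.ne).symm

/-- The weak type estimate for the maximal function. -/
lemma volume_maximalSet_le (hn : 0 < n) {w : E n → ℝ≥0∞} (hfin : ∫⁻ x, w x ≠ ⊤) {t : ℝ}
    (ht : 0 < t) :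
    volume (maximalSet w t) ≤ ENNReal.ofReal (5 ^ n * t⁻¹) * ∫⁻ x, w x := by
  have : Nonempty (Fin n) := ⟨⟨0, hn⟩⟩
  have ht0 : ENNReal.ofReal t ≠ 0 := by simpa using ht
  have hinv : ENNReal.ofReal t⁻¹ = (ENNReal.ofReal t)⁻¹ := ENNReal.ofReal_inv_of_pos ht
  have hball : ∀ q : E n × ℝ, 0 < q.2 ∧
      ENNReal.ofReal t * volume (ball q.1 q.2) < ∫⁻ x in ball q.1 q.2, w x →
      volume (closedBall q.1 q.2) ≤ ENNReal.ofReal t⁻¹ * ∫⁻ x in ball q.1 q.2, w x := by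
    rintro q ⟨-, hq⟩
    rw [← volume_ball_eq, hinv, mul_comm, ← div_eq_mul_inv,
      ENNReal.le_div_iff_mul_le (Or.inl ht0) (Or.inl ENNReal.ofReal_ne_top), mul_comm]
    exact hq.le
  -- Vitali's lemma needs bounded radii; finiteness of the total integral bounds the volume of every
  -- selected ball.
  obtain ⟨T, hT⟩ := exists_radius_bound hn
    (ENNReal.mul_ne_top (ENNReal.ofReal_ne_top (r := t⁻¹)) hfin)
  obtain ⟨u, hut, hdisj, hcov⟩ := Vitali.exists_disjoint_subfamily_covering_enlargement_closedBall
    {q : E n × ℝ | 0 < q.2 ∧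
      ENNReal.ofReal t * volume (ball q.1 q.2) < ∫⁻ x in ball q.1 q.2, w x}
    Prod.fst Prod.snd T
    (fun q hq => hT q.1 q.2 hq.1.le ((hball q hq).trans (by
      gcongr; exact Measure.restrict_le_self))) 5 (by norm_num)
  have hc : u.Countable := countable_of_pairwiseDisjoint_closedBall hdisj fun q hq => (hut hq).1
  have hsub : maximalSet w t ⊆ ⋃ q ∈ u, closedBall q.1 (5 * q.2) := by
    intro x hx
    obtain ⟨q, hq, hxq⟩ := mem_iUnion₂.1 hx
    obtain ⟨q', hq', hqq⟩ := hcov q hq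
    exact mem_biUnion hq' (hqq (ball_subset_closedBall hxq))
  have hcc : Countable u := hc.to_subtype
  calc volume (maximalSet w t) ≤ volume (⋃ q ∈ u, closedBall q.1 (5 * q.2)) := measure_mono hsub
    _ ≤ ∑' q : u, volume (closedBall q.1.1 (5 * q.1.2)) := measure_biUnion_le _ hc _
    _ ≤ ∑' q : u, ENNReal.ofReal (5 ^ n * t⁻¹) * ∫⁻ x in ball q.1.1 q.1.2, w x := by
        refine ENNReal.tsum_le_tsum fun q => ?_
        have hq0 := (hut q.2).1
        calc volume (closedBall q.1.1 (5 * q.1.2))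
            = ENNReal.ofReal (5 ^ n) * volume (closedBall q.1.1 q.1.2) := by
              rw [volume_closedBall_eq _ (by positivity), volume_closedBall_eq _ hq0.le, mul_pow,
                ENNReal.ofReal_mul (by positivity), mul_assoc]
          _ ≤ ENNReal.ofReal (5 ^ n) *
              (ENNReal.ofReal t⁻¹ * ∫⁻ x in ball q.1.1 q.1.2, w x) := by
              gcongr; exact hball q.1 (hut q.2)
          _ = _ := by rw [← mul_assoc, ← ENNReal.ofReal_mul (by positivity)]
    _ = ENNReal.ofReal (5 ^ n * t⁻¹) * ∫⁻ x in ⋃ q : u, ball q.1.1 q.1.2, w x := by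
        rw [ENNReal.tsum_mul_left, lintegral_iUnion (fun _ => measurableSet_ball)]
        intro q q' hqq
        exact (hdisj q.2 q'.2 (fun h => hqq (Subtype.ext h))).mono ball_subset_closedBall
          ball_subset_closedBall
    _ ≤ _ := by gcongr; exact Measure.restrict_le_self

end Covering

end MagneticCZ

namespace MagneticCZ

open Metric Filter Topology Set

/-! ### Whitney coverings with a smooth partition of unity. -/

section Whitney

variable {n : ℕ}

/-- A Whitney covering of `Ω` by cubes of sidelength `40 s k`, with a subordinate smooth partition
of unity. -/
structure WhitneyPartition (Ω : Set (E n)) (N : ℕ) (κ C : ℝ) where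
  ι : Type
  countable : Countable ι
  c : ι → E n
  s : ι → ℝ
  χ : ι → E n → ℝ
  s_pos : ∀ k, 0 < s k
  cube_subset : ∀ k, cube (c k) (40 * s k) ⊆ Ω
  encard_le : ∀ x, {k | x ∈ cube (c k) (40 * s k)}.encard ≤ N
  tsum_volume_le : ∑' k, volume (cube (c k) (40 * s k)) ≤ ENNReal.ofReal κ * volume Ω
  exists_ball : ∀ k, ∃ ρ, 0 < ρ ∧ cube (c k) (2 * (40 * s k)) ⊆ ball (c k) ρ ∧
    volume (ball (c k) ρ) ≤ ENNReal.ofReal κ * volume (cube (c k) (40 * s k)) ∧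
    ¬ ball (c k) ρ ⊆ Ω
  s_le : ∀ x k l, x ∈ cube (c k) (40 * s k) → x ∈ cube (c l) (40 * s l) → s k ≤ 2 * s l
  contDiff_χ : ∀ k, ContDiff ℝ ∞ (χ k)
  support_χ : ∀ k, Function.support (χ k) ⊆ closedBall (c k) (10 * s k)
  χ_nonneg : ∀ k x, 0 ≤ χ k x
  χ_le_one : ∀ k x, χ k x ≤ 1
  finsum_χ : ∀ x ∈ Ω, ∑ᶠ k, χ k x = 1
  finsum_fderiv : ∀ x ∈ Ω, ∑ᶠ k, fderiv ℝ (χ k) x = 0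
  norm_fderiv_le : ∀ k x, ‖fderiv ℝ (χ k) x‖ ≤ C / s k

/-- The radius of the Whitney ball at `x`. -/
noncomputable def whitneyRadius (Ω : Set (E n)) (x : E n) : ℝ := infDist x Ωᶜ / (100 * n)

lemma infDist_eq_whitneyRadius (hn : 0 < n) (Ω : Set (E n)) (x : E n) :
    infDist x Ωᶜ = 100 * n * whitneyRadius Ω x := by
  have : (0 : ℝ) < n := by exact_mod_cast hn
  rw [whitneyRadius]; field_simp

lemma whitneyRadius_pos (hn : 0 < n) {Ω : Set (E n)} (hΩ : IsOpen Ω) (hne : (Ωᶜ).Nonempty)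
    {x : E n} (hx : x ∈ Ω) : 0 < whitneyRadius Ω x := by
  have : (0 : ℝ) < n := by exact_mod_cast hn
  have := (hΩ.isClosed_compl.notMem_iff_infDist_pos hne).1 (by simpa using hx)
  rw [whitneyRadius]; positivity

lemma closedBall_subset_of_lt_infDist {Ω : Set (E n)} {x : E n} {r : ℝ}
    (h : r < infDist x Ωᶜ) : closedBall x r ⊆ Ω := by
  have := disjoint_closedBall_of_lt_infDist h
  rwa [disjoint_compl_right_iff_subset] at this

/-- The Whitney radius varies slowly. -/
lemma whitneyRadius_le_add (hn : 0 < n) (Ω : Set (E n)) {x y : E n} {t : ℝ}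
    (h : dist x y ≤ n * t) : whitneyRadius Ω x ≤ whitneyRadius Ω y + t / 100 := by
  have hn' : (0 : ℝ) < n := by exact_mod_cast hn
  have h1 := infDist_le_infDist_add_dist (s := Ωᶜ) (x := x) (y := y)
  rw [infDist_eq_whitneyRadius hn, infDist_eq_whitneyRadius hn] at h1
  have h2 : (n : ℝ) * (100 * whitneyRadius Ω x) ≤ n * (100 * whitneyRadius Ω y + t) := by
    linarith
  have := le_of_mul_le_mul_left h2 hn'
  linarith

lemma dist_le_of_mem_cube_center {x c : E n} {s : ℝ} (hs : 0 ≤ s)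
    (hx : x ∈ cube c (40 * s)) : dist x c ≤ n * (20 * s) := by
  have := cube_subset_closedBall c (by positivity) hx
  rw [mem_closedBall] at this
  refine this.trans (le_of_eq (by ring))

/-- Across the cube the distance to the centre is at most `20 n s`, which changes the Whitney radius
by at most `s / 5`. -/
lemma whitneyRadius_comparable (hn : 0 < n) {Ω : Set (E n)} {x c : E n}
    (hs : 0 ≤ whitneyRadius Ω c)
    (hx : x ∈ cube c (40 * whitneyRadius Ω c)) :
    whitneyRadius Ω x ≤ 6 / 5 * whitneyRadius Ω c ∧
      whitneyRadius Ω c ≤ 5 / 4 * whitneyRadius Ω x := by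
  have h := dist_le_of_mem_cube_center hs hx
  have h1 := whitneyRadius_le_add hn Ω h
  rw [dist_comm] at h
  have h2 := whitneyRadius_le_add hn Ω h
  constructor <;> linarith

lemma cube_whitneyRadius_subset (hn : 0 < n) {Ω : Set (E n)} {c : E n}
    (hs : 0 < whitneyRadius Ω c) : cube c (40 * whitneyRadius Ω c) ⊆ Ω := by
  have hn' : (0 : ℝ) < n := by exact_mod_cast hn
  refine Subset.trans (fun x hx => ?_) (closedBall_subset_of_lt_infDist
    (x := c) (r := n * (20 * whitneyRadius Ω c)) ?_)
  · exact mem_closedBall.2 (dist_le_of_mem_cube_center hs.le hx)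
  · rw [infDist_eq_whitneyRadius hn]
    nlinarith [mul_pos hn' hs]

/-- Pairwise disjoint balls inside a ball, of radii comparable to it, are bounded in number. -/
lemma encard_le_of_pairwiseDisjoint {u T : Set (E n)} {r : E n → ℝ} {y : E n}
    {D : ℝ} {m : ℕ} (hD : 0 < D) (hm : 0 < m)
    (hdisj : u.PairwiseDisjoint fun x => closedBall x (r x)) (hT : T ⊆ u)
    (hsub : ∀ x ∈ T, closedBall x (r x) ⊆ closedBall y D) (hr : ∀ x ∈ T, D / m ≤ r x) :
    T.encard ≤ (m ^ n : ℕ) := by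
  by_contra hlt
  rw [not_le] at hlt
  -- A finite subfamily with `m ^ n + 1` members is enough to exceed the volume of the enclosing
  -- ball.
  obtain ⟨T', hT', hcard⟩ := exists_subset_encard_eq (Order.add_one_le_of_lt hlt)
  have hfin : T'.Finite := by
    rw [← encard_ne_top_iff, hcard]
    exact ne_of_beq_false rfl
  have hm' : (0 : ℝ) < m := by exact_mod_cast hm
  set v := volume (ball (0 : E n) 1)
  have hv0 : v ≠ 0 := (measure_ball_pos _ _ one_pos).ne'
  have hvt : v ≠ ⊤ := measure_ball_lt_top.ne
  have h1 : (hfin.toFinset.card : ℝ≥0∞) * (ENNReal.ofReal ((D / m) ^ n) * v) ≤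
      ENNReal.ofReal (D ^ n) * v := by
    calc _ = ∑ _x ∈ hfin.toFinset, ENNReal.ofReal ((D / m) ^ n) * v := by
          rw [Finset.sum_const, nsmul_eq_mul]
      _ ≤ ∑ x ∈ hfin.toFinset, volume (closedBall x (r x)) := by
          refine Finset.sum_le_sum fun x hx => ?_
          have hx' := hr x (hT' (by simpa using hx))
          have : 0 < D / m := by positivity
          rw [volume_closedBall_eq x (this.le.trans hx')]
          gcongr
      _ = volume (⋃ x ∈ hfin.toFinset, closedBall x (r x)) := by
          rw [measure_biUnion_finset _ fun _ _ => measurableSet_closedBall]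
          intro x hx x' hx' hne
          exact hdisj (hT (hT' (by simpa using hx))) (hT (hT' (by simpa using hx'))) hne
      _ ≤ volume (closedBall y D) := by
          refine measure_mono (iUnion₂_subset fun x hx => hsub x (hT' (by simpa using hx)))
      _ = _ := volume_closedBall_eq y hD.le
  have hc : hfin.toFinset.card = m ^ n + 1 := by
    rw [hfin.encard_eq_coe_toFinset_card] at hcard
    exact_mod_cast hcard
  rw [hc, ← mul_assoc, ENNReal.mul_le_mul_iff_left hv0 hvt, ← ENNReal.ofReal_natCast,
    ← ENNReal.ofReal_mul (by positivity), ENNReal.ofReal_le_ofReal_iff (by positivity),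
    div_pow] at h1
  push_cast at h1
  have : ((m : ℝ) ^ n + 1) * (D ^ n / m ^ n) = D ^ n + D ^ n / m ^ n := by field_simp
  have : 0 < D ^ n / (m : ℝ) ^ n := by positivity
  linarith

/-- The bump functions `1` on `closedBall 0 5` and supported in `closedBall 0 10`. -/
noncomputable def whitneyBump (n : ℕ) : ContDiffBump (0 : E n) := ⟨5, 10, by norm_num, by norm_num⟩

lemma exists_norm_fderiv_whitneyBump_le (n : ℕ) :
    ∃ C, 0 < C ∧ ∀ x, ‖fderiv ℝ (whitneyBump n) x‖ ≤ C := by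
  have hc : Continuous (fderiv ℝ (whitneyBump n)) :=
    ((whitneyBump n).contDiff (n := 1)).continuous_fderiv one_ne_zero
  obtain ⟨C, hC⟩ := hc.bounded_above_of_compact_support
    ((whitneyBump n).hasCompactSupport.fderiv (𝕜 := ℝ))
  exact ⟨max C 1, by positivity, fun x => (hC x).trans (le_max_left _ _)⟩

/-- The rescaled bump function centred at `c`. -/
noncomputable def scaledBump (c : E n) (s : ℝ) (x : E n) : ℝ := whitneyBump n (s⁻¹ • (x - c))

lemma contDiff_scaledBump (c : E n) (s : ℝ) : ContDiff ℝ ∞ (scaledBump c s) :=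
  (whitneyBump n).contDiff.comp ((contDiff_id.sub contDiff_const).const_smul s⁻¹)

lemma scaledBump_nonneg (c : E n) (s : ℝ) (x : E n) : 0 ≤ scaledBump c s x :=
  (whitneyBump n).nonneg

lemma scaledBump_eq_one {c x : E n} {s : ℝ} (hs : 0 < s) (hx : x ∈ closedBall c (5 * s)) :
    scaledBump c s x = 1 := by
  apply (whitneyBump n).one_of_mem_closedBall
  rw [mem_closedBall, dist_eq_norm] at hx
  rw [mem_closedBall, dist_zero_right, norm_smul, norm_inv, Real.norm_of_nonneg hs.le,
    inv_mul_le_iff₀ hs]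
  exact hx.trans (le_of_eq (mul_comm _ _))

lemma scaledBump_eq_zero {c x : E n} {s : ℝ} (hs : 0 < s) (hx : 10 * s ≤ dist x c) :
    scaledBump c s x = 0 := by
  apply (whitneyBump n).zero_of_le_dist
  rw [dist_zero_right, norm_smul, norm_inv, Real.norm_of_nonneg hs.le, ← dist_eq_norm,
    le_inv_mul_iff₀ hs]
  exact (le_of_eq (mul_comm _ _)).trans hx

lemma norm_fderiv_scaledBump_le {C : ℝ} (hC : ∀ x, ‖fderiv ℝ (whitneyBump n) x‖ ≤ C) (c x : E n)
    {s : ℝ} (hs : 0 < s) : ‖fderiv ℝ (scaledBump c s) x‖ ≤ C / s := by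
  have h1 : HasFDerivAt (fun y : E n => s⁻¹ • (y - c)) (s⁻¹ • ContinuousLinearMap.id ℝ (E n)) x :=
    ((hasFDerivAt_id x).sub_const c).const_smul s⁻¹
  have h2 : HasFDerivAt (whitneyBump n) (fderiv ℝ (whitneyBump n) (s⁻¹ • (x - c)))
      (s⁻¹ • (x - c)) :=
    ((whitneyBump n).contDiff (n := 1)).differentiable one_ne_zero _ |>.hasFDerivAt
  have h3 : fderiv ℝ (scaledBump c s) x = _ := (h2.comp x h1).fderiv
  rw [h3, ContinuousLinearMap.comp_smul, ContinuousLinearMap.comp_id, norm_smul, norm_inv,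
    Real.norm_of_nonneg hs.le, inv_mul_eq_div]
  gcongr
  exact hC _

/-- Every proper open set of finite measure has a Whitney partition. -/
theorem exists_whitneyPartition (hn : 0 < n) :
    ∃ C, 0 < C ∧ ∀ Ω : Set (E n), IsOpen Ω → (Ωᶜ).Nonempty → volume Ω ≠ ⊤ →
      Nonempty (WhitneyPartition Ω ((120 * n) ^ n) ((20 * n) ^ n) C) := by
  obtain ⟨C, hC0, hC⟩ := exists_norm_fderiv_whitneyBump_le n
  have hn' : (0 : ℝ) < n := by exact_mod_cast hn
  have hn1 : (1 : ℝ) ≤ n := by exact_mod_cast hn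
  set N : ℕ := (120 * n) ^ n with hN
  refine ⟨C * (1 + 2 * N), by positivity, fun Ω hΩ hne hvol => ?_⟩
  have hpos : ∀ x ∈ Ω, 0 < whitneyRadius Ω x := fun x hx => whitneyRadius_pos hn hΩ hne hx
  have hballΩ : ∀ x ∈ Ω, closedBall x (whitneyRadius Ω x) ⊆ Ω := by
    intro x hx
    apply closedBall_subset_of_lt_infDist
    rw [infDist_eq_whitneyRadius hn]
    nlinarith [hpos x hx]
  obtain ⟨T₀, hT₀⟩ := exists_radius_bound hn hvol
  obtain ⟨u, huΩ, hdisj, hcov⟩ :=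
    Vitali.exists_disjoint_subfamily_covering_enlargement_closedBall Ω id (whitneyRadius Ω) T₀
      (fun x hx => hT₀ x _ (hpos x hx).le (measure_mono (hballΩ x hx))) 5 (by norm_num)
  have huc : u.Countable :=
    countable_of_pairwiseDisjoint_closedBall hdisj fun x hx => hpos x (huΩ hx)
  have hcu : Countable u := huc.to_subtype
  set s : u → ℝ := fun k => whitneyRadius Ω k.1 with hs
  have hs0 : ∀ k, 0 < s k := fun k => hpos _ (huΩ k.2)
  have hcubeΩ : ∀ k : u, cube k.1 (40 * s k) ⊆ Ω := fun k => cube_whitneyRadius_subset hn (hs0 k)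
  have hcomp : ∀ (k : u) x, x ∈ cube k.1 (40 * s k) →
      whitneyRadius Ω x ≤ 6 / 5 * s k ∧ s k ≤ 5 / 4 * whitneyRadius Ω x :=
    fun k x hx => whitneyRadius_comparable hn (hs0 k).le hx
  have hsle : ∀ x (k l : u), x ∈ cube k.1 (40 * s k) → x ∈ cube l.1 (40 * s l) →
      s k ≤ 2 * s l := by
    intro x k l hk hl
    have h1 := (hcomp k x hk).2
    have h2 := (hcomp l x hl).1
    have := hs0 l
    linarith
  have hencard : ∀ x, {k : u | x ∈ cube k.1 (40 * s k)}.encard ≤ N := by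
    intro y
    by_cases hy : y ∈ Ω
    · have hy0 := hpos y hy
      rw [← Subtype.val_injective.encard_image]
      -- The enclosing radius is `100 n` times the Whitney radius of `y`. The disjoint balls have
      -- radius at least `5 / 6` of that Whitney radius, hence the quotient `120 n`.
      refine encard_le_of_pairwiseDisjoint (u := u) (r := whitneyRadius Ω) (y := y)
        (D := infDist y Ωᶜ) ?_ (by positivity) hdisj ?_ ?_ ?_
      · rw [infDist_eq_whitneyRadius hn]; positivity
      · rintro _ ⟨k, -, rfl⟩
        exact k.2
      · rintro _ ⟨k, hk, rfl⟩
        apply closedBall_subset_closedBall'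
        have h1 := dist_le_of_mem_cube_center (hs0 k).le hk
        rw [dist_comm] at h1
        have h2 := (hcomp k y hk).2
        have h3 : whitneyRadius Ω k.1 ≤ n * s k := le_mul_of_one_le_left (hs0 k).le hn1
        rw [infDist_eq_whitneyRadius hn]
        have h4 : (n : ℝ) * s k ≤ n * (5 / 4 * whitneyRadius Ω y) := by gcongr
        have h5 : (0 : ℝ) < n * whitneyRadius Ω y := by positivity
        linarith
      · rintro _ ⟨k, hk, rfl⟩
        have h2 := (hcomp k y hk).1
        have h3 : s k = whitneyRadius Ω k.1 := rfl
        rw [infDist_eq_whitneyRadius hn]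
        push_cast
        rw [div_le_iff₀ (by positivity)]
        have h4 : (n : ℝ) * whitneyRadius Ω y ≤ n * (6 / 5 * whitneyRadius Ω k.1) := by gcongr
        linarith
    · have : {k : u | y ∈ cube k.1 (40 * s k)} = ∅ := by
        ext k
        simp only [Set.mem_ofPred_eq, mem_empty_iff_false, iff_false]
        exact fun h => hy (hcubeΩ k h)
      rw [this]; simp
  have hfin : ∀ x, {k : u | x ∈ cube k.1 (40 * s k)}.Finite := fun x =>
    finite_of_encard_le_coe (hencard x)
  set T : E n → Finset u := fun x => (hfin x).toFinset with hT
  have hmemT : ∀ x k, k ∈ T x ↔ x ∈ cube k.1 (40 * s k) := by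
    intro x k; simp [hT]
  have hcardT : ∀ x, ((T x).card : ℝ) ≤ N := by
    intro x
    have := hencard x
    rw [(hfin x).encard_eq_coe_toFinset_card] at this
    exact_mod_cast this
  have hballcube : ∀ k : u, closedBall k.1 (20 * s k) ⊆ cube k.1 (40 * s k) := by
    intro k
    have := closedBall_subset_cube k.1 (40 * s k)
    rwa [show 40 * s k / 2 = 20 * s k by ring] at this
  set η : u → E n → ℝ := fun k => scaledBump k.1 (s k) with hη
  have hηC : ∀ k, ContDiff ℝ ∞ (η k) := fun k => contDiff_scaledBump _ _
  have hη0 : ∀ k x, 0 ≤ η k x := fun k x => scaledBump_nonneg _ _ _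
  -- Bumps live in balls of radius `10 s`, while the cubes contain balls of radius `20 s`. This
  -- margin means that bumps active near `y` belong to cubes through `y`, so the sum is locally
  -- finite with a fixed index set.
  have hnear : ∀ y ∈ Ω, ∀ᶠ x in 𝓝 y, ∀ k, k ∉ T y → η k x = 0 := by
    intro y hy
    have hy0 := hpos y hy
    filter_upwards [ball_mem_nhds y (half_pos hy0)] with x hx k hk
    by_contra hne
    apply hk
    rw [hmemT]
    have h1 : dist x k.1 < 10 * s k := by
      by_contra hge
      exact hne (scaledBump_eq_zero (hs0 k) (not_lt.1 hge))
    have hk0 := hs0 k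
    have h2 := (hcomp k x (hballcube k (mem_closedBall.2 (by linarith)))).1
    have h3 : dist y x ≤ n * (whitneyRadius Ω y / 2) := by
      rw [mem_ball, dist_comm] at hx
      exact hx.le.trans (le_mul_of_one_le_left (by positivity) hn1)
    have h4 := whitneyRadius_le_add hn Ω h3
    rw [mem_ball, dist_comm] at hx
    have h5 := dist_triangle y x k.1
    exact hballcube k (mem_closedBall.2 (by linarith))
  set S : E n → ℝ := fun x => ∑ᶠ k, η k x with hS
  have hSnear : ∀ y ∈ Ω, S =ᶠ[𝓝 y] fun x => ∑ k ∈ T y, η k x := by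
    intro y hy
    filter_upwards [hnear y hy] with x hx
    refine finsum_eq_sum_of_support_subset _ fun k hk => ?_
    by_contra hkT
    exact hk (hx k (by simpa using hkT))
  have hSC : ∀ y ∈ Ω, ContDiffAt ℝ ∞ S y := by
    intro y hy
    refine ContDiffAt.congr_of_eventuallyEq ?_ (hSnear y hy)
    exact (ContDiff.sum fun k _ => hηC k).contDiffAt
  -- The fivefold Vitali enlargement matches the radius `5 s` on which a bump equals 1.
  have hS1 : ∀ y ∈ Ω, 1 ≤ S y := by
    intro y hy
    rw [(hSnear y hy).eq_of_nhds]
    obtain ⟨k, hk, hyk⟩ := hcov y hy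
    have h1 : y ∈ closedBall k (5 * whitneyRadius Ω k) :=
      hyk (mem_closedBall_self (hpos y hy).le)
    have hk0 := hs0 ⟨k, hk⟩
    have h2 : (⟨k, hk⟩ : u) ∈ T y := by
      rw [hmemT]
      refine hballcube ⟨k, hk⟩ (closedBall_subset_closedBall ?_ h1)
      have : s ⟨k, hk⟩ = whitneyRadius Ω k := rfl
      linarith
    have h3 : η ⟨k, hk⟩ y = 1 := scaledBump_eq_one hk0 h1
    rw [← h3]
    exact Finset.single_le_sum (f := fun k => η k y) (fun k _ => hη0 k y) h2
  set χ : u → E n → ℝ := fun k x => η k x / S x with hχ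
  have hχzero : ∀ k x, η k x = 0 → χ k x = 0 := fun k x h => by simp [hχ, h]
  have hηout : ∀ (k : u) x, x ∉ closedBall k.1 (10 * s k) → η k x = 0 := by
    intro k x hx
    rw [mem_closedBall, not_le] at hx
    exact scaledBump_eq_zero (hs0 k) hx.le
  have hsubΩ : ∀ k : u, closedBall k.1 (10 * s k) ⊆ cube k.1 (40 * s k) := fun k =>
    (closedBall_subset_closedBall (by linarith [hs0 k])).trans (hballcube k)
  have houtnear : ∀ (k : u) x, x ∉ closedBall k.1 (10 * s k) → χ k =ᶠ[𝓝 x] fun _ => 0 := by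
    intro k x hx
    filter_upwards [isClosed_closedBall.isOpen_compl.mem_nhds hx] with y hy
    exact hχzero k y (hηout k y hy)
  have hχC : ∀ k, ContDiff ℝ ∞ (χ k) := by
    intro k
    rw [contDiff_iff_contDiffAt]
    intro x
    by_cases hx : x ∈ closedBall k.1 (10 * s k)
    · have hxΩ := hcubeΩ k (hsubΩ k hx)
      exact (hηC k).contDiffAt.div (hSC x hxΩ) (by linarith [hS1 x hxΩ])
    · exact contDiffAt_const.congr_of_eventuallyEq (houtnear k x hx)
  have hsum : ∀ y ∈ Ω, ∀ᶠ x in 𝓝 y, ∑ k ∈ T y, χ k x = 1 := by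
    intro y hy
    filter_upwards [hSnear y hy, hΩ.mem_nhds hy] with x hx hxΩ
    simp only [hχ]
    rw [← Finset.sum_div, ← hx, div_self (by linarith [hS1 x hxΩ])]
  have hdiff : ∀ k x, DifferentiableAt ℝ (χ k) x := fun k x =>
    (hχC k).differentiable (by simp) x
  have hbound : ∀ k x, ‖fderiv ℝ (χ k) x‖ ≤ C * (1 + 2 * N) / s k := by
    intro k x
    have hk0 := hs0 k
    by_cases hx : x ∈ closedBall k.1 (10 * s k)
    · have hxQ := hsubΩ k hx
      have hxΩ := hcubeΩ k hxQ
      have hSd : HasFDerivAt S (∑ l ∈ T x, fderiv ℝ (η l) x) x := by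
        refine HasFDerivAt.congr_of_eventuallyEq ?_ (hSnear x hxΩ)
        exact HasFDerivAt.fun_sum fun l _ =>
          ((hηC l).differentiable (by simp) x).hasFDerivAt
      have hprod := (hdiff k x).hasFDerivAt.mul hSd
      -- Differentiating the product `χ * S = η` avoids the quotient rule; `S ≥ 1` then bounds the
      -- derivative of `χ`.
      have hηS : (χ k * S) =ᶠ[𝓝 x] η k := by
        filter_upwards [hΩ.mem_nhds hxΩ] with y hy
        have : S y ≠ 0 := by linarith [hS1 y hy]
        simp only [hχ, Pi.mul_apply]
        field_simp
      have heq := (hprod.congr_of_eventuallyEq hηS.symm).fderiv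
      have h1 : S x • fderiv ℝ (χ k) x =
          fderiv ℝ (η k) x - χ k x • ∑ l ∈ T x, fderiv ℝ (η l) x := by
        rw [heq]; abel
      have hS1x := hS1 x hxΩ
      have hχ1 : χ k x ≤ 1 := by
        have hkT : k ∈ T x := (hmemT x k).2 hxQ
        rw [← (hsum x hxΩ).self_of_nhds]
        exact Finset.single_le_sum (f := fun k => χ k x)
          (fun l _ => div_nonneg (hη0 l x) (by linarith)) hkT
      have hχ0 : 0 ≤ χ k x := div_nonneg (hη0 k x) (by linarith)
      calc ‖fderiv ℝ (χ k) x‖ ≤ S x * ‖fderiv ℝ (χ k) x‖ :=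
            le_mul_of_one_le_left (norm_nonneg _) hS1x
        _ = ‖fderiv ℝ (η k) x - χ k x • ∑ l ∈ T x, fderiv ℝ (η l) x‖ := by
            rw [← h1, norm_smul, Real.norm_of_nonneg (by linarith)]
        _ ≤ ‖fderiv ℝ (η k) x‖ + χ k x * ‖∑ l ∈ T x, fderiv ℝ (η l) x‖ := by
            refine (norm_sub_le _ _).trans (le_of_eq ?_)
            rw [norm_smul, Real.norm_of_nonneg hχ0]
        _ ≤ C / s k + 1 * (N * (2 * C / s k)) := by
            gcongr
            · exact norm_fderiv_scaledBump_le hC _ _ hk0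
            · refine ((norm_sum_le _ _).trans (Finset.sum_le_card_nsmul (T x) _ (2 * C / s k)
                fun l hl => ?_)).trans ?_
              -- Cubes which meet have comparable sides, so each neighbouring bump has gradient at
              -- most `2 * C / s k`.
              · have hl0 := hs0 l
                refine (norm_fderiv_scaledBump_le hC _ _ hl0).trans ?_
                have := hsle x k l hxQ ((hmemT x l).1 hl)
                rw [div_le_div_iff₀ hl0 hk0]
                nlinarith
              · rw [nsmul_eq_mul]
                gcongr
                exact_mod_cast hcardT x
        _ = C * (1 + 2 * N) / s k := by ring
    · rw [(houtnear k x hx).fderiv_eq]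
      simp only [fderiv_fun_const, Pi.zero_apply, norm_zero]
      positivity
  refine ⟨⟨u, hcu, fun k => k.1, s, χ, hs0, hcubeΩ, hencard, ?_, ?_, hsle, hχC, ?_, ?_, ?_, ?_, ?_,
    hbound⟩⟩
  -- A cube of side `2 s / n` fits into the Vitali ball and is `20 n` times smaller than the Whitney
  -- cube. The Vitali balls are disjoint and contained in `Ω`.
  · have hb : ∀ k : u, volume (cube k.1 (40 * s k)) ≤
        ENNReal.ofReal ((20 * n) ^ n) * volume (closedBall k.1 (s k)) := by
      intro k
      have hk0 := hs0 k
      have h1 : cube k.1 (2 * s k / n) ⊆ closedBall k.1 (s k) := by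
        have := cube_subset_closedBall k.1 (R := 2 * s k / n) (by positivity)
        rwa [show (n : ℝ) * (2 * s k / n / 2) = s k by field_simp] at this
      calc volume (cube k.1 (40 * s k)) = volume (cube k.1 ((20 * n) * (2 * s k / n))) := by
            congr 2; field_simp; norm_num
        _ = ENNReal.ofReal ((20 * n) ^ n) * volume (cube k.1 (2 * s k / n)) :=
            volume_cube_mul _ (by positivity) (by positivity)
        _ ≤ _ := by gcongr
    calc _ ≤ ∑' k : u, ENNReal.ofReal ((20 * n) ^ n) * volume (closedBall k.1 (s k)) :=
          ENNReal.tsum_le_tsum hb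
      _ = ENNReal.ofReal ((20 * n) ^ n) * volume (⋃ k : u, closedBall k.1 (s k)) := by
          rw [ENNReal.tsum_mul_left, measure_iUnion _ fun _ => measurableSet_closedBall]
          intro k l hkl
          exact hdisj k.2 l.2 fun h => hkl (Subtype.ext h)
      _ ≤ _ := by
          gcongr
          exact iUnion_subset fun k => hballΩ k.1 (huΩ k.2)
  · intro k
    have hk0 := hs0 k
    -- The distance from the centre to the complement is `100 n s`, so twice this radius reaches it;
    -- the doubled cube needs only `40 n s`.
    refine ⟨200 * n * s k, by positivity, ?_, ?_, ?_⟩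
    · refine (cube_subset_closedBall k.1 (by positivity)).trans (closedBall_subset_ball ?_)
      have : 0 < n * s k := by positivity
      linarith
    · calc volume (ball k.1 (200 * n * s k)) ≤ volume (cube k.1 ((10 * n) * (40 * s k))) := by
            refine measure_mono (ball_subset_closedBall.trans ?_)
            have := closedBall_subset_cube k.1 ((10 * n) * (40 * s k))
            rwa [show (10 * n) * (40 * s k) / 2 = 200 * n * s k by ring] at this
        _ = ENNReal.ofReal ((10 * n) ^ n) * volume (cube k.1 (40 * s k)) :=
            volume_cube_mul _ (by positivity) (by positivity)
        _ ≤ _ := by gcongr; norm_num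
    · intro hsub
      have hlt : infDist k.1 Ωᶜ < 200 * n * s k := by
        rw [infDist_eq_whitneyRadius hn]
        have : 0 < n * s k := by positivity
        have h3 : s k = whitneyRadius Ω k.1 := rfl
        rw [← h3]
        linarith
      obtain ⟨q, hq, hdist⟩ := (infDist_lt_iff hne).1 hlt
      exact hq (hsub (by rwa [mem_ball, dist_comm]))
  · intro k x hx
    by_contra hxb
    exact hx (hχzero k x (hηout k x hxb))
  · intro k x
    by_cases hx : x ∈ closedBall k.1 (10 * s k)
    · exact div_nonneg (hη0 k x) (by linarith [hS1 x (hcubeΩ k (hsubΩ k hx))])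
    · rw [hχzero k x (hηout k x hx)]
  · intro k x
    by_cases hx : x ∈ closedBall k.1 (10 * s k)
    · have hxΩ := hcubeΩ k (hsubΩ k hx)
      rw [← (hsum x hxΩ).self_of_nhds]
      exact Finset.single_le_sum (f := fun k => χ k x)
          (fun l _ => div_nonneg (hη0 l x) (by linarith [hS1 x hxΩ]))
          ((hmemT x k).2 (hsubΩ k hx))
    · rw [hχzero k x (hηout k x hx)]
      exact zero_le_one
  · intro x hx
    rw [← (hsum x hx).self_of_nhds]
    refine finsum_eq_sum_of_support_subset _ fun k hk => ?_
    by_contra hkT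
    exact hk (hχzero k x ((hnear x hx).self_of_nhds k (by simpa using hkT)))
  · intro x hx
    have h1 : ∑ᶠ k, fderiv ℝ (χ k) x = ∑ k ∈ T x, fderiv ℝ (χ k) x := by
      refine finsum_eq_sum_of_support_subset _ fun k hk => ?_
      by_contra hkT
      refine hk ?_
      have : x ∉ closedBall k.1 (10 * s k) := fun h =>
        hkT (by simpa using (hmemT x k).2 (hsubΩ k h))
      simp only [(houtnear k x this).fderiv_eq, fderiv_fun_const, Pi.zero_apply]
    have h2 : HasFDerivAt (fun y => ∑ k ∈ T x, χ k y) (∑ k ∈ T x, fderiv ℝ (χ k) x) x :=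
      HasFDerivAt.fun_sum fun l _ => (hdiff l x).hasFDerivAt
    have h3 : (fun y => ∑ k ∈ T x, χ k y) =ᶠ[𝓝 x] fun _ => 1 := hsum x hx
    rw [h1, ← h2.fderiv, h3.fderiv_eq]
    simp

end Whitney

end MagneticCZ

namespace MagneticCZ

open Filter Topology Set

/-! ### Weak magnetic gradients of sums and of cut-off functions. -/

section WeakGradient

variable {n : ℕ} {a : E n → E n}

lemma aestronglyMeasurable_tsum {X G ι : Type*} [MeasurableSpace X] {μ : Measure X}
    [NormedAddCommGroup G] [CompleteSpace G] [Countable ι] {F : ι → X → G}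
    (hF : ∀ i, AEStronglyMeasurable (F i) μ) (h : ∀ᵐ x ∂μ, ∑' i, ‖F i x‖ₑ ≠ ⊤) :
    AEStronglyMeasurable (fun x => ∑' i, F i x) μ := by
  refine aestronglyMeasurable_of_tendsto_ae (atTop : Filter (Finset ι))
    (f := fun s x => ∑ i ∈ s, F i x)
    (fun s => Finset.aestronglyMeasurable_fun_sum s fun i _ => hF i) ?_
  filter_upwards [h] with x hx
  exact (Summable.of_enorm hx).hasSum

lemma integrable_tsum_of_lintegral {X G ι : Type*} [MeasurableSpace X] {μ : Measure X}
    [NormedAddCommGroup G] [CompleteSpace G] [Countable ι] {F : ι → X → G}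
    (hF : ∀ i, AEStronglyMeasurable (F i) μ) (h : ∑' i, ∫⁻ x, ‖F i x‖ₑ ∂μ ≠ ⊤) :
    Integrable (fun x => ∑' i, F i x) μ := by
  rw [← lintegral_tsum fun i => (hF i).enorm] at h
  have hae : ∀ᵐ x ∂μ, ∑' i, ‖F i x‖ₑ ≠ ⊤ := by
    filter_upwards [ae_lt_top' (AEMeasurable.tsum fun i => (hF i).enorm) h] with x hx
    exact hx.ne
  refine ⟨aestronglyMeasurable_tsum hF hae, lt_of_le_of_lt ?_ (lt_top_iff_ne_top.2 h)⟩
  exact lintegral_mono fun x => enorm_tsum_le_tsum_enorm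

lemma locallyIntegrable_mul_of_bounded {m u : E n → ℂ} (hm : LocallyIntegrable m)
    (hu : AEStronglyMeasurable u volume) {S : ℝ} (hS : ∀ᵐ x, ‖u x‖ ≤ S) :
    LocallyIntegrable fun x => m x * u x := by
  rw [locallyIntegrable_iff]
  intro K hK
  refine ((hm.integrableOn_isCompact hK).norm.const_mul S).mono'
    (hm.aestronglyMeasurable.mul hu).restrict ?_
  filter_upwards [ae_restrict_of_ae hS] with x hx
  rw [norm_mul, mul_comm]
  gcongr

lemma locallyIntegrable_of_bounded {u : E n → ℂ} (hu : AEStronglyMeasurable u volume) {S : ℝ}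
    (hS : ∀ᵐ x, ‖u x‖ ≤ S) : LocallyIntegrable u := by
  simpa using locallyIntegrable_mul_of_bounded (locallyIntegrable_const (1 : ℂ)) hu hS

lemma integrable_mul_of_locallyIntegrable {m ψ : E n → ℂ} (hm : LocallyIntegrable m)
    (hψ : Continuous ψ) (hψc : HasCompactSupport ψ) : Integrable fun x => m x * ψ x := by
  simpa [mul_comm] using hm.integrable_smul_left_of_hasCompactSupport hψ hψc

lemma locallyIntegrable_of_coord {w : E n → EuclideanSpace ℂ (Fin n)}
    (h : ∀ j, LocallyIntegrable fun x => w x j) : LocallyIntegrable w := by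
  rw [locallyIntegrable_iff]
  intro K hK
  exact Integrable.of_eval_piLp fun j => (h j).integrableOn_isCompact hK

lemma locallyIntegrable_coord {w : E n → EuclideanSpace ℂ (Fin n)} (h : LocallyIntegrable w)
    (j : Fin n) : LocallyIntegrable fun x => w x j := by
  rw [locallyIntegrable_iff]
  intro K hK
  exact Integrable.eval_piLp (h.integrableOn_isCompact hK) j

lemma IsL2Loc.locallyIntegrable_ofReal (ha : IsL2Loc a) (j : Fin n) :
    LocallyIntegrable fun x => (a x j : ℂ) := by
  rw [locallyIntegrable_iff]
  intro K hK
  exact ((ha.locallyIntegrable_apply j).integrableOn_isCompact hK).ofReal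

/-- The classical magnetic gradient of a test function is its weak magnetic gradient. -/
lemma IsL2Loc.isWeakMagGrad_magGrad (ha : IsL2Loc a) {f : E n → ℂ} (hf : IsTest f) :
    IsWeakMagGrad a f (magGrad a f) := by
  have hfc : Continuous f := hf.1.continuous
  obtain ⟨S, hS⟩ := hfc.bounded_above_of_compact_support hf.2
  have haf : ∀ j, LocallyIntegrable fun x => (a x j : ℂ) * f x := fun j =>
    locallyIntegrable_mul_of_bounded (ha.locallyIntegrable_ofReal j) hfc.aestronglyMeasurable
      (Eventually.of_forall hS)
  refine ⟨hfc.locallyIntegrable, haf, locallyIntegrable_of_coord fun j => ?_, fun j ψ hψ => ?_⟩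
  · exact ((continuous_const.mul (continuous_partialDeriv hf j)).locallyIntegrable).sub (haf j)
  · have hψc : Continuous ψ := hψ.1.continuous
    have hdf := continuous_partialDeriv hf j
    have hdψ := continuous_partialDeriv hψ j
    have hibp := integral_mul_fderiv_eq_neg_fderiv_mul_of_integrable (μ := volume) (f := f) (g := ψ)
      (v := EuclideanSpace.single j 1)
      ((hdf.mul hψc).integrable_of_hasCompactSupport hψ.2.mul_left)
      ((hfc.mul hdψ).integrable_of_hasCompactSupport hf.2.mul_right)
      ((hfc.mul hψc).integrable_of_hasCompactSupport hψ.2.mul_left)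
      (fun x _ => hf.1.differentiable (by simp) x) (fun x _ => hψ.1.differentiable (by simp) x)
    have hafi : Integrable fun x => (a x j : ℂ) * f x * ψ x :=
      integrable_mul_of_locallyIntegrable (haf j) hψc hψ.2
    have h1 : Integrable fun x => 1 / Complex.I * (partialDeriv j f x * ψ x) :=
      ((hdf.mul hψc).integrable_of_hasCompactSupport hψ.2.mul_left).const_mul _
    have h2 : Integrable fun x => -(1 / Complex.I) * (f x * partialDeriv j ψ x) :=
      ((hfc.mul hdψ).integrable_of_hasCompactSupport hf.2.mul_right).const_mul _
    calc ∫ x, magGrad a f x j * ψ x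
        = ∫ x, (1 / Complex.I * (partialDeriv j f x * ψ x) - (a x j : ℂ) * f x * ψ x) := by
          refine integral_congr_ae (Eventually.of_forall fun x => ?_)
          simp only [magGrad]; ring
      _ = _ := by
          rw [integral_sub h1 hafi, integral_sub h2 hafi, integral_const_mul, integral_const_mul]
          congr 1
          have hibp' : ∫ x, f x * partialDeriv j ψ x = -∫ x, partialDeriv j f x * ψ x := hibp
          rw [hibp']; ring

/-- Weak magnetic gradients can be summed. -/
lemma IsWeakMagGrad.sub_tsum {ι : Type*} [Countable ι] (ha : IsL2Loc a) {f : E n → ℂ}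
    {Lf : E n → EuclideanSpace ℂ (Fin n)} (hf : IsWeakMagGrad a f Lf) {b : ι → E n → ℂ}
    {Lb : ι → E n → EuclideanSpace ℂ (Fin n)} (hb : ∀ k, IsWeakMagGrad a (b k) (Lb k)) {S : ℝ}
    (hS : ∀ x, ∑' k, ‖b k x‖ₑ ≤ ENNReal.ofReal S) (hLb : ∑' k, ∫⁻ x, ‖Lb k x‖ₑ ≠ ⊤) :
    IsWeakMagGrad a (fun x => f x - ∑' k, b k x)
      (fun x => Lf x - WithLp.toLp 2 fun j => ∑' k, Lb k x j) := by
  have hbm : ∀ k, AEStronglyMeasurable (b k) volume := fun k => (hb k).1.aestronglyMeasurable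
  have hLbm : ∀ k j, AEStronglyMeasurable (fun x => Lb k x j) volume := fun k j =>
    (locallyIntegrable_coord (hb k).2.2.1 j).aestronglyMeasurable
  have hSt : ∀ x, ∑' k, ‖b k x‖ₑ ≠ ⊤ := fun x => ne_top_of_le_ne_top ENNReal.ofReal_ne_top (hS x)
  set B : E n → ℂ := fun x => ∑' k, b k x with hB
  have hBm : AEStronglyMeasurable B volume :=
    aestronglyMeasurable_tsum hbm (Eventually.of_forall hSt)
  have hBS : ∀ᵐ x, ‖B x‖ ≤ max S 0 := Eventually.of_forall fun x => by
    have h1 : ENNReal.ofReal ‖B x‖ ≤ ENNReal.ofReal S := by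
      rw [ofReal_norm]
      exact enorm_tsum_le_tsum_enorm.trans (hS x)
    rwa [ENNReal.ofReal_le_ofReal_iff', ← le_max_iff] at h1
  have hLbj : ∀ j, ∑' k, ∫⁻ x, ‖Lb k x j‖ₑ ≠ ⊤ := fun j =>
    ne_top_of_le_ne_top hLb (ENNReal.tsum_le_tsum fun k => lintegral_mono fun x => by
      rw [← ofReal_norm, ← ofReal_norm]
      exact ENNReal.ofReal_le_ofReal (PiLp.norm_apply_le _ _))
  have hGj : ∀ j, Integrable fun x => ∑' k, Lb k x j := fun j =>
    integrable_tsum_of_lintegral (fun k => hLbm k j) (hLbj j)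
  have haB : ∀ j, LocallyIntegrable fun x => (a x j : ℂ) * B x := fun j =>
    locallyIntegrable_mul_of_bounded (ha.locallyIntegrable_ofReal j) hBm hBS
  have hBl : LocallyIntegrable B := locallyIntegrable_of_bounded hBm hBS
  refine ⟨hf.1.sub hBl, fun j => ?_, ?_, fun j ψ hψ => ?_⟩
  · refine ((hf.2.1 j).sub (haB j)).congr (Eventually.of_forall fun x => ?_)
    simp only [Pi.sub_apply]; ring
  · refine locallyIntegrable_of_coord fun j => ?_
    exact (locallyIntegrable_coord hf.2.2.1 j).sub (hGj j).locallyIntegrable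
  · have hψc : Continuous ψ := hψ.1.continuous
    have hdψ := continuous_partialDeriv hψ j
    have hdψs := hasCompactSupport_partialDeriv hψ j
    obtain ⟨T, hT⟩ := hψc.bounded_above_of_compact_support hψ.2
    -- Collecting everything but the unknown function makes the right side of the weak equation the
    -- pairing `∫ u * m` with one integrable function, so sum and integral can be exchanged once.
    set m : E n → ℂ := fun x => -(1 / Complex.I) * partialDeriv j ψ x - (a x j : ℂ) * ψ x with hm
    have hmi : Integrable m :=
      ((hdψ.integrable_of_hasCompactSupport hdψs).const_mul _).sub
        (ha.integrable_mul_test hψc hψ.2 j)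
    have hmrw : ∀ u : E n → ℂ, (fun x => -(1 / Complex.I) * (u x * partialDeriv j ψ x) -
        (a x j : ℂ) * u x * ψ x) = fun x => u x * m x := by
      intro u; ext x; simp only [hm]; ring
    have hum : ∀ u : E n → ℂ, LocallyIntegrable u → LocallyIntegrable (fun x => (a x j : ℂ) * u x) →
        Integrable fun x => u x * m x := by
      intro u hu hau
      rw [← hmrw]
      exact ((integrable_mul_of_locallyIntegrable hu hdψ hdψs).const_mul _).sub
        (integrable_mul_of_locallyIntegrable hau hψc hψ.2)
    have hψS : ∑' k, ∫⁻ x, ‖Lb k x j * ψ x‖ₑ ≠ ⊤ := by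
      refine ne_top_of_le_ne_top (ENNReal.mul_ne_top (hLbj j) (ENNReal.ofReal_ne_top (r := T))) ?_
      rw [← ENNReal.tsum_mul_right]
      refine ENNReal.tsum_le_tsum fun k => ?_
      rw [← lintegral_mul_const' _ _ ENNReal.ofReal_ne_top]
      refine lintegral_mono fun x => ?_
      rw [enorm_mul]
      gcongr
      rw [← ofReal_norm]
      exact ENNReal.ofReal_le_ofReal (hT x)
    have hbmm : ∀ k, AEStronglyMeasurable (fun x => b k x * m x) volume := fun k =>
      (hbm k).mul hmi.aestronglyMeasurable
    have hLψm : ∀ k, AEStronglyMeasurable (fun x => Lb k x j * ψ x) volume := fun k =>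
      (hLbm k j).mul hψc.aestronglyMeasurable
    have hmS : ∑' k, ∫⁻ x, ‖b k x * m x‖ₑ ≠ ⊤ := by
      rw [← lintegral_tsum fun k => (hbmm k).enorm]
      refine ne_top_of_le_ne_top (ENNReal.mul_ne_top (ENNReal.ofReal_ne_top (r := S))
        hmi.2.ne) ?_
      rw [← lintegral_const_mul' _ _ ENNReal.ofReal_ne_top]
      refine lintegral_mono fun x => ?_
      simp only [enorm_mul]
      rw [ENNReal.tsum_mul_right]
      gcongr
      exact hS x
    have hsum : ∫ x, (∑' k, Lb k x j) * ψ x = ∫ x, B x * m x := by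
      simp only [hB, ← tsum_mul_right]
      rw [integral_tsum hLψm hψS, integral_tsum hbmm hmS]
      refine tsum_congr fun k => ?_
      rw [(hb k).2.2.2 j ψ hψ, hmrw]
    have hfe := hf.2.2.2 j ψ hψ
    rw [hmrw] at hfe ⊢
    simp only [PiLp.sub_apply, sub_mul]
    rw [integral_sub, integral_sub, hfe, hsum]
    · exact hum f hf.1 (hf.2.1 j)
    · exact hum B hBl (haB j)
    · exact integrable_mul_of_locallyIntegrable (locallyIntegrable_coord hf.2.2.1 j) hψc hψ.2
    · exact integrable_mul_of_locallyIntegrable (hGj j).locallyIntegrable hψc hψ.2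

/-- The part of `f - z e^{iφ}` cut out by `χ`. -/
noncomputable def localPart (f : E n → ℂ) (z : ℂ) (φ χ : E n → ℝ) (x : E n) : ℂ :=
  (f x - z * phase φ x) * χ x

/-- The magnetic gradient of `localPart`, if `L e^{iφ} = -h e^{iφ}`. -/
noncomputable def localPartGrad (a : E n → E n) (f : E n → ℂ) (z : ℂ) (φ : E n → ℝ)
    (h : E n → E n) (χ : E n → ℝ) (x : E n) : EuclideanSpace ℂ (Fin n) :=
  WithLp.toLp 2 fun j => χ x * (magGrad a f x j + h x j * (z * phase φ x)) +
    1 / Complex.I * partialDeriv j χ x * (f x - z * phase φ x)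

lemma partialDeriv_ofReal_mul {χ : E n → ℝ} (hχ : Differentiable ℝ χ) {ψ : E n → ℂ}
    (hψ : Differentiable ℝ ψ) (j : Fin n) (x : E n) :
    partialDeriv j (fun y => (χ y : ℂ) * ψ y) x =
      partialDeriv j χ x * ψ x + χ x * partialDeriv j ψ x := by
  have h1 : HasFDerivAt (fun y => (χ y : ℂ)) (Complex.ofRealCLM.comp (fderiv ℝ χ x)) x :=
    Complex.ofRealCLM.hasFDerivAt.comp x (hχ x).hasFDerivAt
  have h2 : HasFDerivAt (fun y => (χ y : ℂ) * ψ y) _ x := h1.mul (hψ x).hasFDerivAt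
  simp only [partialDeriv]
  rw [h2.fderiv]
  simp
  ring

/-- Leibniz rule: the weak equations of `f` and of `e^{iφ}` are tested against `χ ψ`. Its support
lies in the cube, where the equation of the phase holds, and the derivative falling on `χ` gives the
extra term. -/
lemma GaugeData.isWeakMagGrad_localPart (ha : IsL2Loc a) {c : E n} {R M : ℝ}
    (g : GaugeData (fun m => mollify m a) (cube c R) M) {f : E n → ℂ} (hf : IsTest f) (z : ℂ)
    {χ : E n → ℝ} (hχ : ContDiff ℝ ∞ χ) (hsupp : Function.support χ ⊆ cube c R) :
    IsWeakMagGrad a (localPart f z g.φ χ) (localPartGrad a f z g.φ g.h χ) := by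
  have hfc : Continuous f := hf.1.continuous
  obtain ⟨S, hS⟩ := hfc.bounded_above_of_compact_support hf.2
  have hχc : Continuous χ := hχ.continuous
  have hχs : HasCompactSupport χ := (isCompact_cube c R).of_isClosed_subset isClosed_closure
    (closure_minimal hsupp (isClosed_cube c R))
  obtain ⟨T, hT⟩ := hχc.bounded_above_of_compact_support hχs
  have hT0 : 0 ≤ T := (norm_nonneg _).trans (hT 0)
  have hphm : AEStronglyMeasurable (phase g.φ) volume :=
    aestronglyMeasurable_phase g.aestronglyMeasurable_φ
  set u : E n → ℂ := fun x => f x - z * phase g.φ x with hu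
  have hum : AEStronglyMeasurable u volume := hfc.aestronglyMeasurable.sub (hphm.const_mul z)
  have huS : ∀ x, ‖u x‖ ≤ S + ‖z‖ := fun x => by
    refine (norm_sub_le _ _).trans ?_
    simpa using hS x
  have hbm : AEStronglyMeasurable (localPart f z g.φ χ) volume :=
    hum.mul (Complex.continuous_ofReal.comp hχc).aestronglyMeasurable
  have hbS : ∀ᵐ x, ‖localPart f z g.φ χ x‖ ≤ (S + ‖z‖) * T := Eventually.of_forall fun x => by
    simp only [localPart, norm_mul, Complex.norm_real]
    gcongr
    · exact (norm_nonneg _).trans (huS x)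
    · exact huS x
    · exact hT x
  have hχd : ∀ j, Continuous (partialDeriv j χ) := fun j => by
    have : Continuous (fderiv ℝ χ) := hχ.continuous_fderiv (by simp)
    unfold partialDeriv
    fun_prop
  have hLf := ha.isWeakMagGrad_magGrad hf
  have hhm : ∀ j, AEStronglyMeasurable (fun x => (g.h x j : ℂ)) volume := fun j =>
    (Complex.continuous_ofReal.comp (EuclideanSpace.proj (𝕜 := ℝ) j).continuous
      ).comp_aestronglyMeasurable g.aestronglyMeasurable_h
  have hhl : ∀ j, LocallyIntegrable fun x => (g.h x j : ℂ) * (z * phase g.φ x) := fun j => by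
    refine locallyIntegrable_of_bounded (S := M * ‖z‖) ((hhm j).mul (hphm.const_mul z)) ?_
    filter_upwards [g.norm_h_le] with x hx
    rw [norm_mul, norm_mul, norm_phase, mul_one, Complex.norm_real]
    gcongr
    exact (PiLp.norm_apply_le _ _).trans hx
  have hul : LocallyIntegrable u := locallyIntegrable_of_bounded hum (Eventually.of_forall huS)
  have hcχ : Continuous fun x => (χ x : ℂ) := Complex.continuous_ofReal.comp hχc
  have hcχs : HasCompactSupport fun x => (χ x : ℂ) := hχs.comp_left Complex.ofReal_zero
  have hcd : ∀ j, Continuous fun x => ((partialDeriv j χ x : ℝ) : ℂ) := fun j =>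
    Complex.continuous_ofReal.comp (hχd j)
  have hcds : ∀ j, HasCompactSupport fun x => ((partialDeriv j χ x : ℝ) : ℂ) := fun j =>
    (((hχs.fderiv ℝ).comp_left
      (g := fun D : E n →L[ℝ] ℝ => D (EuclideanSpace.single j 1)) rfl)).comp_left
      Complex.ofReal_zero
  refine ⟨locallyIntegrable_of_bounded hbm hbS, fun j => locallyIntegrable_mul_of_bounded
    (ha.locallyIntegrable_ofReal j) hbm hbS, locallyIntegrable_of_coord fun j => ?_,
    fun j ψ hψ => ?_⟩
  · have h1 := (integrable_mul_of_locallyIntegrable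
      ((locallyIntegrable_coord hLf.2.2.1 j).add (hhl j)) hcχ hcχs).locallyIntegrable
    have h2 := ((integrable_mul_of_locallyIntegrable hul (hcd j) (hcds j)).const_mul
      (1 / Complex.I)).locallyIntegrable
    refine (h1.add h2).congr (Eventually.of_forall fun x => ?_)
    simp only [localPartGrad, Pi.add_apply, hu]
    ring
  · have hψc : Continuous ψ := hψ.1.continuous
    have hdψ := continuous_partialDeriv hψ j
    set η : E n → ℂ := fun x => (χ x : ℂ) * ψ x with hη
    have hηt : IsTest η :=
      ⟨(Complex.ofRealCLM.contDiff.comp hχ).mul hψ.1, hψ.2.mul_left⟩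
    have hηsupp : Function.support η ⊆ cube c R := fun x hx => hsupp fun h => hx (by simp [hη, h])
    have hηd : ∀ x, partialDeriv j η x = partialDeriv j χ x * ψ x + χ x * partialDeriv j ψ x :=
      fun x => partialDeriv_ofReal_mul (hχ.differentiable (by simp))
        (hψ.1.differentiable (by simp)) j x
    have hηc := continuous_partialDeriv hηt j
    have hηs := hasCompactSupport_partialDeriv hηt j
    have e1 := hLf.2.2.2 j η hηt
    have e2 := g.integral_phase ha j hηt hηsupp
    have i1 : Integrable fun x => magGrad a f x j * η x :=
      integrable_mul_of_locallyIntegrable (locallyIntegrable_coord hLf.2.2.1 j) hηt.1.continuous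
        hηt.2
    have i2 : Integrable fun x => (g.h x j : ℂ) * (z * phase g.φ x) * η x :=
      integrable_mul_of_locallyIntegrable (hhl j) hηt.1.continuous hηt.2
    have i3 : Integrable fun x => u x * (((partialDeriv j χ x : ℝ) : ℂ) * ψ x) :=
      integrable_mul_of_locallyIntegrable hul ((hcd j).mul hψc) hψ.2.mul_left
    have i4 : ∀ w : E n → ℂ, LocallyIntegrable w →
        LocallyIntegrable (fun x => (a x j : ℂ) * w x) → Integrable fun x =>
        -(1 / Complex.I) * (w x * partialDeriv j η x) - (a x j : ℂ) * w x * η x := fun w hw haw =>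
      ((integrable_mul_of_locallyIntegrable hw hηc hηs).const_mul _).sub
        (integrable_mul_of_locallyIntegrable haw hηt.1.continuous hηt.2)
    have hphS : ∀ᵐ x, ‖phase g.φ x‖ ≤ 1 := Eventually.of_forall fun x => by simp
    have e2' : ∫ x, (g.h x j : ℂ) * (z * phase g.φ x) * η x =
        ∫ x, -z * (-(1 / Complex.I) * (phase g.φ x * partialDeriv j η x) -
          (a x j : ℂ) * phase g.φ x * η x) := by
      rw [integral_const_mul, ← e2, ← integral_const_mul]
      refine integral_congr_ae (Eventually.of_forall fun x => ?_)
      simp only; ring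
    calc ∫ x, localPartGrad a f z g.φ g.h χ x j * ψ x
        = ∫ x, ((magGrad a f x j * η x + (g.h x j : ℂ) * (z * phase g.φ x) * η x) +
            1 / Complex.I * (u x * (((partialDeriv j χ x : ℝ) : ℂ) * ψ x))) := by
          refine integral_congr_ae (Eventually.of_forall fun x => ?_)
          simp only [localPartGrad, hη, hu]; ring
      _ = ∫ x, (((-(1 / Complex.I) * (f x * partialDeriv j η x) - (a x j : ℂ) * f x * η x) +
            -z * (-(1 / Complex.I) * (phase g.φ x * partialDeriv j η x) -
              (a x j : ℂ) * phase g.φ x * η x)) +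
            1 / Complex.I * (u x * (((partialDeriv j χ x : ℝ) : ℂ) * ψ x))) := by
          have i5 := (i4 _ (locallyIntegrable_of_bounded hphm hphS) (locallyIntegrable_mul_of_bounded
            (ha.locallyIntegrable_ofReal j) hphm hphS)).const_mul (-z)
          have i6 := i4 f hLf.1 (hLf.2.1 j)
          rw [integral_add (Integrable.fun_add i1 i2) (i3.const_mul _), integral_add i1 i2,
            integral_add (Integrable.fun_add i6 i5) (i3.const_mul _), integral_add i6 i5, e1, e2']
      _ = _ := by
          refine integral_congr_ae (Eventually.of_forall fun x => ?_)
          simp only [hηd]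
          simp only [localPart, hη, hu]
          ring

end WeakGradient

end MagneticCZ

namespace MagneticCZ

open Filter Topology Set

/-! ### Integrability of the energy density. -/

section Energy

variable {n : ℕ} {a : E n → E n} {V : E n → ℝ} {p : ℝ} {f : E n → ℂ}

lemma rpow_le_one_add_sq (hp0 : 0 ≤ p) (hp2 : p ≤ 2) (x : ℝ≥0∞) : x ^ p ≤ 1 + x ^ 2 := by
  rcases le_total x 1 with h | h
  · exact (ENNReal.rpow_le_one h hp0).trans le_self_add
  · refine le_trans ?_ le_add_self
    rw [← ENNReal.rpow_natCast]
    exact ENNReal.rpow_le_rpow_of_exponent_le h (by exact_mod_cast hp2)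

lemma le_one_add_rpow (hp : 1 ≤ p) (x : ℝ≥0∞) : x ≤ 1 + x ^ p := by
  rcases le_total x 1 with h | h
  · exact h.trans le_self_add
  · refine le_trans ?_ le_add_self
    conv_lhs => rw [← ENNReal.rpow_one x]
    exact ENNReal.rpow_le_rpow_of_exponent_le h hp

lemma enorm_sqrtMul_sq (V : E n → ℝ) (f : E n → ℂ) (x : E n) :
    ‖sqrtMul V f x‖ₑ ^ 2 = ENNReal.ofReal (V x) * ‖f x‖ₑ ^ 2 := by
  rw [sqrtMul, enorm_mul, mul_pow]
  congr 1
  rw [← ofReal_norm, Complex.norm_real, Real.norm_of_nonneg (Real.sqrt_nonneg _),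
    ← ENNReal.ofReal_pow (Real.sqrt_nonneg _)]
  rcases le_total 0 (V x) with h | h
  · rw [Real.sq_sqrt h]
  · rw [Real.sqrt_eq_zero_of_nonpos h, ENNReal.ofReal_of_nonpos h]; simp

lemma IsL2Loc.memLp_magGrad (ha : IsL2Loc a) (hf : IsTest f) {Q : Set (E n)} (hQ : IsCompact Q) :
    MemLp (magGrad a f) 2 (volume.restrict Q) := by
  have hfc : Continuous f := hf.1.continuous
  have : IsFiniteMeasure (volume.restrict Q) := ⟨by simpa using hQ.measure_lt_top⟩
  obtain ⟨S, hS⟩ := hfc.bounded_above_of_compact_support hf.2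
  refine MemLp.of_eval_piLp fun j => ?_
  obtain ⟨T, hT⟩ := (continuous_partialDeriv hf j).bounded_above_of_compact_support
    (hasCompactSupport_partialDeriv hf j)
  refine MemLp.sub ?_ ?_
  · refine MemLp.of_bound (continuous_const.mul
      (continuous_partialDeriv hf j)).aestronglyMeasurable T (Eventually.of_forall fun x => ?_)
    simpa using hT x
  · have hj : MemLp (fun x => a x j) 2 (volume.restrict Q) := (ha Q hQ).eval_piLp j
    refine (hj.norm.const_mul S).mono ?_ (Eventually.of_forall fun x => ?_)
    · exact (Complex.continuous_ofReal.comp_aestronglyMeasurable hj.1).mul hfc.aestronglyMeasurable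
    · rw [norm_mul, norm_mul, norm_norm, Complex.norm_real, mul_comm]
      gcongr
      exact (hS x).trans (le_abs_self S)

lemma magGrad_eq_zero {x : E n} (hx : x ∉ tsupport f) : magGrad a f x = 0 := by
  have h1 : f x = 0 := image_eq_zero_of_notMem_tsupport hx
  ext j
  simp [magGrad, partialDeriv, h1, fderiv_of_notMem_tsupport ℝ hx]

lemma energyDensity_eq_zero (hp : 0 < p) {x : E n} (hx : x ∉ tsupport f) :
    energyDensity a V p f x = 0 := by
  have h1 : f x = 0 := image_eq_zero_of_notMem_tsupport hx
  simp [energyDensity, magGrad_eq_zero hx, sqrtMul, h1, hp]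

lemma aestronglyMeasurable_magGrad (ha : IsL2Loc a) (hf : IsTest f) :
    AEStronglyMeasurable (magGrad a f) volume :=
  (ha.isWeakMagGrad_magGrad hf).2.2.1.aestronglyMeasurable

lemma aestronglyMeasurable_sqrtMul (hV : LocallyIntegrable V)
    (hf : AEStronglyMeasurable f volume) : AEStronglyMeasurable (sqrtMul V f) volume :=
  ((Complex.continuous_ofReal.comp Real.continuous_sqrt).comp_aestronglyMeasurable
    hV.aestronglyMeasurable).mul hf

lemma aemeasurable_energyDensity (ha : IsL2Loc a) (hV : LocallyIntegrable V) (hf : IsTest f)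
    (p : ℝ) : AEMeasurable (energyDensity a V p f) :=
  ((aestronglyMeasurable_magGrad ha hf).enorm.pow_const _).add
    ((aestronglyMeasurable_sqrtMul hV hf.1.continuous.aestronglyMeasurable).enorm.pow_const _)

/-- On the compact support of `f` both terms are square integrable, as `a` is in L² and `V` in L¹
there; for `p ≤ 2` a `p`-th power is at most one plus a square. -/
lemma lintegral_energyDensity_ne_top (ha : IsL2Loc a) (hV : LocallyIntegrable V) (hf : IsTest f)
    (hp : 1 ≤ p) (hp2 : p ≤ 2) : ∫⁻ x, energyDensity a V p f x ≠ ⊤ := by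
  have hfc : Continuous f := hf.1.continuous
  obtain ⟨S, hS⟩ := hfc.bounded_above_of_compact_support hf.2
  have hQ : IsCompact (tsupport f) := hf.2
  have hQm : MeasurableSet (tsupport f) := (isClosed_tsupport f).measurableSet
  have hsupp : Function.support (energyDensity a V p f) ⊆ tsupport f := fun x hx => by
    by_contra h
    exact hx (energyDensity_eq_zero (by linarith) h)
  rw [← setLIntegral_eq_of_support_subset hsupp]
  have h1 : ∫⁻ x in tsupport f, ‖magGrad a f x‖ₑ ^ 2 < ⊤ := by
    have := (ha.memLp_magGrad hf hQ).2
    rw [eLpNorm_lt_top_iff_lintegral_rpow_enorm_lt_top (by simp) (by simp)] at this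
    simpa using this
  have h2 : ∫⁻ x in tsupport f, ENNReal.ofReal (V x) < ⊤ :=
    lt_of_le_of_lt (lintegral_mono fun x => Real.ofReal_le_enorm _)
      (hV.integrableOn_isCompact hQ).2
  have hle : ∀ x, energyDensity a V p f x ≤
      2 + ‖magGrad a f x‖ₑ ^ 2 + ENNReal.ofReal (S ^ 2) * ENNReal.ofReal (V x) := by
    intro x
    calc _ ≤ (1 + ‖magGrad a f x‖ₑ ^ 2) + (1 + ‖sqrtMul V f x‖ₑ ^ 2) :=
          add_le_add (rpow_le_one_add_sq (by linarith) hp2 _)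
            (rpow_le_one_add_sq (by linarith) hp2 _)
      _ ≤ (1 + ‖magGrad a f x‖ₑ ^ 2) + (1 + ENNReal.ofReal (S ^ 2) * ENNReal.ofReal (V x)) := by
          gcongr
          rw [enorm_sqrtMul_sq, mul_comm, ← ofReal_norm, ← ENNReal.ofReal_pow (norm_nonneg _)]
          gcongr
          exact hS x
      _ = _ := by ring
  refine ne_top_of_le_ne_top ?_ (lintegral_mono hle)
  have hm1 : AEMeasurable (fun x => 2 + ‖magGrad a f x‖ₑ ^ 2) (volume.restrict (tsupport f)) :=
    ((aestronglyMeasurable_magGrad ha hf).enorm.pow_const 2).const_add 2 |>.restrict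
  rw [lintegral_add_left' hm1, lintegral_add_left measurable_const, lintegral_const,
    lintegral_const_mul' _ _ ENNReal.ofReal_ne_top]
  refine ENNReal.add_ne_top.2 ⟨ENNReal.add_ne_top.2 ⟨?_, h1.ne⟩,
    ENNReal.mul_ne_top ENNReal.ofReal_ne_top h2.ne⟩
  refine ENNReal.mul_ne_top (by simp) ?_
  simpa using hQ.measure_lt_top.ne

end Energy

/-! ### Pointwise form of the gradient of a cut-off part. -/

section LocalParts

variable {n : ℕ} {a : E n → E n} {f : E n → ℂ}

/-- A real vector as a complex vector. -/
noncomputable def complexVec (v : E n) : EuclideanSpace ℂ (Fin n) := WithLp.toLp 2 fun j => (v j : ℂ)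

@[simp] lemma norm_complexVec (v : E n) : ‖complexVec v‖ = ‖v‖ := by
  simp [complexVec, EuclideanSpace.norm_eq]

/-- The gradient of a real function as a complex vector. -/
noncomputable def complexGrad (χ : E n → ℝ) (x : E n) : EuclideanSpace ℂ (Fin n) :=
  WithLp.toLp 2 fun j => ((partialDeriv j χ x : ℝ) : ℂ)

lemma norm_complexGrad_le (χ : E n → ℝ) (x : E n) : ‖complexGrad χ x‖ ≤ n * ‖fderiv ℝ χ x‖ := by
  have h : ∀ j, ‖partialDeriv j χ x‖ ≤ ‖fderiv ℝ χ x‖ := fun j => by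
    refine (ContinuousLinearMap.le_opNorm _ _).trans (le_of_eq ?_)
    simp
  rw [EuclideanSpace.norm_eq]
  apply Real.sqrt_le_iff.2 ⟨by positivity, ?_⟩
  calc ∑ j, ‖(complexGrad χ x) j‖ ^ 2 ≤ ∑ _j : Fin n, ‖fderiv ℝ χ x‖ ^ 2 := by
        refine Finset.sum_le_sum fun j _ => ?_
        gcongr
        simpa [complexGrad] using h j
    _ = n * ‖fderiv ℝ χ x‖ ^ 2 := by simp
    _ ≤ (n * ‖fderiv ℝ χ x‖) ^ 2 := by
        rw [mul_pow]
        gcongr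
        have : (n : ℝ) ≤ n ^ 2 := by exact_mod_cast Nat.le_self_pow two_ne_zero n
        exact this

lemma localPartGrad_eq (a : E n → E n) (f : E n → ℂ) (z : ℂ) (φ : E n → ℝ) (h : E n → E n)
    (χ : E n → ℝ) (x : E n) :
    localPartGrad a f z φ h χ x =
      (χ x : ℂ) • (magGrad a f x + (z * phase φ x) • complexVec (h x)) +
        (1 / Complex.I * (f x - z * phase φ x)) • complexGrad χ x := by
  ext j
  simp only [localPartGrad, complexVec, complexGrad, PiLp.add_apply, PiLp.smul_apply, smul_eq_mul]
  ring

lemma norm_localPartGrad_le (a : E n → E n) (f : E n → ℂ) (z : ℂ) (φ : E n → ℝ) (h : E n → E n)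
    {χ : E n → ℝ} {x : E n} (hχ0 : 0 ≤ χ x) (hχ1 : χ x ≤ 1) :
    ‖localPartGrad a f z φ h χ x‖ ≤
      ‖magGrad a f x‖ + ‖z‖ * ‖h x‖ + n * ‖fderiv ℝ χ x‖ * ‖f x - z * phase φ x‖ := by
  rw [localPartGrad_eq]
  refine (norm_add_le _ _).trans (add_le_add ?_ ?_)
  · rw [norm_smul, Complex.norm_real, Real.norm_of_nonneg hχ0]
    refine (mul_le_of_le_one_left (norm_nonneg _) hχ1).trans ((norm_add_le _ _).trans ?_)
    rw [norm_smul, norm_mul, norm_phase, mul_one, norm_complexVec]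
  · rw [norm_smul, norm_mul, norm_div, norm_one, Complex.norm_I, div_one, one_mul, mul_comm]
    gcongr
    exact norm_complexGrad_le χ x

end LocalParts

end MagneticCZ

namespace MagneticCZ

open Filter Topology Set Metric

/-! ### The good and bad parts attached to a Whitney covering. -/

section Assembly

variable {n : ℕ} {Ω : Set (E n)} {N : ℕ} {κ Cχ : ℝ}

namespace WhitneyPartition

variable (W : WhitneyPartition Ω N κ Cχ)

/-- The cubes of the covering. -/
def Q (k : W.ι) : Set (E n) := cube (W.c k) (40 * W.s k)

lemma measurableSet_Q (k : W.ι) : MeasurableSet (W.Q k) := measurableSet_cube _ _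

lemma closedBall_subset_Q (k : W.ι) : closedBall (W.c k) (20 * W.s k) ⊆ W.Q k := by
  have := closedBall_subset_cube (W.c k) (40 * W.s k)
  rwa [show 40 * W.s k / 2 = 20 * W.s k by ring] at this

lemma closedBall_ten_subset_Q (k : W.ι) : closedBall (W.c k) (10 * W.s k) ⊆ W.Q k :=
  (closedBall_subset_closedBall (by linarith [W.s_pos k])).trans (W.closedBall_subset_Q k)

lemma finite_mem_Q (x : E n) : {k | x ∈ W.Q k}.Finite := finite_of_encard_le_coe (W.encard_le x)

/-- The indices of the cubes through `x`. -/
noncomputable def nbr (x : E n) : Finset W.ι := (W.finite_mem_Q x).toFinset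

@[simp] lemma mem_nbr {x : E n} {k : W.ι} : k ∈ W.nbr x ↔ x ∈ W.Q k := by simp [nbr]

lemma card_nbr_le (x : E n) : (W.nbr x).card ≤ N := by
  have h : {k | x ∈ W.Q k}.encard ≤ N := W.encard_le x
  rw [(W.finite_mem_Q x).encard_eq_coe_toFinset_card] at h
  exact_mod_cast h

lemma χ_eq_zero {k : W.ι} {x : E n} (hx : x ∉ closedBall (W.c k) (10 * W.s k)) : W.χ k x = 0 := by
  by_contra h
  exact hx (W.support_χ k h)

lemma fderiv_χ_eq_zero {k : W.ι} {x : E n} (hx : x ∉ closedBall (W.c k) (10 * W.s k)) :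
    fderiv ℝ (W.χ k) x = 0 := by
  apply fderiv_of_notMem_tsupport
  exact fun h => hx (closure_minimal (W.support_χ k) isClosed_closedBall h)

lemma complexGrad_χ_eq_zero {k : W.ι} {x : E n} (hx : x ∉ closedBall (W.c k) (10 * W.s k)) :
    complexGrad (W.χ k) x = 0 := by
  have := norm_complexGrad_le (W.χ k) x
  rw [W.fderiv_χ_eq_zero hx, norm_zero, mul_zero] at this
  exact norm_le_zero_iff.1 this

lemma sum_χ {x : E n} (hx : x ∈ Ω) : ∑ k ∈ W.nbr x, W.χ k x = 1 := by
  rw [← W.finsum_χ x hx]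
  refine (finsum_eq_sum_of_support_subset _ fun k hk => ?_).symm
  simp only [Finset.mem_coe, mem_nbr]
  by_contra h
  exact hk (W.χ_eq_zero fun h' => h (W.closedBall_ten_subset_Q k h'))

lemma sum_complexGrad {x : E n} (hx : x ∈ Ω) : ∑ k ∈ W.nbr x, complexGrad (W.χ k) x = 0 := by
  have h : ∑ k ∈ W.nbr x, fderiv ℝ (W.χ k) x = 0 := by
    rw [← W.finsum_fderiv x hx]
    refine (finsum_eq_sum_of_support_subset _ fun k hk => ?_).symm
    simp only [Finset.mem_coe, mem_nbr]
    by_contra h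
    exact hk (W.fderiv_χ_eq_zero fun h' => h (W.closedBall_ten_subset_Q k h'))
  ext j
  have h2 := DFunLike.congr_fun h (EuclideanSpace.single j 1)
  simp only [_root_.sum_apply, zero_apply] at h2
  simp only [complexGrad, WithLp.ofLp_sum, Finset.sum_apply, partialDeriv, PiLp.zero_apply]
  exact_mod_cast h2

lemma norm_complexGrad_χ_le (k : W.ι) (x : E n) : ‖complexGrad (W.χ k) x‖ ≤ n * (Cχ / W.s k) :=
  (norm_complexGrad_le _ _).trans (by gcongr; exact W.norm_fderiv_le k x)

lemma bump_nonneg (k : W.ι) : 0 ≤ Cχ := by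
  have h := (norm_nonneg _).trans (W.norm_fderiv_le k 0)
  by_contra hlt
  exact absurd h (not_le.2 (div_neg_of_neg_of_pos (not_le.1 hlt) (W.s_pos k)))

end WhitneyPartition

/-- Gauges and transported constants which approximate `f` on the cubes of a Whitney covering. -/
structure LocalApproximation (W : WhitneyPartition Ω N κ Cχ) (a : E n → E n) (V : E n → ℝ)
    (f : E n → ℂ) (p α K : ℝ) where
  M : W.ι → ℝ
  gauge : ∀ k, GaugeData (fun m => mollify m a) (cube (W.c k) (40 * W.s k)) (M k)
  z : W.ι → ℂ
  M_nonneg : ∀ k, 0 ≤ M k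
  z_mul_M_le : ∀ k, ‖z k‖ * M k ≤ K * α
  norm_z_le : ∀ k (S : ℝ), (∀ x, ‖f x‖ ≤ S) → ‖z k‖ ≤ S
  lintegral_sub_le : ∀ k, ∫⁻ x in W.Q k, ‖f x - z k * phase (gauge k).φ x‖ₑ ^ p ≤
    ENNReal.ofReal (K * (α * (40 * W.s k)) ^ p) * volume (W.Q k)
  potential_le : ∀ k, ENNReal.ofReal (‖z k‖ ^ 2) * ∫⁻ x in W.Q k, ENNReal.ofReal (V x) ≤
    ENNReal.ofReal (K * α ^ 2) * volume (W.Q k)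

namespace LocalApproximation

variable {W : WhitneyPartition Ω N κ Cχ} {a : E n → E n} {V : E n → ℝ} {f : E n → ℂ} {p α K : ℝ}
  (D : LocalApproximation W a V f p α K)

/-- The transported constant. -/
noncomputable def P (k : W.ι) (x : E n) : ℂ := D.z k * phase (D.gauge k).φ x

lemma norm_P (k : W.ι) (x : E n) : ‖D.P k x‖ = ‖D.z k‖ := by simp [P]

/-- The bad part on the cube `Q k`. -/
noncomputable def bad (k : W.ι) : E n → ℂ := localPart f (D.z k) (D.gauge k).φ (W.χ k)

/-- The magnetic gradient of the bad part. -/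
noncomputable def badGrad (k : W.ι) : E n → EuclideanSpace ℂ (Fin n) :=
  localPartGrad a f (D.z k) (D.gauge k).φ (D.gauge k).h (W.χ k)

/-- The good part. -/
noncomputable def good (x : E n) : ℂ := f x - ∑' k, D.bad k x

/-- The magnetic gradient of the good part. -/
noncomputable def goodGrad (x : E n) : EuclideanSpace ℂ (Fin n) :=
  magGrad a f x - WithLp.toLp 2 fun j => ∑' k, D.badGrad k x j

lemma bad_eq (k : W.ι) (x : E n) : D.bad k x = (f x - D.P k x) * W.χ k x := rfl

lemma badGrad_eq (k : W.ι) (x : E n) : D.badGrad k x =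
    (W.χ k x : ℂ) • (magGrad a f x + D.P k x • complexVec ((D.gauge k).h x)) +
      (1 / Complex.I * (f x - D.P k x)) • complexGrad (W.χ k) x :=
  localPartGrad_eq _ _ _ _ _ _ _

lemma bad_eq_zero {k : W.ι} {x : E n} (hx : x ∉ W.Q k) : D.bad k x = 0 := by
  rw [bad_eq, W.χ_eq_zero fun h => hx (W.closedBall_ten_subset_Q k h)]
  simp

lemma badGrad_eq_zero {k : W.ι} {x : E n} (hx : x ∉ W.Q k) : D.badGrad k x = 0 := by
  have h : x ∉ closedBall (W.c k) (10 * W.s k) := fun h => hx (W.closedBall_ten_subset_Q k h)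
  rw [badGrad_eq, W.χ_eq_zero h, W.complexGrad_χ_eq_zero h]
  simp

lemma isWeakMagGrad_bad (ha : IsL2Loc a) (hf : IsTest f) (k : W.ι) :
    IsWeakMagGrad a (D.bad k) (D.badGrad k) :=
  (D.gauge k).isWeakMagGrad_localPart ha hf (D.z k) (W.contDiff_χ k)
    ((W.support_χ k).trans (W.closedBall_ten_subset_Q k))

lemma hasSum_bad (x : E n) : HasSum (fun k => D.bad k x) (∑ k ∈ W.nbr x, D.bad k x) :=
  hasSum_sum_of_ne_finset_zero fun k hk => D.bad_eq_zero (by simpa using hk)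

lemma good_eq (x : E n) : D.good x = f x - ∑ k ∈ W.nbr x, D.bad k x := by
  rw [good, (D.hasSum_bad x).tsum_eq]

lemma goodGrad_eq (x : E n) : D.goodGrad x = magGrad a f x - ∑ k ∈ W.nbr x, D.badGrad k x := by
  rw [goodGrad]
  congr 1
  ext j
  simp only [WithLp.ofLp_sum, Finset.sum_apply]
  refine (hasSum_sum_of_ne_finset_zero fun k hk => ?_).tsum_eq
  rw [D.badGrad_eq_zero (by simpa using hk)]
  rfl

lemma good_of_notMem {x : E n} (hx : x ∉ Ω) : D.good x = f x := by
  rw [good_eq, Finset.sum_eq_zero, sub_zero]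
  intro k hk
  exact absurd (W.cube_subset k (W.mem_nbr.1 hk)) hx

lemma goodGrad_of_notMem {x : E n} (hx : x ∉ Ω) : D.goodGrad x = magGrad a f x := by
  rw [goodGrad_eq, Finset.sum_eq_zero, sub_zero]
  intro k hk
  exact absurd (W.cube_subset k (W.mem_nbr.1 hk)) hx

/-- The cut-offs add up to 1, so `f` cancels. -/
lemma good_of_mem {x : E n} (hx : x ∈ Ω) : D.good x = ∑ k ∈ W.nbr x, W.χ k x * D.P k x := by
  have h : (∑ k ∈ W.nbr x, (W.χ k x : ℂ)) = 1 := by exact_mod_cast W.sum_χ hx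
  have h2 : ∑ k ∈ W.nbr x, D.bad k x =
      f x * ∑ k ∈ W.nbr x, (W.χ k x : ℂ) - ∑ k ∈ W.nbr x, W.χ k x * D.P k x := by
    rw [Finset.mul_sum, ← Finset.sum_sub_distrib]
    refine Finset.sum_congr rfl fun k _ => ?_
    rw [bad_eq]; ring
  rw [good_eq, h2, h]; ring

/-- With `∑ χ = 1` the gradient of `f` cancels, and with `∑ ∇χ = 0` the function `f` in front of
`∇χ` may be replaced by `P l`. Only differences of neighbouring transported constants remain. -/
lemma goodGrad_of_mem {x : E n} (hx : x ∈ Ω) (l : W.ι) : D.goodGrad x =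
    -∑ k ∈ W.nbr x, (W.χ k x * D.P k x) • complexVec ((D.gauge k).h x) +
      ∑ k ∈ W.nbr x, (1 / Complex.I * (D.P k x - D.P l x)) • complexGrad (W.χ k) x := by
  have h : (∑ k ∈ W.nbr x, (W.χ k x : ℂ)) = 1 := by exact_mod_cast W.sum_χ hx
  have h1 : ∑ k ∈ W.nbr x, D.badGrad k x =
      (∑ k ∈ W.nbr x, (W.χ k x : ℂ)) • magGrad a f x +
      ∑ k ∈ W.nbr x, (W.χ k x * D.P k x) • complexVec ((D.gauge k).h x) +
      (1 / Complex.I * (f x - D.P l x)) • ∑ k ∈ W.nbr x, complexGrad (W.χ k) x -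
      ∑ k ∈ W.nbr x, (1 / Complex.I * (D.P k x - D.P l x)) • complexGrad (W.χ k) x := by
    rw [Finset.sum_smul, Finset.smul_sum, ← Finset.sum_add_distrib, ← Finset.sum_add_distrib,
      ← Finset.sum_sub_distrib]
    refine Finset.sum_congr rfl fun k _ => ?_
    rw [badGrad_eq]
    module
  rw [goodGrad_eq, h1, h, W.sum_complexGrad hx]
  module

/-- A bound depending on the supremum of `f`. It enters no constant of the theorem; it only
justifies summing the weak equations. -/
lemma tsum_enorm_bad_le {S : ℝ} (hS : ∀ x, ‖f x‖ ≤ S) (x : E n) :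
    ∑' k, ‖D.bad k x‖ₑ ≤ ENNReal.ofReal (N * (2 * S)) := by
  have hS0 : 0 ≤ S := (norm_nonneg _).trans (hS x)
  rw [tsum_eq_sum (s := W.nbr x) fun k hk => by
    rw [D.bad_eq_zero (by simpa using hk), enorm_zero]]
  calc ∑ k ∈ W.nbr x, ‖D.bad k x‖ₑ ≤ ∑ _k ∈ W.nbr x, ENNReal.ofReal (2 * S) := by
        refine Finset.sum_le_sum fun k _ => ?_
        rw [← ofReal_norm, bad_eq, norm_mul, Complex.norm_real,
          Real.norm_of_nonneg (W.χ_nonneg k x)]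
        apply ENNReal.ofReal_le_ofReal
        have h1 : ‖f x - D.P k x‖ ≤ 2 * S := by
          refine (norm_sub_le _ _).trans ?_
          rw [norm_P]
          linarith [hS x, D.norm_z_le k S hS]
        exact (mul_le_of_le_one_right (norm_nonneg _) (W.χ_le_one k x)).trans h1
    _ = (W.nbr x).card * ENNReal.ofReal (2 * S) := by simp
    _ ≤ N * ENNReal.ofReal (2 * S) := by
        gcongr
        exact_mod_cast W.card_nbr_le x
    _ = _ := by rw [ENNReal.ofReal_mul (p := (N : ℝ)) N.cast_nonneg, ENNReal.ofReal_natCast]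

lemma ae_norm_badGrad_le (k : W.ι) : ∀ᵐ x, ‖D.badGrad k x‖ ≤
    ‖magGrad a f x‖ + K * α + n * (Cχ / W.s k) * ‖f x - D.P k x‖ := by
  filter_upwards [(D.gauge k).norm_h_le] with x hx
  refine (norm_localPartGrad_le a f _ _ _ (W.χ_nonneg k x) (W.χ_le_one k x)).trans ?_
  have h1 : ‖D.z k‖ * ‖(D.gauge k).h x‖ ≤ K * α :=
    le_trans (by gcongr) (D.z_mul_M_le k)
  have h2 : (n : ℝ) * ‖fderiv ℝ (W.χ k) x‖ * ‖f x - D.P k x‖ ≤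
      n * (Cχ / W.s k) * ‖f x - D.P k x‖ := by
    gcongr
    exact W.norm_fderiv_le k x
  exact add_le_add (add_le_add le_rfl h1) h2

end LocalApproximation

end Assembly

end MagneticCZ

namespace MagneticCZ

open Filter Topology Set Metric

/-! ### Estimates for the bad parts and pointwise bounds for the good part. -/

section Estimates

variable {n : ℕ} {Ω : Set (E n)} {N : ℕ} {κ Cχ : ℝ}

lemma rpow_add_add_le {p : ℝ} (hp : 1 ≤ p) (hp2 : p ≤ 2) (x y z : ℝ≥0∞) :
    (x + y + z) ^ p ≤ 4 * (x ^ p + y ^ p + z ^ p) := by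
  have h2 : (2 : ℝ≥0∞) ^ (p - 1) ≤ 2 := by
    conv_rhs => rw [← ENNReal.rpow_one 2]
    exact ENNReal.rpow_le_rpow_of_exponent_le (by norm_num) (by linarith)
  calc (x + y + z) ^ p ≤ 2 ^ (p - 1) * ((x + y) ^ p + z ^ p) :=
        ENNReal.rpow_add_le_mul_rpow_add_rpow _ _ hp
    _ ≤ 2 ^ (p - 1) * (2 ^ (p - 1) * (x ^ p + y ^ p) + z ^ p) := by
        gcongr
        exact ENNReal.rpow_add_le_mul_rpow_add_rpow _ _ hp
    _ ≤ 2 * (2 * (x ^ p + y ^ p) + 2 * z ^ p) := by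
        gcongr
        exact le_mul_of_one_le_left zero_le (by norm_num)
    _ = _ := by ring

/-- The constant in the estimate of the bad parts. -/
noncomputable def badConst (n : ℕ) (p K κ Cχ : ℝ) : ℝ :=
  4 * (κ + K ^ p + (40 * n * Cχ) ^ p * K) + K

/-- The constant in the comparison of neighbouring transported constants. -/
noncomputable def pairConst (n : ℕ) (p K : ℝ) : ℝ :=
  2 * K * n * 8 + (2 ^ p * K * 8 ^ p * (n * 8 / 2) ^ n) ^ (1 / p)

namespace LocalApproximation

variable {W : WhitneyPartition Ω N κ Cχ} {a : E n → E n} {V : E n → ℝ} {f : E n → ℂ} {p α K : ℝ}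
  (D : LocalApproximation W a V f p α K)

/-- The derivative of the cut-off costs `1 / s`, while `f - P` is of size `α s` in mean, so this
term too is of order `α`. -/
lemma lintegral_badGrad_le (hp : 1 ≤ p) (hp2 : p ≤ 2) (hα : 0 < α) (hK : 0 < K) (hf : Continuous f)
    {κ' : ℝ} (hκ' : 0 ≤ κ') (k : W.ι)
    (hw : ∫⁻ x in W.Q k, energyDensity a V p f x ≤ ENNReal.ofReal (κ' * α ^ p) * volume (W.Q k)) :
    ∫⁻ x in W.Q k, (‖D.badGrad k x‖ₑ ^ p +
      ENNReal.ofReal ((40 * W.s k) ^ (-p)) * ‖D.bad k x‖ₑ ^ p) ≤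
      ENNReal.ofReal (badConst n p K κ' Cχ * α ^ p) * volume (W.Q k) := by
  have hp0 : 0 < p := by linarith
  have hs := W.s_pos k
  have hC := W.bump_nonneg k
  set u : E n → ℝ≥0∞ := fun x => ‖f x - D.P k x‖ₑ ^ p with hu
  have hum : AEMeasurable u (volume.restrict (W.Q k)) := by
    refine (AEStronglyMeasurable.enorm ?_).pow_const p
    exact hf.aestronglyMeasurable.sub ((aestronglyMeasurable_phase
      (D.gauge k).aestronglyMeasurable_φ.restrict).const_mul (D.z k))
  have hui : ∫⁻ x in W.Q k, u x ≤
      ENNReal.ofReal (K * (α * (40 * W.s k)) ^ p) * volume (W.Q k) := D.lintegral_sub_le k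
  have hpt : ∀ᵐ x ∂(volume.restrict (W.Q k)), ‖D.badGrad k x‖ₑ ^ p +
      ENNReal.ofReal ((40 * W.s k) ^ (-p)) * ‖D.bad k x‖ₑ ^ p ≤
      4 * (energyDensity a V p f x + ENNReal.ofReal ((K * α) ^ p) +
        ENNReal.ofReal ((n * (Cχ / W.s k)) ^ p) * u x) +
      ENNReal.ofReal ((40 * W.s k) ^ (-p)) * u x := by
    filter_upwards [ae_restrict_of_ae (D.ae_norm_badGrad_le k)] with x hx
    have h1 : ‖D.badGrad k x‖ₑ ≤ ‖magGrad a f x‖ₑ + ENNReal.ofReal (K * α) +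
        ENNReal.ofReal (n * (Cχ / W.s k)) * ‖f x - D.P k x‖ₑ := by
      rw [← ofReal_norm, ← ofReal_norm, ← ofReal_norm, ← ENNReal.ofReal_mul (by positivity),
        ← ENNReal.ofReal_add (by positivity) (by positivity),
        ← ENNReal.ofReal_add (by positivity) (by positivity)]
      exact ENNReal.ofReal_le_ofReal hx
    have h2 : ‖D.bad k x‖ₑ ≤ ‖f x - D.P k x‖ₑ := by
      rw [← ofReal_norm, ← ofReal_norm, bad_eq, norm_mul, Complex.norm_real,
        Real.norm_of_nonneg (W.χ_nonneg k x)]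
      exact ENNReal.ofReal_le_ofReal
        (mul_le_of_le_one_right (norm_nonneg _) (W.χ_le_one k x))
    refine add_le_add ?_ (by simp only [hu]; gcongr)
    calc ‖D.badGrad k x‖ₑ ^ p ≤ _ := ENNReal.rpow_le_rpow h1 hp0.le
      _ ≤ _ := rpow_add_add_le hp hp2 _ _ _
      _ ≤ _ := by
          rw [ENNReal.mul_rpow_of_nonneg _ _ hp0.le,
            ENNReal.ofReal_rpow_of_nonneg (by positivity) hp0.le,
            ENNReal.ofReal_rpow_of_nonneg (by positivity) hp0.le]
          gcongr
          exact le_self_add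
  refine (lintegral_mono_ae hpt).trans ?_
  have hm1 : AEMeasurable (fun x => ENNReal.ofReal ((40 * W.s k) ^ (-p)) * u x)
      (volume.restrict (W.Q k)) := hum.const_mul _
  have hm2 : AEMeasurable (fun x => ENNReal.ofReal ((n * (Cχ / W.s k)) ^ p) * u x)
      (volume.restrict (W.Q k)) := hum.const_mul _
  rw [lintegral_add_right' _ hm1, lintegral_const_mul' _ _ (by simp), lintegral_add_right' _ hm2,
    lintegral_add_right _ measurable_const, lintegral_const_mul' _ _ ENNReal.ofReal_ne_top,
    lintegral_const_mul' _ _ ENNReal.ofReal_ne_top, setLIntegral_const]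
  calc _ ≤ 4 * (ENNReal.ofReal (κ' * α ^ p) * volume (W.Q k) +
        ENNReal.ofReal ((K * α) ^ p) * volume (W.Q k) +
        ENNReal.ofReal ((n * (Cχ / W.s k)) ^ p) *
          (ENNReal.ofReal (K * (α * (40 * W.s k)) ^ p) * volume (W.Q k))) +
        ENNReal.ofReal ((40 * W.s k) ^ (-p)) *
          (ENNReal.ofReal (K * (α * (40 * W.s k)) ^ p) * volume (W.Q k)) := by gcongr
    _ = _ := by
        have h4 : (4 : ℝ≥0∞) = ENNReal.ofReal 4 := by simp
        have hmul : ∀ (x y : ℝ) (v : ℝ≥0∞), 0 ≤ x →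
            ENNReal.ofReal x * (ENNReal.ofReal y * v) = ENNReal.ofReal (x * y) * v := by
          intro x y v hx
          rw [ENNReal.ofReal_mul hx, mul_assoc]
        have e1 : (n * (Cχ / W.s k)) ^ p * (K * (α * (40 * W.s k)) ^ p) =
            (40 * n * Cχ) ^ p * K * α ^ p := by
          rw [mul_left_comm, ← Real.mul_rpow (by positivity) (by positivity),
            show n * (Cχ / W.s k) * (α * (40 * W.s k)) = (40 * n * Cχ) * α by field_simp,
            Real.mul_rpow (by positivity) hα.le]
          ring
        have e2 : (40 * W.s k) ^ (-p) * (K * (α * (40 * W.s k)) ^ p) = K * α ^ p := by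
          rw [Real.mul_rpow hα.le (by positivity), Real.rpow_neg (by positivity)]
          have : (40 * W.s k) ^ p ≠ 0 := (Real.rpow_pos_of_pos (by positivity) p).ne'
          field_simp
        rw [hmul _ _ _ (by positivity), hmul _ _ _ (by positivity), e1, e2, ← add_mul, ← add_mul,
          ← ENNReal.ofReal_add (by positivity) (by positivity),
          ← ENNReal.ofReal_add (by positivity) (by positivity), h4, hmul _ _ _ (by norm_num),
          ← add_mul, ← ENNReal.ofReal_add (by positivity) (by positivity),
          Real.mul_rpow hK.le hα.le, badConst]
        congr 2
        ring

/-- The elementary bound `t ≤ 1 + t ^ p`, together with the finite total volume of the cubes, gives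
the absolute convergence needed for summing weak gradients. -/
lemma tsum_lintegral_badGrad_ne_top (hp : 1 ≤ p) {C : ℝ}
    (hfin : ∑' k, volume (W.Q k) ≠ ⊤)
    (h : ∀ k, ∫⁻ x in W.Q k, (‖D.badGrad k x‖ₑ ^ p +
      ENNReal.ofReal ((40 * W.s k) ^ (-p)) * ‖D.bad k x‖ₑ ^ p) ≤
      ENNReal.ofReal C * volume (W.Q k)) :
    ∑' k, ∫⁻ x, ‖D.badGrad k x‖ₑ ≠ ⊤ := by
  refine ne_top_of_le_ne_top (b := ∑' k, (1 + ENNReal.ofReal C) * volume (W.Q k)) ?_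
    (ENNReal.tsum_le_tsum fun k => ?_)
  · rw [ENNReal.tsum_mul_left]
    exact ENNReal.mul_ne_top (by simp) hfin
  · have hsupp : Function.support (fun x => ‖D.badGrad k x‖ₑ) ⊆ W.Q k := fun x hx => by
      by_contra hn
      exact hx (by simp [D.badGrad_eq_zero hn])
    rw [← setLIntegral_eq_of_support_subset hsupp]
    calc ∫⁻ x in W.Q k, ‖D.badGrad k x‖ₑ ≤ ∫⁻ x in W.Q k, (1 + (‖D.badGrad k x‖ₑ ^ p +
          ENNReal.ofReal ((40 * W.s k) ^ (-p)) * ‖D.bad k x‖ₑ ^ p)) := by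
          refine lintegral_mono fun x => (le_one_add_rpow hp _).trans ?_
          gcongr
          exact le_self_add
      _ = volume (W.Q k) + ∫⁻ x in W.Q k, (‖D.badGrad k x‖ₑ ^ p +
          ENNReal.ofReal ((40 * W.s k) ^ (-p)) * ‖D.bad k x‖ₑ ^ p) := by
          rw [lintegral_add_left measurable_const, setLIntegral_const, one_mul]
      _ ≤ volume (W.Q k) + ENNReal.ofReal C * volume (W.Q k) := by gcongr; exact h k
      _ = _ := by ring

lemma isWeakMagGrad_good (ha : IsL2Loc a) (hf : IsTest f)
    (h : ∑' k, ∫⁻ x, ‖D.badGrad k x‖ₑ ≠ ⊤) : IsWeakMagGrad a D.good D.goodGrad := by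
  have := W.countable
  obtain ⟨S, hS⟩ := hf.1.continuous.bounded_above_of_compact_support hf.2
  exact (ha.isWeakMagGrad_magGrad hf).sub_tsum ha (D.isWeakMagGrad_bad ha hf)
    (D.tsum_enorm_bad_le hS) h

lemma ae_norm_P_sub_le (hn : 0 < n) (hp : 1 ≤ p) (hα : 0 < α) (hK : 0 < K) (hf : Continuous f) :
    ∀ᵐ x, ∀ k l, x ∈ closedBall (W.c k) (10 * W.s k) → x ∈ closedBall (W.c l) (10 * W.s l) →
      ‖D.P k x - D.P l x‖ ≤ pairConst n p K * (α * (10 * W.s k)) := by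
  have := W.countable
  rw [ae_all_iff]
  intro k
  rw [ae_all_iff]
  intro l
  by_cases hne : (closedBall (W.c k) (10 * W.s k) ∩ closedBall (W.c l) (10 * W.s l)).Nonempty
  · obtain ⟨x₀, hk, hl⟩ := hne
    have hsk := W.s_pos k
    have hsl := W.s_pos l
    have hkl := W.s_le x₀ k l (W.closedBall_ten_subset_Q k hk) (W.closedBall_ten_subset_Q l hl)
    have hlk := W.s_le x₀ l k (W.closedBall_ten_subset_Q l hl) (W.closedBall_ten_subset_Q k hk)
    -- A ball of this radius about a common point of the two support balls fits into both cubes.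
    -- Sides of meeting cubes differ by at most a factor 2, so each side `40 s` is at most `8 ρ`.
    set ρ := 10 * min (W.s k) (W.s l) with hρ
    have hρ0 : 0 < ρ := by positivity
    have hmin : ∀ t, t ≤ 2 * W.s k → t ≤ 2 * W.s l → 40 * t ≤ 8 * ρ := by
      intro t h1 h2
      rw [hρ]
      rcases min_choice (W.s k) (W.s l) with h | h <;> rw [h] <;> linarith
    have hball : closedBall x₀ ρ ⊆ cube (W.c k) (40 * W.s k) ∩ cube (W.c l) (40 * W.s l) := by
      refine subset_inter (Subset.trans ?_ (W.closedBall_subset_Q k))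
        (Subset.trans ?_ (W.closedBall_subset_Q l))
      · apply closedBall_subset_closedBall'
        rw [mem_closedBall] at hk
        have : ρ ≤ 10 * W.s k := by rw [hρ]; gcongr; exact min_le_left _ _
        linarith
      · apply closedBall_subset_closedBall'
        rw [mem_closedBall] at hl
        have : ρ ≤ 10 * W.s l := by rw [hρ]; gcongr; exact min_le_right _ _
        linarith
    have key := norm_phase_sub_phase_le_of_ball (Λ := 8) hn hp hρ0 (by positivity) (by positivity)
      (hmin _ (by linarith) hkl) (hmin _ hlk (by linarith)) hK hα (D.M_nonneg k) (D.M_nonneg l)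
      hball (D.gauge k) (D.gauge l) (D.z_mul_M_le k) (D.z_mul_M_le l) hf (D.lintegral_sub_le k)
      (D.lintegral_sub_le l)
    rw [ae_restrict_iff' ((measurableSet_cube _ _).inter (measurableSet_cube _ _))] at key
    filter_upwards [key] with x hx hxk hxl
    refine (hx ⟨W.closedBall_ten_subset_Q k hxk, W.closedBall_ten_subset_Q l hxl⟩).trans ?_
    have hρk : ρ ≤ 10 * W.s k := by rw [hρ]; gcongr; exact min_le_left _ _
    rw [pairConst]
    gcongr
  · refine Eventually.of_forall fun x hk hl => absurd ⟨x, hk, hl⟩ hne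

lemma ae_norm_goodGrad_le (hn : 0 < n) (hp : 1 ≤ p) (hα : 0 < α) (hK : 0 < K)
    (hf : Continuous f) :
    ∀ᵐ x, x ∈ Ω → ‖D.goodGrad x‖ ≤ (K + N * (10 * n * Cχ * pairConst n p K)) * α := by
  have := W.countable
  have hh : ∀ᵐ x, ∀ k, ‖(D.gauge k).h x‖ ≤ D.M k := by
    rw [ae_all_iff]
    exact fun k => (D.gauge k).norm_h_le
  have hpc : 0 ≤ pairConst n p K := by unfold pairConst; positivity
  filter_upwards [hh, D.ae_norm_P_sub_le hn hp hα hK hf] with x hx hpair hxΩ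
  have hsum := W.sum_χ hxΩ
  -- The reference index must have `x` in its own support ball, so that `P l` can be compared with
  -- every other active constant at `x`.
  obtain ⟨l, hl⟩ : ∃ l, W.χ l x ≠ 0 := by
    by_contra hall
    push Not at hall
    rw [Finset.sum_eq_zero fun k _ => hall k] at hsum
    exact zero_ne_one hsum
  have hlb : x ∈ closedBall (W.c l) (10 * W.s l) := W.support_χ l hl
  have hC := W.bump_nonneg l
  rw [D.goodGrad_of_mem hxΩ l]
  refine (norm_add_le _ _).trans ?_
  rw [norm_neg, add_mul]
  refine add_le_add ?_ ?_
  · calc _ ≤ ∑ k ∈ W.nbr x, W.χ k x * (K * α) := by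
          refine norm_sum_le_of_le _ fun k _ => ?_
          rw [norm_smul, norm_mul, Complex.norm_real, Real.norm_of_nonneg (W.χ_nonneg k x), norm_P,
            norm_complexVec, mul_assoc]
          refine mul_le_mul_of_nonneg_left ?_ (W.χ_nonneg k x)
          exact le_trans (by gcongr; exact hx k) (D.z_mul_M_le k)
      _ = K * α := by rw [← Finset.sum_mul, hsum, one_mul]
  · calc _ ≤ ∑ _k ∈ W.nbr x, 10 * n * Cχ * pairConst n p K * α := by
          refine norm_sum_le_of_le _ fun k _ => ?_
          have hs := W.s_pos k
          by_cases hk : x ∈ closedBall (W.c k) (10 * W.s k)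
          · rw [norm_smul, norm_mul, norm_div, norm_one, Complex.norm_I, div_one, one_mul]
            calc _ ≤ pairConst n p K * (α * (10 * W.s k)) * (n * (Cχ / W.s k)) := by
                  gcongr
                  · exact hpair k l hk hlb
                  · exact W.norm_complexGrad_χ_le k x
              _ = _ := by field_simp
          · rw [W.complexGrad_χ_eq_zero hk, smul_zero, norm_zero]
            positivity
      _ = (W.nbr x).card * (10 * n * Cχ * pairConst n p K * α) := by simp
      _ ≤ N * (10 * n * Cχ * pairConst n p K * α) := by
          gcongr
          exact_mod_cast W.card_nbr_le x
      _ = _ := by ring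

/-- Convexity of the square, the `χ k x` being weights of sum 1. Bounding by the constants `‖z k‖`
on whole cubes prepares for the integral of `V`. -/
lemma enorm_good_sq_le {x : E n} (hx : x ∈ Ω) :
    ‖D.good x‖ₑ ^ 2 ≤ ∑' k, (W.Q k).indicator (fun _ => ENNReal.ofReal (‖D.z k‖ ^ 2)) x := by
  have h1 : ‖D.good x‖ ≤ ∑ k ∈ W.nbr x, W.χ k x * ‖D.z k‖ := by
    rw [D.good_of_mem hx]
    refine norm_sum_le_of_le _ fun k _ => ?_
    rw [norm_mul, Complex.norm_real, Real.norm_of_nonneg (W.χ_nonneg k x), norm_P]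
  have h2 : ‖D.good x‖ ^ 2 ≤ ∑ k ∈ W.nbr x, ‖D.z k‖ ^ 2 := by
    calc ‖D.good x‖ ^ 2 ≤ (∑ k ∈ W.nbr x, W.χ k x * ‖D.z k‖) ^ 2 := by gcongr
      _ ≤ ∑ k ∈ W.nbr x, W.χ k x * ‖D.z k‖ ^ 2 :=
          Real.pow_arith_mean_le_arith_mean_pow _ _ _ (fun k _ => W.χ_nonneg k x) (W.sum_χ hx)
            (fun k _ => norm_nonneg _) 2
      _ ≤ _ := Finset.sum_le_sum fun k _ =>
          mul_le_of_le_one_left (by positivity) (W.χ_le_one k x)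
  rw [tsum_eq_sum (s := W.nbr x) fun k hk => by
    rw [indicator_of_notMem (by simpa using hk)]]
  calc ‖D.good x‖ₑ ^ 2 = ENNReal.ofReal (‖D.good x‖ ^ 2) := by
        rw [ENNReal.ofReal_pow (norm_nonneg _), ofReal_norm]
    _ ≤ ENNReal.ofReal (∑ k ∈ W.nbr x, ‖D.z k‖ ^ 2) := ENNReal.ofReal_le_ofReal h2
    _ = ∑ k ∈ W.nbr x, ENNReal.ofReal (‖D.z k‖ ^ 2) :=
        ENNReal.ofReal_sum_of_nonneg fun k _ => by positivity
    _ = _ := Finset.sum_congr rfl fun k hk => by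
        rw [indicator_of_mem (W.mem_nbr.1 hk)]

/-- The potential energy of the good part on `Ω`. -/
lemma lintegral_good_le (hΩ : MeasurableSet Ω) (hV : LocallyIntegrable V) :
    ∫⁻ x in Ω, ‖sqrtMul V D.good x‖ₑ ^ 2 ≤
      ENNReal.ofReal (K * α ^ 2) * ∑' k, volume (W.Q k) := by
  have := W.countable
  have hVm : AEMeasurable (fun x => ENNReal.ofReal (V x)) volume :=
    hV.aestronglyMeasurable.aemeasurable.ennreal_ofReal
  calc ∫⁻ x in Ω, ‖sqrtMul V D.good x‖ₑ ^ 2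
      ≤ ∫⁻ x, ∑' k, (W.Q k).indicator
        (fun x => ENNReal.ofReal (‖D.z k‖ ^ 2) * ENNReal.ofReal (V x)) x := by
        refine (setLIntegral_mono' hΩ fun x hx => ?_).trans (setLIntegral_le_lintegral Ω _)
        rw [enorm_sqrtMul_sq]
        calc ENNReal.ofReal (V x) * ‖D.good x‖ₑ ^ 2 ≤ ENNReal.ofReal (V x) *
              ∑' k, (W.Q k).indicator (fun _ => ENNReal.ofReal (‖D.z k‖ ^ 2)) x := by
              gcongr; exact D.enorm_good_sq_le hx
          _ = _ := by
              rw [← ENNReal.tsum_mul_left]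
              refine tsum_congr fun k => ?_
              by_cases hk : x ∈ W.Q k <;> simp [hk, mul_comm]
    _ = ∑' k, ∫⁻ x in W.Q k, ENNReal.ofReal (‖D.z k‖ ^ 2) * ENNReal.ofReal (V x) := by
        rw [lintegral_tsum fun k => (hVm.const_mul _).indicator (W.measurableSet_Q k)]
        exact tsum_congr fun k => lintegral_indicator (W.measurableSet_Q k) _
    _ ≤ ∑' k, ENNReal.ofReal (K * α ^ 2) * volume (W.Q k) := by
        refine ENNReal.tsum_le_tsum fun k => ?_
        rw [lintegral_const_mul' _ _ ENNReal.ofReal_ne_top]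
        exact D.potential_le k
    _ = _ := ENNReal.tsum_mul_left

end LocalApproximation

end Estimates

end MagneticCZ

namespace MagneticCZ

open Filter Topology Set Metric

/-! ### L² bounds for the good part. -/

section Energy

variable {n : ℕ} {p α : ℝ}

lemma le_ofReal_of_rpow_le (hp : 0 < p) (hα : 0 ≤ α) {x : ℝ≥0∞}
    (h : x ^ p ≤ ENNReal.ofReal (α ^ p)) : x ≤ ENNReal.ofReal α := by
  rw [← ENNReal.ofReal_rpow_of_nonneg hα hp.le] at h
  exact (ENNReal.rpow_le_rpow_iff hp).1 h

/-- This is the interpolation between the supremum bound `α` and the exponent `p`; it supplies the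
factor `α ^ (2 - p)` outside `Ω`. -/
lemma sq_le_mul_rpow (hp : 0 < p) (hp2 : p ≤ 2) (hα : 0 ≤ α) {x : ℝ≥0∞}
    (h : x ^ p ≤ ENNReal.ofReal (α ^ p)) : x ^ 2 ≤ ENNReal.ofReal (α ^ (2 - p)) * x ^ p := by
  have hx := le_ofReal_of_rpow_le hp hα h
  calc x ^ 2 = x ^ (2 - p) * x ^ p := by
        rw [← ENNReal.rpow_add_of_nonneg _ _ (by linarith) hp.le, sub_add_cancel]
        norm_cast
    _ ≤ _ := by
        rw [← ENNReal.ofReal_rpow_of_nonneg hα (by linarith)]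
        gcongr

lemma lintegral_rpow_add_le {f : E n → EuclideanSpace ℂ (Fin n)} {g : E n → ℂ} (hp : 1 ≤ p)
    (hg : AEStronglyMeasurable g volume) :
    ∫⁻ x, (‖f x‖ₑ ^ p + ‖g x‖ₑ ^ p) ≤
      2 * (eLpNorm f (ENNReal.ofReal p) volume + eLpNorm g (ENNReal.ofReal p) volume) ^ p := by
  have hp0 : 0 < p := by linarith
  have hpow : ∀ (F : Type) [NormedAddCommGroup F] (u : E n → F),
      eLpNorm u (ENNReal.ofReal p) volume ^ p = ∫⁻ x, ‖u x‖ₑ ^ p := by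
    intro F _ u
    rw [eLpNorm_eq_lintegral_rpow_enorm_toReal (by simpa using hp0) ENNReal.ofReal_ne_top,
      ENNReal.toReal_ofReal hp0.le, ← ENNReal.rpow_mul, one_div_mul_cancel hp0.ne',
      ENNReal.rpow_one]
  rw [lintegral_add_right' _ (hg.enorm.pow_const p), ← hpow, ← hpow, two_mul]
  gcongr
  · exact le_self_add
  · exact le_add_self

lemma eLpNorm_two_le {F : Type*} [NormedAddCommGroup F] {u : E n → F} {C : ℝ} (hC : 0 ≤ C)
    (hα : 0 < α) {I J : ℝ≥0∞}
    (hu : ∫⁻ x, ‖u x‖ₑ ^ 2 ≤ ENNReal.ofReal (C * α ^ (2 - p)) * I) (hI : I ≤ 2 * J ^ p) :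
    eLpNorm u 2 volume ≤ ENNReal.ofReal (Real.sqrt (2 * C) * α ^ (1 - p / 2)) * J ^ (p / 2) := by
  rw [eLpNorm_eq_lintegral_rpow_enorm_toReal (by simp) (by simp)]
  simp only [ENNReal.toReal_ofNat]
  have h1 : ∫⁻ x, ‖u x‖ₑ ^ (2 : ℝ) ≤ ENNReal.ofReal (2 * C * α ^ (2 - p)) * J ^ p := by
    calc ∫⁻ x, ‖u x‖ₑ ^ (2 : ℝ) = ∫⁻ x, ‖u x‖ₑ ^ 2 := by norm_cast
      _ ≤ ENNReal.ofReal (C * α ^ (2 - p)) * (2 * J ^ p) := hu.trans (by gcongr)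
      _ = _ := by
          rw [show 2 * C * α ^ (2 - p) = (C * α ^ (2 - p)) * 2 by ring,
            ENNReal.ofReal_mul (p := C * α ^ (2 - p)) (by positivity), ENNReal.ofReal_ofNat,
            mul_assoc]
  calc (∫⁻ x, ‖u x‖ₑ ^ (2 : ℝ)) ^ (1 / 2 : ℝ)
      ≤ (ENNReal.ofReal (2 * C * α ^ (2 - p)) * J ^ p) ^ (1 / 2 : ℝ) := by gcongr
    _ = _ := by
        rw [ENNReal.mul_rpow_of_nonneg _ _ (by norm_num), ← ENNReal.rpow_mul,
          ENNReal.ofReal_rpow_of_nonneg (by positivity) (by norm_num),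
          Real.mul_rpow (by positivity) (by positivity), ← Real.sqrt_eq_rpow, ← Real.rpow_mul hα.le]
        congr 3 <;> ring_nf

variable {Ω : Set (E n)} {N : ℕ} {κ Cχ K : ℝ}
  {W : WhitneyPartition Ω N κ Cχ} {a : E n → E n} {V : E n → ℝ} {f : E n → ℂ}

namespace LocalApproximation

variable (D : LocalApproximation W a V f p α K)

/-- Inside `Ω` the supremum bound is combined with the weak type estimate for the volume; outside,
the good part is `f` and its energy density is at most `α ^ p`. -/
lemma lintegral_goodGrad_sq_le (hΩ : MeasurableSet Ω) (hp : 1 ≤ p) (hp2 : p ≤ 2) (hα : 0 < α)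
    {C : ℝ} (hout : ∀ᵐ x, x ∉ Ω → energyDensity a V p f x ≤ ENNReal.ofReal (α ^ p))
    (hin : ∀ᵐ x, x ∈ Ω → ‖D.goodGrad x‖ ≤ C * α)
    (hvol : volume Ω ≤
      ENNReal.ofReal (5 ^ n * (α ^ p)⁻¹) * ∫⁻ x, energyDensity a V p f x) :
    ∫⁻ x, ‖D.goodGrad x‖ₑ ^ 2 ≤ ENNReal.ofReal ((1 + C ^ 2 * 5 ^ n) * α ^ (2 - p)) *
      ∫⁻ x, energyDensity a V p f x := by
  have hp0 : 0 < p := by linarith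
  have h1 : ∫⁻ x in Ω, ‖D.goodGrad x‖ₑ ^ 2 ≤ ENNReal.ofReal ((C * α) ^ 2) * volume Ω := by
    rw [← setLIntegral_const]
    refine lintegral_mono_ae ?_
    rw [ae_restrict_iff' hΩ]
    filter_upwards [hin] with x hx hxΩ
    rw [← ofReal_norm, ← ENNReal.ofReal_pow (norm_nonneg _)]
    exact ENNReal.ofReal_le_ofReal (by gcongr; exact hx hxΩ)
  have h2 : ∫⁻ x in Ωᶜ, ‖D.goodGrad x‖ₑ ^ 2 ≤
      ENNReal.ofReal (α ^ (2 - p)) * ∫⁻ x, energyDensity a V p f x := by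
    rw [← lintegral_const_mul' _ _ ENNReal.ofReal_ne_top]
    refine le_trans (lintegral_mono_ae ?_) (setLIntegral_le_lintegral Ωᶜ _)
    rw [ae_restrict_iff' hΩ.compl]
    filter_upwards [hout] with x hx hxΩ
    rw [D.goodGrad_of_notMem hxΩ]
    refine (sq_le_mul_rpow hp0 hp2 hα.le (le_self_add.trans (hx hxΩ))).trans ?_
    gcongr
    exact le_self_add
  rw [← lintegral_add_compl _ hΩ]
  calc _ ≤ ENNReal.ofReal ((C * α) ^ 2) *
        (ENNReal.ofReal (5 ^ n * (α ^ p)⁻¹) * ∫⁻ x, energyDensity a V p f x) +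
        ENNReal.ofReal (α ^ (2 - p)) * ∫⁻ x, energyDensity a V p f x :=
        add_le_add (h1.trans (by gcongr)) h2
    _ = _ := by
        rw [← mul_assoc, ← ENNReal.ofReal_mul (by positivity), ← add_mul,
          ← ENNReal.ofReal_add (by positivity) (by positivity)]
        congr 2
        rw [Real.rpow_sub hα, Real.rpow_two]
        field_simp
        ring

/-- Inside `Ω` there is no pointwise bound for `V`, so the potential energy is summed cube by cube;
outside, the density bound is used again. -/
lemma lintegral_sqrtMul_good_sq_le (hΩ : MeasurableSet Ω) (hp : 1 ≤ p) (hp2 : p ≤ 2) (hα : 0 < α)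
    (hK : 0 < K) (hκ : 0 ≤ κ) (hV : LocallyIntegrable V)
    (hout : ∀ᵐ x, x ∉ Ω → energyDensity a V p f x ≤ ENNReal.ofReal (α ^ p))
    (hvol : ∑' k, volume (W.Q k) ≤
      ENNReal.ofReal (κ * 5 ^ n * (α ^ p)⁻¹) * ∫⁻ x, energyDensity a V p f x) :
    ∫⁻ x, ‖sqrtMul V D.good x‖ₑ ^ 2 ≤ ENNReal.ofReal ((1 + K * (κ * 5 ^ n)) * α ^ (2 - p)) *
      ∫⁻ x, energyDensity a V p f x := by
  have hp0 : 0 < p := by linarith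
  have h2 : ∫⁻ x in Ωᶜ, ‖sqrtMul V D.good x‖ₑ ^ 2 ≤
      ENNReal.ofReal (α ^ (2 - p)) * ∫⁻ x, energyDensity a V p f x := by
    rw [← lintegral_const_mul' _ _ ENNReal.ofReal_ne_top]
    refine le_trans (lintegral_mono_ae ?_) (setLIntegral_le_lintegral Ωᶜ _)
    rw [ae_restrict_iff' hΩ.compl]
    filter_upwards [hout] with x hx hxΩ
    have e : sqrtMul V D.good x = sqrtMul V f x := by
      rw [sqrtMul, sqrtMul, D.good_of_notMem hxΩ]
    rw [e]
    refine (sq_le_mul_rpow hp0 hp2 hα.le (le_add_self.trans (hx hxΩ))).trans ?_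
    gcongr
    exact le_add_self
  rw [← lintegral_add_compl _ hΩ]
  calc _ ≤ ENNReal.ofReal (K * α ^ 2) *
        (ENNReal.ofReal (κ * 5 ^ n * (α ^ p)⁻¹) * ∫⁻ x, energyDensity a V p f x) +
        ENNReal.ofReal (α ^ (2 - p)) * ∫⁻ x, energyDensity a V p f x :=
        add_le_add ((D.lintegral_good_le hΩ hV).trans (by gcongr)) h2
    _ = _ := by
        rw [← mul_assoc, ← ENNReal.ofReal_mul (by positivity), ← add_mul,
          ← ENNReal.ofReal_add (by positivity) (by positivity)]
        congr 2
        rw [Real.rpow_sub hα, Real.rpow_two]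
        field_simp
        ring

end LocalApproximation

end Energy

end MagneticCZ

/-! ### The decomposition. -/

theorem mainTheorem7 (n : ℕ) (hn : 2 ≤ n) :
    ∃ N : ℕ, ∀ p r A C₀ : ℝ, 1 ≤ p → p < 2 → 1 < r →
      ∃ C : ℝ, 0 < C ∧
        ∀ (a : MagneticCZ.E n → MagneticCZ.E n)
          (B : MagneticCZ.E n → Matrix (Fin n) (Fin n) ℝ)
          (V : MagneticCZ.E n → ℝ),
          MagneticCZ.IsL2Loc a →
          MagneticCZ.IsCurl a B →
          MagneticCZ.IsMuckenhoupt r A V →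
          MagneticCZ.FieldControlled C₀ B V →
          ∀ (f : MagneticCZ.E n → ℂ), MagneticCZ.IsTest f →
          ∀ α : ℝ, 0 < α →
            ∃ (ι : Type) (_ : Countable ι) (c : ι → MagneticCZ.E n) (R : ι → ℝ)
              (g : MagneticCZ.E n → ℂ) (b : ι → MagneticCZ.E n → ℂ)
              (Lg : MagneticCZ.E n → EuclideanSpace ℂ (Fin n))
              (Lb : ι → MagneticCZ.E n → EuclideanSpace ℂ (Fin n)),
              (∀ k, 0 < R k) ∧
              MagneticCZ.IsWeakMagGrad a g Lg ∧
              (∀ k, MagneticCZ.IsWeakMagGrad a (b k) (Lb k)) ∧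
              -- `b_k` lives on the cube `Q_k`
              (∀ k, ∀ x, x ∉ MagneticCZ.cube (c k) (R k) → b k x = 0) ∧
              -- `f = g + ∑ b_k`
              (∀ x, HasSum (fun k => b k x) (f x - g x)) ∧
              -- `‖Lg‖_∞ ≤ C α`
              (∀ᵐ x, ‖Lg x‖ ≤ C * α) ∧
              -- `‖Lg‖_2 + ‖V^{1/2} g‖_2 ≤ C α^{1-p/2} (‖Lf‖_p + ‖V^{1/2} f‖_p)^{p/2}`
              (eLpNorm Lg 2 volume + eLpNorm (MagneticCZ.sqrtMul V g) 2 volume ≤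
                ENNReal.ofReal (C * α ^ (1 - p / 2)) *
                  (eLpNorm (MagneticCZ.magGrad a f) (ENNReal.ofReal p) volume +
                    eLpNorm (MagneticCZ.sqrtMul V f) (ENNReal.ofReal p) volume) ^ (p / 2)) ∧
              -- `∫_{Q_k} |L b_k|^p + R_k^{-p} |b_k|^p ≤ C α^p |Q_k|`
              (∀ k, ∫⁻ x in MagneticCZ.cube (c k) (R k),
                  (‖Lb k x‖ₑ ^ p + ENNReal.ofReal (R k ^ (-p)) * ‖b k x‖ₑ ^ p) ≤
                ENNReal.ofReal (C * α ^ p) * volume (MagneticCZ.cube (c k) (R k))) ∧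
              -- `∑ |Q_k| ≤ C α^{-p} ∫ |Lf|^p + |V^{1/2} f|^p`
              (∑' k, volume (MagneticCZ.cube (c k) (R k)) ≤
                ENNReal.ofReal (C * α ^ (-p)) *
                  ∫⁻ x, (‖MagneticCZ.magGrad a f x‖ₑ ^ p + ‖MagneticCZ.sqrtMul V f x‖ₑ ^ p)) ∧
              -- `∑ 1_{Q_k} ≤ N`
              (∀ x, {k | x ∈ MagneticCZ.cube (c k) (R k)}.encard ≤ N) := by
  have hn0 : 0 < n := by omega
  obtain ⟨Cχ, hCχ, hwhit⟩ := MagneticCZ.exists_whitneyPartition (n := n) hn0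
  refine ⟨(120 * n) ^ n, fun p r A C₀ hp hp2 hr => ?_⟩
  have hp0 : 0 < p := by linarith
  set κ : ℝ := (20 * n) ^ n with hκ
  set N : ℕ := (120 * n) ^ n with hN
  have hκ0 : 0 ≤ κ := by positivity
  obtain ⟨K, hK, hloc⟩ := MagneticCZ.exists_local_approximation (A := A) (C₀ := C₀) n hp hp2 hr hκ0
  have hpc : 0 ≤ MagneticCZ.pairConst n p K := by unfold MagneticCZ.pairConst; positivity
  set C₁ := K + N * (10 * n * Cχ * MagneticCZ.pairConst n p K) with hC₁
  set C₂ := MagneticCZ.badConst n p K κ Cχ with hC₂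
  have hC₁0 : 0 ≤ C₁ := by positivity
  have hC₂0 : 0 ≤ C₂ := by rw [hC₂, MagneticCZ.badConst]; positivity
  set C₃ := Real.sqrt (2 * (1 + C₁ ^ 2 * 5 ^ n)) with hC₃
  set C₄ := Real.sqrt (2 * (1 + K * (κ * 5 ^ n))) with hC₄
  have hC₃0 : 0 ≤ C₃ := Real.sqrt_nonneg _
  have hC₄0 : 0 ≤ C₄ := Real.sqrt_nonneg _
  have h5 : 0 ≤ κ * 5 ^ n := by positivity
  -- The summands serve, in order: the supremum outside `Ω`, the supremum inside, the bad parts, the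
  -- two L² norms, and the total volume of the cubes.
  set C := 1 + C₁ + C₂ + (C₃ + C₄) + κ * 5 ^ n with hC
  refine ⟨C, by positivity, fun a B V ha hB hV hBV f hf α hα => ?_⟩
  have hfc : Continuous f := hf.1.continuous
  have hVl : LocallyIntegrable V := hV.2.1
  have hαp : 0 < α ^ p := Real.rpow_pos_of_pos hα p
  set w := MagneticCZ.energyDensity a V p f with hw
  have hwfin : ∫⁻ x, w x ≠ ⊤ := MagneticCZ.lintegral_energyDensity_ne_top ha hVl hf hp hp2.le
  set Ω := MagneticCZ.maximalSet w (α ^ p) with hΩ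
  have hΩo : IsOpen Ω := MagneticCZ.isOpen_maximalSet _ _
  have hvol : volume Ω ≤ ENNReal.ofReal (5 ^ n * (α ^ p)⁻¹) * ∫⁻ x, w x :=
    MagneticCZ.volume_maximalSet_le hn0 hwfin hαp
  have hvolfin : volume Ω ≠ ⊤ :=
    ne_top_of_le_ne_top (ENNReal.mul_ne_top ENNReal.ofReal_ne_top hwfin) hvol
  -- `Ω` has finite volume and the whole space does not.
  have hne : (Ωᶜ).Nonempty := by
    rw [Set.nonempty_compl]
    intro h
    have : Nonempty (Fin n) := ⟨⟨0, hn0⟩⟩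
    exact hvolfin (h ▸ measure_univ_of_isAddLeftInvariant _)
  have hout : ∀ᵐ x, x ∉ Ω → w x ≤ ENNReal.ofReal (α ^ p) :=
    MagneticCZ.ae_le_of_notMem_maximalSet hn0
      (MagneticCZ.aemeasurable_energyDensity ha hVl hf p) hwfin _
  obtain ⟨W⟩ := hwhit Ω hΩo hne hvolfin
  -- The ball around the doubled cube is not contained in `Ω`, so the mean of `w` over it is at most
  -- `α ^ p`.
  have hball : ∀ k, ∫⁻ x in MagneticCZ.cube (W.c k) (2 * (40 * W.s k)), w x ≤
      ENNReal.ofReal (κ * α ^ p) * volume (MagneticCZ.cube (W.c k) (40 * W.s k)) := by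
    intro k
    obtain ⟨ρ, hρ, hsub, hle, hnot⟩ := W.exists_ball k
    calc _ ≤ ∫⁻ x in Metric.ball (W.c k) ρ, w x := lintegral_mono_set hsub
      _ ≤ ENNReal.ofReal (α ^ p) * volume (Metric.ball (W.c k) ρ) :=
          MagneticCZ.lintegral_ball_le_of_not_subset hρ hnot
      _ ≤ ENNReal.ofReal (α ^ p) *
          (ENNReal.ofReal κ * volume (MagneticCZ.cube (W.c k) (40 * W.s k))) := by gcongr
      _ = _ := by rw [← mul_assoc, ← ENNReal.ofReal_mul hαp.le, mul_comm κ]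
  choose M gauge z hM hzM hzS hsubP hpot using fun k => hloc a B V ha hB hV hBV f hf α hα (W.c k)
    (40 * W.s k) (by linarith [W.s_pos k]) (hball k)
  let D : MagneticCZ.LocalApproximation W a V f p α K :=
    ⟨M, gauge, z, hM, hzM, hzS, hsubP, hpot⟩
  have hin := D.ae_norm_goodGrad_le hn0 hp hα hK hfc
  have hbad : ∀ k, ∫⁻ x in W.Q k, (‖D.badGrad k x‖ₑ ^ p +
      ENNReal.ofReal ((40 * W.s k) ^ (-p)) * ‖D.bad k x‖ₑ ^ p) ≤
      ENNReal.ofReal (C₂ * α ^ p) * volume (W.Q k) := fun k =>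
    D.lintegral_badGrad_le hp hp2.le hα hK hfc hκ0 k
      ((lintegral_mono_set (MagneticCZ.cube_subset_cube _ (by linarith [W.s_pos k]))).trans
        (hball k))
  have hsumQ : ∑' k, volume (W.Q k) ≤ ENNReal.ofReal (κ * 5 ^ n * (α ^ p)⁻¹) * ∫⁻ x, w x := by
    refine W.tsum_volume_le.trans ?_
    calc ENNReal.ofReal κ * volume Ω
        ≤ ENNReal.ofReal κ * (ENNReal.ofReal (5 ^ n * (α ^ p)⁻¹) * ∫⁻ x, w x) := by gcongr
      _ = _ := by rw [← mul_assoc, ← ENNReal.ofReal_mul hκ0, mul_assoc κ]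
  have hsumfin : ∑' k, volume (W.Q k) ≠ ⊤ :=
    ne_top_of_le_ne_top (ENNReal.mul_ne_top ENNReal.ofReal_ne_top hwfin) hsumQ
  have hI := MagneticCZ.lintegral_rpow_add_le (f := MagneticCZ.magGrad a f) hp
    (MagneticCZ.aestronglyMeasurable_sqrtMul hVl hfc.aestronglyMeasurable)
  refine ⟨W.ι, W.countable, W.c, fun k => 40 * W.s k, D.good, D.bad, D.goodGrad, D.badGrad,
    fun k => by linarith [W.s_pos k], ?_, D.isWeakMagGrad_bad ha hf,
    fun k x hx => D.bad_eq_zero hx, fun x => ?_, ?_, ?_, fun k => ?_, ?_, W.encard_le⟩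
  · exact D.isWeakMagGrad_good ha hf (D.tsum_lintegral_badGrad_ne_top hp hsumfin hbad)
  · rw [D.good_eq, sub_sub_cancel]
    exact D.hasSum_bad x
  · filter_upwards [hin, hout] with x h1 h2
    by_cases hx : x ∈ Ω
    · refine (h1 hx).trans ?_
      gcongr
      rw [hC]; linarith
    · rw [D.goodGrad_of_notMem hx]
      have h3 := MagneticCZ.le_ofReal_of_rpow_le hp0 hα.le
        ((le_self_add (b := ‖MagneticCZ.sqrtMul V f x‖ₑ ^ p)).trans (h2 hx))
      rw [← ofReal_norm, ENNReal.ofReal_le_ofReal_iff hα.le] at h3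
      refine h3.trans (le_mul_of_one_le_left hα.le ?_)
      rw [hC]; linarith
  · have h1 := MagneticCZ.eLpNorm_two_le (by positivity) hα
      (D.lintegral_goodGrad_sq_le hΩo.measurableSet hp hp2.le hα hout hin hvol) hI
    have h2 := MagneticCZ.eLpNorm_two_le (by positivity) hα
      (D.lintegral_sqrtMul_good_sq_le hΩo.measurableSet hp hp2.le hα hK hκ0 hVl hout hsumQ) hI
    refine (add_le_add h1 h2).trans ?_
    rw [← add_mul, ← ENNReal.ofReal_add (by positivity) (by positivity), ← add_mul]
    gcongr
    rw [hC]; linarith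
  · refine (hbad k).trans ?_
    change _ ≤ ENNReal.ofReal (C * α ^ p) * volume (W.Q k)
    gcongr
    rw [hC]; linarith
  · refine hsumQ.trans ?_
    rw [Real.rpow_neg hα.le]
    gcongr
    · rw [hC]; linarith
    · exact le_rfl
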